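/- **Setting.** Let $k$ be an algebraically closed field of arbitrary characteristic and let $\mathcal C$ be a modular tensor category over $k$, that is, a braided fusion category with a spherical structure whose $S$-matrix $s_{ij}=\mathrm{tr}(c_{V_j,V_i^*}c_{V_i^*,V_j})$ is invertible. Here $(V_j)_{j\in I}$ are representatives of the isomorphism classes of simple objects, and $d_j=\dim V_j\in k$ are their quantum dimensions. Then the forgetful functor $F:\mathcal Z(\mathcal C)\to\mathcal C$ of the Drinfeld center has a right adjoint $R$. Put $A=FR(\mathbf 1)$, with its algebra structure $(m,u)$, $\mathrm{CF}(\mathcal C)=\mathrm{Hom}(A,\mathbf 1)$ and $\mathrm{CE}(\mathcal C)=\mathrm{Hom}(\mathbf 1,A)$. The canonical map $\mathrm{CE}(\mathcal C)\to\mathrm{End}(\mathrm{id}_{\mathcal C})$ is bijective. Let $E_j\in\mathrm{CE}(\mathcal C)$ be the element that acts as the identity on $V_j$ and as zero on $V_i$ for $i\ne j$, and let $\mathcal S$ be the antipodal operator of $\mathrm{CE}(\mathcal C)$, induced by $\xi\mapsto\xi^!$, $\xi^!_X=(\xi_{{}^*X})^*$. A cointegral of a fusion category is a class function $\lambda$ with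 $Z(\lambda)\circ\delta_{\mathbf 1}=u\circ\lambda$, where $Z=FR$ is the central comonad and $\delta$ its comultiplication. There is exactly one cointegral $\lambda$ of $\mathcal C$ with $\lambda\circ u=\mathrm{id}_{\mathbf 1}$, and its Fourier transform $\mathcal F_\lambda:\mathrm{CE}(\mathcal C)\to\mathrm{CF}(\mathcal C)$, $a\mapsto\lambda\circ m\circ(\mathcal S(a)\otimes\mathrm{id}_A)$, is bijective. The object $R(\mathbf 1)$ is a direct sum of $|I|$ simple objects of $\mathcal Z(\mathcal C)$, the conjugacy classes. In any decomposition of $R(\mathbf 1)$ into simple objects, the summands can be labelled in exactly one way as $\mathfrak C^j$, $j\in I$, so that $f_Q(F_j)=E_j$ for all $j$. Here $F_j\in\mathrm{CF}(\mathcal C)\cong\mathrm{End}(R(\mathbf 1))$ corresponds to the projection onto $\mathfrak C^j$, and $f_Q:\mathrm{CF}(\mathcal C)\to\mathrm{CE}(\mathcal C)$ is the Drinfeld map. Let $|\mathfrak C^j|\in k$ be the pivotal dimension of $\mathfrak C^j$ and let $\overline{\mathfrak C}_j=\mathcal F_\lambda^{-1}(F_j)$ be the conjugacy class sums. For a fusion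 subcategory $\mathcal E\subseteq\mathcal C$ let $\lambda_{\mathcal E}\in\mathrm{CF}(\mathcal C)$ be the image of the (existing and unique) cointegral of $\mathcal E$ with $\lambda_{\mathcal E}\circ u_{\mathcal E}=\mathrm{id}_{\mathbf 1}$ under the canonical map $\mathrm{CF}(\mathcal E)\to\mathrm{CF}(\mathcal C)$, and put $\ell_{\mathcal E}=\mathcal F_\lambda^{-1}(\lambda_{\mathcal E})$. Let $\mathcal L_{\mathcal E}\subseteq I$ be the subset with $\lambda_{\mathcal E}=\sum_{j\in\mathcal L_{\mathcal E}}F_j$, if there is one (it is then unique). For a fusion subcategory $\mathcal D$ let $\mathcal D'$ be its centralizer, the fusion subcategory generated by the simple objects $X$ with $c_{Y,X}c_{X,Y}=\mathrm{id}_{X\otimes Y}$ for all $Y\in\mathcal D$. **Theorem.** With these notations (all existence and uniqueness assertions above being part of the claim; those on $\lambda_{\mathcal E}$ for $\mathcal E=\mathcal D'$): 1. $|\mathfrak C^j|=d_j^2$ for all $j\in I$. 2. For every fusion subcategory $\mathcal D$ of $\mathcal C$, $$\ell_{\mathcal D'}=\sum_{j:\,V_j\in\mathcal D}\overline{\mathfrak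 C}_j,$$ and $\mathcal L_{\mathcal D'}$ exists and equals $\{j\in I: V_j\in\mathcal D\}$. -/

import Mathlib

open CategoryTheory CategoryTheory.Limits MonoidalCategory

universe w v u v' u'

noncomputable section

namespace FusionCat

/-! ## The right adjoint of the forgetful functor of the Drinfeld center, and the adjoint algebra

`R` is a right adjoint of the forgetful functor `F : Z(𝒟) ⥤ 𝒟`, and `A = F R(1)`. -/

section AdjointAlgebra

variable {𝒟 : Type u} [Category.{v} 𝒟] [MonoidalCategory 𝒟]

/-- The half-braiding of an object of the center, on the underlying object. -/
def halfBraid (Z : Center 𝒟) (X : 𝒟) :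
    (Center.forget 𝒟).obj Z ⊗ X ≅ X ⊗ (Center.forget 𝒟).obj Z :=
  Z.2.β X

lemma halfBraid_naturality (Z : Center 𝒟) {X Y : 𝒟} (f : X ⟶ Y) :
    (Center.forget 𝒟).obj Z ◁ f ≫ (halfBraid Z Y).hom =
      (halfBraid Z X).hom ≫ f ▷ (Center.forget 𝒟).obj Z :=
  Z.2.naturality f

/-- The adjoint algebra `A = F R(1)`. -/
abbrev adjAlg (R : 𝒟 ⥤ Center 𝒟) : 𝒟 :=
  (Center.forget 𝒟).obj (R.obj (𝟙_ 𝒟))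

/-- The space of class functions `CF(𝒟) = Hom(A, 1)`. -/
abbrev CF (R : 𝒟 ⥤ Center 𝒟) : Type v := adjAlg R ⟶ 𝟙_ 𝒟

/-- The space of central elements `CE(𝒟) = Hom(1, A)`. -/
abbrev CE (R : 𝒟 ⥤ Center 𝒟) : Type v := 𝟙_ 𝒟 ⟶ adjAlg R

variable {R : 𝒟 ⥤ Center 𝒟} (adj : Center.forget 𝒟 ⊣ R)

/-- The canonical action `A ⊗ X ⟶ X`: the half-braiding of `R(1)` followed by the counit
`A ⟶ 1` of the adjunction.  Under the duality `Hom(A ⊗ X, X) = Hom(A, X ⊗ X*)` it is the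
universal dinatural map `π_X : A ⟶ X ⊗ X*` of the end `A`. -/
def action (X : 𝒟) : adjAlg R ⊗ X ⟶ X :=
  (halfBraid (R.obj (𝟙_ 𝒟)) X).hom ≫ X ◁ adj.counit.app (𝟙_ 𝒟) ≫ (ρ_ X).hom

/-- The unit `u : 1 ⟶ A` of the adjoint algebra: the underlying morphism of the morphism
`1 ⟶ R(1)` of `Z(𝒟)` that is adjoint to the identity of the unit object. -/
def algUnit : CE R :=
  Functor.LaxMonoidal.ε (Center.forget 𝒟) ≫
    (Center.forget 𝒟).map
      (adj.homEquiv (𝟙_ (Center 𝒟)) (𝟙_ 𝒟) (Functor.OplaxMonoidal.η (Center.forget 𝒟)))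

/-- The multiplication `m : A ⊗ A ⟶ A` of the adjoint algebra, which comes from the lax monoidal
structure of the right adjoint `R` of the strong monoidal functor `F`. -/
def algMul : adjAlg R ⊗ adjAlg R ⟶ adjAlg R :=
  Functor.LaxMonoidal.μ (Center.forget 𝒟) (R.obj (𝟙_ 𝒟)) (R.obj (𝟙_ 𝒟)) ≫
    (Center.forget 𝒟).map
      (adj.homEquiv (R.obj (𝟙_ 𝒟) ⊗ R.obj (𝟙_ 𝒟)) (𝟙_ 𝒟)
        (Functor.OplaxMonoidal.δ (Center.forget 𝒟) _ _ ≫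
          (adj.counit.app (𝟙_ 𝒟) ⊗ₘ adj.counit.app (𝟙_ 𝒟)) ≫ (λ_ (𝟙_ 𝒟)).hom))

/-- The canonical map `CE(𝒟) → End(id_𝒟)`: a central element acts on every object. -/
def toNat (a : CE R) : 𝟭 𝒟 ⟶ 𝟭 𝒟 where
  app X := (λ_ X).inv ≫ a ▷ X ≫ action adj X
  naturality X Y f := by
    have h := halfBraid_naturality (R.obj (𝟙_ 𝒟)) f
    simp only [Functor.id_map, Functor.id_obj, action, Category.assoc]
    rw [← rightUnitor_naturality, whisker_exchange_assoc, ← reassoc_of% h,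
      ← whisker_exchange_assoc, leftUnitor_inv_naturality_assoc]

/-- A cointegral is a class function `lam` with `Z(lam) ∘ δ = u ∘ lam`, where `Z = F R` is the
central comonad and `δ : A ⟶ Z(A)` its comultiplication at the unit object.  It is normalized
by `⟨lam, u⟩ = 1`.  Since `lam ⋆ lam = ⟨lam, u⟩ lam` for the product
`f ⋆ g = f ∘ Z(g) ∘ δ` of `CF(𝒟)`, this is the nonzero idempotent cointegral. -/
structure IsIdempotentCointegral (lam : CF R) : Prop where
  cointegral : adj.toComonad.δ.app (𝟙_ 𝒟) ≫ (Center.forget 𝒟).map (R.map lam) =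
    lam ≫ algUnit adj
  normalized : algUnit adj ≫ lam = 𝟙 (𝟙_ 𝒟)

end AdjointAlgebra

/-! ## Antipode of `CE` and Fourier transform -/

section Fourier

variable {𝒟 : Type u} [Category.{v} 𝒟] [MonoidalCategory 𝒟]

/-- For `f : *Y ⟶ *X`, the dual morphism `f* : X = (*X)* ⟶ (*Y)* = Y`. -/
def dualOfLeft [LeftRigidCategory 𝒟] {X Y : 𝒟} (f : (ᘁY : 𝒟) ⟶ (ᘁX : 𝒟)) : X ⟶ Y :=
  @rightAdjointMate 𝒟 _ _ (ᘁY) (ᘁX) hasRightDualLeftDual hasRightDualLeftDual f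

lemma dualOfLeft_comp [LeftRigidCategory 𝒟] {X Y Z : 𝒟} (f : (ᘁZ : 𝒟) ⟶ (ᘁY : 𝒟))
    (g : (ᘁY : 𝒟) ⟶ (ᘁX : 𝒟)) : dualOfLeft (f ≫ g) = dualOfLeft g ≫ dualOfLeft f :=
  @comp_rightAdjointMate 𝒟 _ _ (ᘁZ) (ᘁY) (ᘁX) hasRightDualLeftDual hasRightDualLeftDual
    hasRightDualLeftDual f g

lemma dualOfLeft_leftAdjointMate [LeftRigidCategory 𝒟] {X Y : 𝒟} (g : X ⟶ Y) :
    dualOfLeft (leftAdjointMate g) = g := by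
  have h : η_ (ᘁX : 𝒟) X ≫ (ᘁX : 𝒟) ◁ dualOfLeft (leftAdjointMate g) =
      η_ (ᘁX : 𝒟) X ≫ (ᘁX : 𝒟) ◁ g :=
    (@coevaluation_comp_rightAdjointMate 𝒟 _ _ (ᘁY) (ᘁX) hasRightDualLeftDual
      hasRightDualLeftDual (leftAdjointMate g)).trans (coevaluation_comp_leftAdjointMate g)
  have h' := congrArg (tensorLeftHomEquiv _ (ᘁX : 𝒟) X _).symm h
  rwa [tensorLeftHomEquiv_symm_coevaluation_comp_whiskerLeft,
    tensorLeftHomEquiv_symm_coevaluation_comp_whiskerLeft, cancel_epi] at h'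

/-- The operation `ξ ↦ ξ^!` on endomorphisms of the identity functor, `ξ^!_X = (ξ_{*X})*`. -/
def dualNat [LeftRigidCategory 𝒟] (ξ : 𝟭 𝒟 ⟶ 𝟭 𝒟) : 𝟭 𝒟 ⟶ 𝟭 𝒟 where
  app X := dualOfLeft (ξ.app (ᘁX))
  naturality X Y f := by
    have h := ξ.naturality (leftAdjointMate f)
    simp only [Functor.id_map, Functor.id_obj] at h ⊢
    have h' := congrArg dualOfLeft h
    rw [dualOfLeft_comp, dualOfLeft_comp, dualOfLeft_leftAdjointMate] at h'
    exact h'.symm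

variable [Preadditive 𝒟] [LeftRigidCategory 𝒟] {R : 𝒟 ⥤ Center 𝒟}
  (adj : Center.forget 𝒟 ⊣ R)

/-- The central element that corresponds to an endomorphism of the identity functor
under the canonical map `CE(𝒟) → End(id_𝒟)` (used when that map is bijective). -/
def ofNat (ξ : 𝟭 𝒟 ⟶ 𝟭 𝒟) : CE R := Function.invFun (toNat adj) ξ

/-- The antipodal operator of `CE(𝒟)`. -/
def antipode (a : CE R) : CE R := ofNat adj (dualNat (toNat adj a))

/-- The Fourier transform `a ↦ lam ↼ S(a) = lam ∘ m ∘ (S(a) ⊗ id_A)`. -/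
def fourier (lam : CF R) (a : CE R) : CF R :=
  (λ_ (adjAlg R)).inv ≫ antipode adj a ▷ adjAlg R ≫ algMul adj ≫ lam

/-- The inverse of the Fourier transform (used when the latter is bijective). -/
def fourierInv (lam : CF R) (f : CF R) : CE R := Function.invFun (fourier adj lam) f

end Fourier

/-! ## The Drinfeld map of a braided category -/

section Drinfeld

variable {C : Type u} [Category.{v} C] [MonoidalCategory C] [BraidedCategory C]

variable (C) in
/-- The functor `C ⥤ Z(C)` given by the inverse braiding. -/
def ofInverseBraiding : C ⥤ Center C where
  obj X := ⟨X, { β := fun Y => (β_ Y X).symm }⟩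
  map f := { f := f }

variable [RightRigidCategory C]

/-- `Y* ⊗ Y` as an object of the center; `Y*` carries the braiding, `Y` the inverse braiding. -/
def hopfObj (Y : C) : Center C :=
  (Center.ofBraided C).obj Yᘁ ⊗ (ofInverseBraiding C).obj Y

variable {R : C ⥤ Center C} (adj : Center.forget C ⊣ R)

/-- The Drinfeld map `Q`, composed with the map `Y* ⊗ Y ⟶ L(1)` to the coend `L(1)`:
the morphism `Q_Y : Y* ⊗ Y ⟶ A` that comes from the morphism of `Z(C)` adjoint to the
evaluation of `Y`.  Acting with it on `X` gives the map `Y* ⊗ Y ⊗ X ⟶ X` that is the inverse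
double braiding of `Y` and `X` followed by the evaluation of `Y`, i.e. the Hopf link map; with
this convention `f_Q(χ_i) = ∑ (s_ij / d_j) E_j` for the S-matrix below. -/
def drinfeldQ (Y : C) : Yᘁ ⊗ Y ⟶ adjAlg R :=
  (Center.forget C).map (adj.homEquiv (hopfObj Y) (𝟙_ C) (ε_ Y Yᘁ))

lemma drinfeldQ_dinatural {Y W : C} (g : Y ⟶ W) :
    rightAdjointMate g ▷ Y ≫ drinfeldQ adj Y = Wᘁ ◁ g ≫ drinfeldQ adj W := by
  let a : (Center.ofBraided C).obj Wᘁ ⊗ (ofInverseBraiding C).obj Y ⟶ hopfObj Y :=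
    (Center.ofBraided C).map (rightAdjointMate g) ▷ (ofInverseBraiding C).obj Y
  let b : (Center.ofBraided C).obj Wᘁ ⊗ (ofInverseBraiding C).obj Y ⟶ hopfObj W :=
    (Center.ofBraided C).obj Wᘁ ◁ (ofInverseBraiding C).map g
  have h : (Center.forget C).map a ≫ ε_ Y Yᘁ = (Center.forget C).map b ≫ ε_ W Wᘁ :=
    rightAdjointMate_comp_evaluation g
  have h' := congrArg (adj.homEquiv _ (𝟙_ C)) h
  have h1 := adj.homEquiv_naturality_left a (ε_ Y Yᘁ)
  have h2 := adj.homEquiv_naturality_left b (ε_ W Wᘁ)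
  have h3 := congrArg (Center.forget C).map (h1.symm.trans (h'.trans h2))
  rw [Functor.map_comp, Functor.map_comp] at h3
  exact h3

/-- The endomorphism of the identity functor that corresponds to the image of the class
function `f` under the Drinfeld map: `Y ⟶ Y ⊗ Y* ⊗ Y ⟶ Y ⊗ A ⟶ Y`. -/
def drinfeldNat (f : CF R) : 𝟭 C ⟶ 𝟭 C where
  app Y := (λ_ Y).inv ≫ η_ Y Yᘁ ▷ Y ≫ (α_ Y Yᘁ Y).hom ≫ Y ◁ (drinfeldQ adj Y ≫ f) ≫ (ρ_ Y).hom
  naturality Y W g := by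
    have h1 := drinfeldQ_dinatural adj g
    have h2 := coevaluation_comp_rightAdjointMate g
    simp only [Functor.id_map, Functor.id_obj]
    calc
      _ = (λ_ Y).inv ≫ (η_ W Wᘁ ▷ Y) ≫ (α_ W Wᘁ Y).hom ≫
            W ◁ ((Wᘁ ◁ g ≫ drinfeldQ adj W) ≫ f) ≫ (ρ_ W).hom := by
        rw [leftUnitor_inv_naturality_assoc, whisker_exchange_assoc]; simp
      _ = (λ_ Y).inv ≫ (η_ W Wᘁ ≫ W ◁ rightAdjointMate g) ▷ Y ≫ (α_ W Yᘁ Y).hom ≫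
            W ◁ (drinfeldQ adj Y ≫ f) ≫ (ρ_ W).hom := by
        rw [← h1]; simp
      _ = _ := by
        rw [h2]
        simp only [comp_whiskerRight, Category.assoc, associator_naturality_left_assoc]
        rw [← whisker_exchange_assoc, rightUnitor_naturality]

/-- The Drinfeld map `f_Q : CF(C) → CE(C)`. -/
def drinfeldMap [Preadditive C] (f : CF R) : CE R :=
  Function.invFun (toNat adj) (drinfeldNat adj f)

end Drinfeld

/-! ## Conjugacy classes -/

section Conjugacy

variable {C : Type u} [Category.{v} C] [MonoidalCategory C] [Preadditive C]
  [MonoidalPreadditive C]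

instance centerHomZero (X Y : Center C) : Zero (X ⟶ Y) := ⟨⟨0, fun U => by simp⟩⟩

instance centerHomAdd (X Y : Center C) : Add (X ⟶ Y) :=
  ⟨fun f g => ⟨f.f + g.f, fun U => by
    rw [MonoidalPreadditive.add_whiskerRight, MonoidalPreadditive.whiskerLeft_add,
      Preadditive.add_comp, Preadditive.comp_add, f.comm, g.comm]⟩⟩

instance centerHomNeg (X Y : Center C) : Neg (X ⟶ Y) :=
  ⟨fun f => ⟨-f.f, fun U => by
    have h1 : (-f.f) ▷ U = -(f.f ▷ U) := ((tensoringRight C).obj U).map_neg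
    have h2 : U ◁ (-f.f) = -(U ◁ f.f) := ((tensoringLeft C).obj U).map_neg
    rw [h1, h2, Preadditive.neg_comp, Preadditive.comp_neg, f.comm]⟩⟩

/-- The Drinfeld center of a preadditive monoidal category is preadditive: morphisms are
added as morphisms of the underlying objects. -/
instance centerPreadditive : Preadditive (Center C) where
  homGroup X Y :=
    { add_assoc := fun f g h => Center.ext _ _ (add_assoc f.f g.f h.f)
      zero_add := fun f => Center.ext _ _ (zero_add f.f)
      add_zero := fun f => Center.ext _ _ (add_zero f.f)
      add_comm := fun f g => Center.ext _ _ (add_comm f.f g.f)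
      neg_add_cancel := fun f => Center.ext _ _ (neg_add_cancel f.f)
      nsmul := nsmulRec
      zsmul := zsmulRec }
  add_comp X Y Z f g h := Center.ext _ _ (Preadditive.add_comp _ _ _ f.f g.f h.f)
  comp_add X Y Z f g h := Center.ext _ _ (Preadditive.comp_add _ _ _ f.f g.f h.f)

/-- A decomposition of `R(1)` into a direct sum of simple objects of the center `Z(C)`,
the conjugacy classes of `C`. -/
structure ConjugacyClasses (R : C ⥤ Center C) (κ : Type w) [Fintype κ] where
  /-- the conjugacy classes -/
  cls : κ → Center C
  simple : ∀ i, Simple (cls i)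
  incl : ∀ i, cls i ⟶ R.obj (𝟙_ C)
  proj : ∀ i, R.obj (𝟙_ C) ⟶ cls i
  incl_proj_self : ∀ i, incl i ≫ proj i = 𝟙 (cls i)
  incl_proj_ne : ∀ i j, i ≠ j → incl i ≫ proj j = 0
  sum_proj_incl : ∑ i, proj i ≫ incl i = 𝟙 (R.obj (𝟙_ C))

variable {R : C ⥤ Center C} (adj : Center.forget C ⊣ R) {κ : Type w} [Fintype κ]

/-- The idempotent `F_i ∈ CF(C)` of a conjugacy class: it corresponds to the projection of `R(1)`
onto that class under the adjunction isomorphism `Hom(F R(1), 1) = End(R(1))`. -/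
def ConjugacyClasses.idem (K : ConjugacyClasses R κ) (i : κ) : CF R :=
  (adj.homEquiv (R.obj (𝟙_ C)) (𝟙_ C)).symm (K.proj i ≫ K.incl i)

/-- The conjugacy class sum, the preimage of `F_i` under the Fourier transform of `lam`. -/
def ConjugacyClasses.classSum [LeftRigidCategory C] (K : ConjugacyClasses R κ) (lam : CF R)
    (i : κ) : CE R :=
  fourierInv adj lam (K.idem adj i)

/-- `e` is the primitive idempotent `E_j` of `CE(C)` of the simple object `V_j`: the central
element that acts as the identity on `V_j` and as zero on the other simple objects. -/
def IsCentralIdempotent {ι : Type w} [DecidableEq ι] (V : ι → C) (j : ι) (e : CE R) : Prop :=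
  ∀ i, (toNat adj e).app (V i) = if i = j then 𝟙 (V i) else 0

end Conjugacy

/-! ## Pivotal and spherical structures, dimensions, the S-matrix -/

section Pivotal

variable (C : Type u) [Category.{v} C] [MonoidalCategory C] [RightRigidCategory C]

variable {C} in
/-- The double dual `X**` of an object. -/
abbrev doubleDual (X : C) : C := HasRightDual.rightDual (HasRightDual.rightDual X)

/-- A pivotal structure: a monoidal natural isomorphism `id ⟶ (-)**`.  The monoidal structure of
the functor `(-)**` is given by the canonical isomorphisms
`(X ⊗ Y)** = (Y* ⊗ X*)* = X** ⊗ Y**`.  (Compatibility with the unit object follows.) -/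
structure PivotalStructure where
  /-- the components of the isomorphism -/
  iso : ∀ X : C, X ≅ doubleDual X
  naturality : ∀ {X Y : C} (f : X ⟶ Y),
    f ≫ (iso Y).hom = (iso X).hom ≫ rightAdjointMate (rightAdjointMate f)
  monoidal : ∀ X Y : C,
    (iso (X ⊗ Y)).hom ≫ rightAdjointMate (rightDualTensorIso X Y).inv ≫
      (rightDualTensorIso Yᘁ Xᘁ).hom = (iso X).hom ⊗ₘ (iso Y).hom

variable {C}

/-- The (right) pivotal trace of an endomorphism, an endomorphism of the unit object. -/
def PivotalStructure.trace (p : PivotalStructure C) {X : C} (f : X ⟶ X) : 𝟙_ C ⟶ 𝟙_ C :=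
  η_ X Xᘁ ≫ (f ≫ (p.iso X).hom) ▷ Xᘁ ≫ ε_ Xᘁ (doubleDual X)

variable (C) in
/-- A spherical structure: a pivotal structure with `dim X = dim X*` for all `X`. -/
structure SphericalStructure extends PivotalStructure C where
  spherical : ∀ X : C, toPivotalStructure.trace (𝟙 X) = toPivotalStructure.trace (𝟙 Xᘁ)

variable (k : Type w) [Field k] [Preadditive C] [Linear k C]

/-- The scalar `c` with `f = c • 𝟙`, for an endomorphism `f` of the unit object. -/
def scalar (f : 𝟙_ C ⟶ 𝟙_ C) : k := Function.invFun (fun c : k => c • 𝟙 (𝟙_ C)) f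

/-- The pivotal (quantum) dimension of an object. -/
def PivotalStructure.dim (p : PivotalStructure C) (X : C) : k := scalar k (p.trace (𝟙 X))

/-- The S-matrix of a family of objects,
the quantum trace of the monodromy `V_i* ⊗ V_j ⟶ V_j ⊗ V_i* ⟶ V_i* ⊗ V_j`. -/
def PivotalStructure.sMatrix [BraidedCategory C] (p : PivotalStructure C)
    {ι : Type u'} (V : ι → C) : Matrix ι ι k :=
  fun i j => scalar k (p.trace ((β_ (V i)ᘁ (V j)).hom ≫ (β_ (V j) (V i)ᘁ).hom))

/-- The size of a conjugacy class: its pivotal dimension in the center.  Duals, evaluations,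
coevaluations and the pivotal structure of the center are those of the underlying objects, and so
this is the dimension of the underlying object. -/
def ConjugacyClasses.size [MonoidalPreadditive C] (p : PivotalStructure C) {R : C ⥤ Center C}
    {κ : Type u'} [Fintype κ] (K : ConjugacyClasses R κ) (i : κ) : k :=
  p.dim k ((Center.forget C).obj (K.cls i))

end Pivotal

/-! ## Fusion categories and fusion subcategories -/

section Fusion

/-- `V` is a complete set of representatives of the isomorphism classes of simple objects. -/
structure IsSimpleFamily {C : Type u} [Category.{v} C] [HasZeroMorphisms C] {ι : Type u'}
    (V : ι → C) : Prop where
  simple : ∀ i, Simple (V i)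
  distinct : ∀ i j, Nonempty (V i ≅ V j) → i = j
  complete : ∀ X : C, Simple X → ∃ i, Nonempty (X ≅ V i)

/-- A fusion category over `k` is a `k`-linear abelian rigid monoidal category with `k`-bilinear
tensor product (these are instance arguments) and finite-dimensional spaces of morphisms, such that
every object is a finite direct sum of simple objects, there are only finitely many
simple objects up to isomorphism, and `End(1) = k`. -/
structure IsFusion (k : Type w) [Field k] (C : Type u) [Category.{v} C] [Abelian C] [Linear k C]
    [MonoidalCategory C] [MonoidalPreadditive C] [MonoidalLinear k C] [RigidCategory C] :
    Prop where
  finiteDimensional : ∀ X Y : C, FiniteDimensional k (X ⟶ Y)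
  semisimple : ∀ X : C, ∃ (n : ℕ) (S : Fin n → C), (∀ i, Simple (S i)) ∧
    (haveI := Abelian.hasFiniteBiproducts (C := C); Nonempty (X ≅ ⨁ S))
  finite : ∃ (n : ℕ) (V : Fin n → C), IsSimpleFamily V
  end_unit : Function.Bijective (fun c : k => c • 𝟙 (𝟙_ C))

variable (C : Type u) [Category.{v} C] [Abelian C] [MonoidalCategory C] [RigidCategory C]

/-- A fusion subcategory: a full subcategory that contains the unit object and is closed under
tensor products, direct sums, direct summands (hence isomorphic objects) and duals. -/
structure FusionSubcategory where
  /-- the objects of the subcategory -/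
  prop : ObjectProperty C
  isMonoidal : prop.IsMonoidal
  retract : prop.IsStableUnderRetracts
  biprod : ∀ X Y : C, prop X → prop Y → prop (X ⊞ Y)
  dual : ∀ X : C, prop X → prop Xᘁ

variable {C}

/-- The smallest fusion subcategory that contains the objects in `S`. -/
def FusionSubcategory.generated (S : ObjectProperty C) : FusionSubcategory C where
  prop X := ∀ E : FusionSubcategory C, (∀ Y, S Y → E.prop Y) → E.prop X
  isMonoidal :=
    { prop_unit := fun E _ => E.isMonoidal.prop_unit
      prop_tensor := fun X Y hX hY E hE => E.isMonoidal.prop_tensor X Y (hX E hE) (hY E hE) }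
  retract := ⟨fun r hY E hE => E.retract.of_retract r (hY E hE)⟩
  biprod X Y hX hY E hE := E.biprod X Y (hX E hE) (hY E hE)
  dual X hX E hE := E.dual X (hX E hE)

/-- The centralizer `D'`: the fusion subcategory generated by the simple objects `X`
that centralize every object `Y` of `D`, i.e. the double braiding of `X` and `Y` is trivial. -/
def FusionSubcategory.centralizer [BraidedCategory C] (D : FusionSubcategory C) :
    FusionSubcategory C :=
  .generated fun X => Simple X ∧ ∀ Y, D.prop Y → (β_ X Y).hom ≫ (β_ Y X).hom = 𝟙 (X ⊗ Y)

/-- `mu ∈ CF(C)` is (the image in `CF(C)` of) the idempotent cointegral `lamD ∈ CF(D)` of the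
fusion subcategory `D`.  The inclusion `CF(D) ⟶ CF(C)` is the composition with the
canonical morphism `q` from the adjoint algebra of `C` to that of `D`, which is compatible
with the universal dinatural maps, equivalently with the canonical actions on the objects of `D`. -/
def IsIdempotentCointegralOf {R : C ⥤ Center C} (adj : Center.forget C ⊣ R)
    (D : FusionSubcategory C) (mu : CF R) : Prop :=
  haveI := D.isMonoidal
  ∃ (RD : D.prop.FullSubcategory ⥤ Center D.prop.FullSubcategory)
    (adjD : Center.forget D.prop.FullSubcategory ⊣ RD) (lamD : CF RD)
    (q : adjAlg R ⟶ (adjAlg RD).obj),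
    IsIdempotentCointegral adjD lamD ∧
    (∀ X : D.prop.FullSubcategory, q ▷ X.obj ≫ (action adjD X).hom = action adj X.obj) ∧
    mu = q ≫ lamD.hom

end Fusion

end FusionCat

end

set_option linter.unusedSectionVars false

/-! In a modular category `R(1)` is the direct sum of the objects `V_j* ⊗ V_j`, where `V_j*` carries
the braiding and `V_j` the inverse braiding. Everything is read off from the inclusions `Q_j : V_j*
⊗ V_j ⟶ A` given by `drinfeldQ`. A class function `f` satisfies `f ∘ Q_j = c_j(f) · ev` for a scalar
`c_j(f)` (`drinfeldCoeff`, `drinfeldQ_comp`), and `f_Q(f) = ∑ c_j(f) E_j`. The characters span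
`CF(C)` and `c_j(χ_i) = s_ij / d_j`. Hence invertibility of the S-matrix makes `f ↦ (c_j(f))_j`
bijective (`drinfeldCoeff_injective`, `exists_drinfeldCoeff_eq`), and identities between class
functions become comparisons of coefficient vectors.

The topological input is the handle slide `sum_ptr_tensor`: the weighted loop `∑ d_i V_i` over the
simple objects of a fusion subcategory `D` absorbs strands from `D`. Such a loop therefore kills
every simple object outside `D'` and multiplies those in `D'` by the global dimension of `D`
(`sum_dim_mul_ring`). In matrix form (`dimVector_vecMul_sMatrix`), with the S-matrix injective, this
shows in every characteristic that all global dimensions of fusion subcategories are nonzero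
(`globalDim_ne_zero`) and that `D'' = D` (`centralizing_centralizing`).

A normalized cointegral is a normalized class function that commutes with the half-braiding of `A`
(`isIdempotentCointegral_iff`). It exists as the regular character divided by the global dimension;
the handle slide gives its centrality (`regTrace_action`). For the image of the cointegral of a
fusion subcategory `E`, centrality forces `c_j = 0` unless `V_j` centralizes `E`, and normalization
forces `c_j = 1` if it does (`drinfeldCoeff_restriction`). This proves uniqueness, and for `E = D'`
the double centralizer theorem turns the coefficients into the indicator of `{j : V_j ∈ D}`.

For the conjugacy classes, nonvanishing of the global dimension gives a Maschke argument in the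
center (`exists_central_regular`), which splits off the objects `V_j* ⊗ V_j` and shows that they are
simple (`exists_drinfeldQ_decomposition`, `simple_hopfObj`). In an arbitrary decomposition the
idempotents `F_i` have orthogonal coefficients in `{0, 1}` with sum `1`. This labels the summands,
identifies the one labelled `j` with `V_j* ⊗ V_j`, and gives its dimension `d_j²`. The Fourier
transform is additive and bijective (`fourier_bijective`), so `λ_{D'} = ∑ F_j` becomes the formula
for the class sums. -/

noncomputable section

namespace FusionCat

section

/-! ### Partial traces in a pivotal category -/

section PartialTrace

variable {C : Type u} [Category.{v} C] [MonoidalCategory C]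

/-- Two exact pairings with the same evaluation have the same coevaluation. -/
lemma coevaluation_eq_of_evaluation_eq {X Y : C} (P Q : ExactPairing X Y)
    (h : @ExactPairing.evaluation C _ _ X Y P = @ExactPairing.evaluation C _ _ X Y Q) :
    @ExactPairing.coevaluation C _ _ X Y P = @ExactPairing.coevaluation C _ _ X Y Q := by
  have h1 := @ExactPairing.evaluation_coevaluation'' C _ _ X Y P
  have h2 := @ExactPairing.coevaluation_evaluation'' C _ _ X Y Q
  rw [← h] at h2
  generalize @ExactPairing.evaluation C _ _ X Y P = e at h1 h2
  generalize @ExactPairing.coevaluation C _ _ X Y P = a at h1 h2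
  generalize @ExactPairing.coevaluation C _ _ X Y Q = b at h1 h2
  calc
    a = a ⊗≫ X ◁ ((λ_ Y).inv ≫ 𝟙 _ ≫ (λ_ Y).hom) ⊗≫ 𝟙 _ := by monoidal
    _ = 𝟙 _ ⊗≫ (a ▷ 𝟙_ C ≫ (X ⊗ Y) ◁ b) ⊗≫ X ◁ e ▷ Y ⊗≫ 𝟙 _ := by
      rw [show (λ_ Y).inv ≫ 𝟙 _ ≫ (λ_ Y).hom = 𝟙 _ ⊗≫ (Y ◁ b ⊗≫ e ▷ Y) ⊗≫ 𝟙 _ by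
        rw [h2]; monoidal]
      monoidal
    _ = b ⊗≫ (a ▷ X ⊗≫ X ◁ e) ▷ Y ⊗≫ 𝟙 _ := by
      rw [← whisker_exchange]; monoidal
    _ = b := by rw [h1]; monoidal

variable [RightRigidCategory C] (p : PivotalStructure C)

namespace PivotalStructure

/-- The evaluation `X ⊗ X* ⟶ 1` given by the pivotal structure. -/
def evr (X : C) : X ⊗ Xᘁ ⟶ 𝟙_ C := (p.iso X).hom ▷ Xᘁ ≫ ε_ Xᘁ (doubleDual X)

/-- The coevaluation `1 ⟶ X* ⊗ X` given by the pivotal structure. -/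
def coevr (X : C) : 𝟙_ C ⟶ Xᘁ ⊗ X := η_ Xᘁ (doubleDual X) ≫ Xᘁ ◁ (p.iso X).inv

/-- In a pivotal category the right dual is also a left dual. -/
@[reducible] def dualPairing (X : C) : ExactPairing Xᘁ X :=
  exactPairingCongrRight (Y' := doubleDual X) (p.iso X)

lemma evr_coevr (X : C) : X ◁ p.coevr X ⊗≫ p.evr X ▷ X = ⊗𝟙.hom :=
  @ExactPairing.coevaluation_evaluation'' C _ _ Xᘁ X (p.dualPairing X)

lemma evr_naturality {A B : C} (f : A ⟶ B) :
    f ▷ Bᘁ ≫ p.evr B = A ◁ rightAdjointMate f ≫ p.evr A := by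
  rw [evr, evr, ← comp_whiskerRight_assoc, p.naturality, comp_whiskerRight_assoc,
    rightAdjointMate_comp_evaluation, whisker_exchange_assoc]

/-- The right partial trace. -/
def ptr {X Z : C} (V : C) (h : X ⊗ V ⟶ Z ⊗ V) : X ⟶ Z :=
  (ρ_ X).inv ≫ X ◁ η_ V Vᘁ ≫ (α_ X V Vᘁ).inv ≫ h ▷ Vᘁ ≫ (α_ Z V Vᘁ).hom ≫ Z ◁ p.evr V ≫
    (ρ_ Z).hom

lemma ptr_comp_left {W X Z V : C} (f : W ⟶ X) (h : X ⊗ V ⟶ Z ⊗ V) :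
    p.ptr V (f ▷ V ≫ h) = f ≫ p.ptr V h := by
  calc
    _ = 𝟙 _ ⊗≫ (W ◁ η_ V Vᘁ ≫ f ▷ (V ⊗ Vᘁ)) ⊗≫ h ▷ Vᘁ ⊗≫ Z ◁ p.evr V ⊗≫ 𝟙 _ := by
      rw [ptr]; monoidal
    _ = _ := by rw [whisker_exchange, ptr]; monoidal

lemma ptr_comp_right {X Z W V : C} (h : X ⊗ V ⟶ Z ⊗ V) (g : Z ⟶ W) :
    p.ptr V (h ≫ g ▷ V) = p.ptr V h ≫ g := by
  calc
    _ = 𝟙 _ ⊗≫ X ◁ η_ V Vᘁ ⊗≫ h ▷ Vᘁ ⊗≫ (g ▷ (V ⊗ Vᘁ) ≫ W ◁ p.evr V) ⊗≫ 𝟙 _ := by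
      rw [ptr]; monoidal
    _ = _ := by rw [← whisker_exchange, ptr]; monoidal

lemma ptr_whiskerLeft {X Z V : C} (U : C) (h : X ⊗ V ⟶ Z ⊗ V) :
    p.ptr V ((α_ U X V).hom ≫ U ◁ h ≫ (α_ U Z V).inv) = U ◁ p.ptr V h := by
  rw [ptr, ptr]; monoidal

/-- The morphism `g` travels round the loop: it crosses the cap as its dual and returns through the
cup. -/
lemma ptr_cyclic {X Z V V' : C} (h : X ⊗ V ⟶ Z ⊗ V') (g : V' ⟶ V) :
    p.ptr V (h ≫ Z ◁ g) = p.ptr V' (X ◁ g ≫ h) := by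
  calc
    _ = 𝟙 _ ⊗≫ X ◁ η_ V Vᘁ ⊗≫ h ▷ Vᘁ ⊗≫ Z ◁ (g ▷ Vᘁ ≫ p.evr V) ⊗≫ 𝟙 _ := by
      rw [ptr]; monoidal
    _ = 𝟙 _ ⊗≫ X ◁ η_ V Vᘁ ⊗≫ (h ▷ Vᘁ ≫ (Z ⊗ V') ◁ rightAdjointMate g) ⊗≫ Z ◁ p.evr V' ⊗≫ 𝟙 _ := by
      rw [evr_naturality]; monoidal
    _ = 𝟙 _ ⊗≫ X ◁ (η_ V Vᘁ ≫ V ◁ rightAdjointMate g) ⊗≫ h ▷ V'ᘁ ⊗≫ Z ◁ p.evr V' ⊗≫ 𝟙 _ := by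
      rw [← whisker_exchange]; monoidal
    _ = _ := by rw [coevaluation_comp_rightAdjointMate, ptr]; monoidal

lemma trace_def {X : C} (f : X ⟶ X) : p.trace f = η_ X Xᘁ ≫ f ▷ Xᘁ ≫ p.evr X := by
  simp [trace, evr]

lemma ptr_unit {X : C} (f : X ⟶ X) :
    p.ptr X ((λ_ X).hom ≫ f ≫ (λ_ X).inv) = p.trace f := by
  rw [trace_def, ptr]; monoidal

lemma trace_cyclic {X Y : C} (f : X ⟶ Y) (g : Y ⟶ X) : p.trace (f ≫ g) = p.trace (g ≫ f) := by
  have := p.ptr_cyclic (X := 𝟙_ C) (Z := 𝟙_ C) ((λ_ X).hom ≫ f ≫ (λ_ Y).inv) g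
  rw [← ptr_unit, ← ptr_unit]
  convert this using 2 <;> simp

/-- The coevaluation of a tensor product in terms of those of the factors. -/
lemma coevaluation_tensor (U V : C) :
    η_ (U ⊗ V) (U ⊗ V)ᘁ ≫ (U ⊗ V) ◁ (rightDualTensorIso U V).hom =
      η_ U Uᘁ ⊗≫ (U ◁ η_ V Vᘁ) ▷ Uᘁ ⊗≫ 𝟙 _ := by
  have h := @coevaluation_comp_rightAdjointMate C _ _ (U ⊗ V) (U ⊗ V) hasRightDualTensor
    (RightRigidCategory.rightDual _) (𝟙 _)
  rw [id_whiskerRight, Category.comp_id] at h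
  exact h

/-- Here monoidality of the pivotal structure enters: it makes the loop of a tensor product a pair
of nested loops. -/
lemma evr_tensor (U V : C) :
    p.evr (U ⊗ V) = (U ⊗ V) ◁ (rightDualTensorIso U V).hom ⊗≫ U ◁ p.evr V ▷ Uᘁ ⊗≫ p.evr U := by
  have h1 : (rightDualTensorIso Vᘁ Uᘁ).hom ▷ _ ≫
      @ExactPairing.evaluation C _ _ (Vᘁ ⊗ Uᘁ) (doubleDual U ⊗ doubleDual V) ExactPairing.tensor =
        ε_ (Vᘁ ⊗ Uᘁ) (Vᘁ ⊗ Uᘁ)ᘁ := by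
    have h := @rightAdjointMate_comp_evaluation C _ _ (Vᘁ ⊗ Uᘁ) (Vᘁ ⊗ Uᘁ)
      hasRightDualTensor (RightRigidCategory.rightDual _) (𝟙 _)
    rw [whiskerLeft_id, Category.id_comp] at h
    exact h
  have h2 := rightAdjointMate_comp_evaluation (rightDualTensorIso U V).inv
  have h3 := p.monoidal U V
  have h4 : (U ⊗ V) ◁ (rightDualTensorIso U V).inv ≫ p.evr (U ⊗ V) =
      ((p.iso U).hom ⊗ₘ (p.iso V).hom) ▷ _ ≫
        @ExactPairing.evaluation C _ _ (Vᘁ ⊗ Uᘁ) (doubleDual U ⊗ doubleDual V)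
          ExactPairing.tensor := by
    rw [← h3, comp_whiskerRight_assoc, comp_whiskerRight_assoc, h1, h2, evr,
      whisker_exchange_assoc]
  have h5 : p.evr (U ⊗ V) = (U ⊗ V) ◁ (rightDualTensorIso U V).hom ≫
      (U ⊗ V) ◁ (rightDualTensorIso U V).inv ≫ p.evr (U ⊗ V) := by
    rw [← whiskerLeft_comp_assoc]; simp
  rw [h5, h4, ExactPairing.tensor_evaluation, evr, evr, MonoidalCategory.tensorHom_def]
  calc
    _ = (U ⊗ V) ◁ (rightDualTensorIso U V).hom ⊗≫ ((p.iso U).hom ▷ (V ⊗ Vᘁ) ≫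
          _ ◁ ((p.iso V).hom ▷ Vᘁ ≫ ε_ Vᘁ (doubleDual V))) ▷ Uᘁ ⊗≫ ε_ Uᘁ (doubleDual U) := by
      monoidal
    _ = _ := by rw [← whisker_exchange]; monoidal

lemma ptr_tensor {X Z U V : C} (h : X ⊗ (U ⊗ V) ⟶ Z ⊗ (U ⊗ V)) :
    p.ptr (U ⊗ V) h = p.ptr U (p.ptr V ((α_ X U V).hom ≫ h ≫ (α_ Z U V).inv)) := by
  calc
    _ = 𝟙 _ ⊗≫ X ◁ η_ (U ⊗ V) (U ⊗ V)ᘁ ⊗≫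
          (h ▷ (U ⊗ V)ᘁ ≫ (Z ⊗ (U ⊗ V)) ◁ (rightDualTensorIso U V).hom) ⊗≫
          Z ◁ (U ◁ p.evr V ▷ Uᘁ ⊗≫ p.evr U) ⊗≫ 𝟙 _ := by
      rw [ptr, evr_tensor]; monoidal
    _ = 𝟙 _ ⊗≫ X ◁ (η_ (U ⊗ V) (U ⊗ V)ᘁ ≫ (U ⊗ V) ◁ (rightDualTensorIso U V).hom) ⊗≫
          h ▷ (Vᘁ ⊗ Uᘁ) ⊗≫ Z ◁ (U ◁ p.evr V ▷ Uᘁ ⊗≫ p.evr U) ⊗≫ 𝟙 _ := by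
      rw [← whisker_exchange]; monoidal
    _ = _ := by
      rw [coevaluation_tensor, ptr, ptr]; monoidal

/-- The trace of an endomorphism of a tensor product is the trace of its partial trace. -/
lemma trace_tensor {U V : C} (f : U ⊗ V ⟶ U ⊗ V) : p.trace f = p.trace (p.ptr V f) := by
  rw [← ptr_unit, ptr_tensor, ← ptr_unit]
  congr 1
  have h : (α_ (𝟙_ C) U V).hom ≫ ((λ_ (U ⊗ V)).hom ≫ f ≫ (λ_ (U ⊗ V)).inv) ≫
      (α_ (𝟙_ C) U V).inv = (λ_ U).hom ▷ V ≫ f ≫ (λ_ U).inv ▷ V := by monoidal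
  rw [h, ptr_comp_left, ptr_comp_right]

/-- The left trace of an endomorphism. -/
def ltrace {U : C} (g : U ⟶ U) : 𝟙_ C ⟶ 𝟙_ C := p.coevr U ≫ Uᘁ ◁ g ≫ ε_ U Uᘁ

/-- The left partial trace. -/
def lptr {V Y : C} (U : C) (f : U ⊗ V ⟶ U ⊗ Y) : V ⟶ Y :=
  (λ_ V).inv ≫ p.coevr U ▷ V ≫ (α_ Uᘁ U V).hom ≫ Uᘁ ◁ f ≫ (α_ Uᘁ U Y).inv ≫ ε_ U Uᘁ ▷ Y ≫
    (λ_ Y).hom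

/-- The left strand is closed on the left and the right strand on the right, so the interchange law
makes the order of the two closures irrelevant. -/
lemma ltrace_ptr {U V : C} (f : U ⊗ V ⟶ U ⊗ V) :
    p.ltrace (p.ptr V f) = p.trace (p.lptr U f) := by
  calc
    _ = 𝟙 _ ⊗≫ (p.coevr U ▷ 𝟙_ C ≫ (Uᘁ ⊗ U) ◁ η_ V Vᘁ) ⊗≫ (Uᘁ ◁ f) ▷ Vᘁ ⊗≫
        ((Uᘁ ⊗ U) ◁ p.evr V ≫ ε_ U Uᘁ ▷ 𝟙_ C) ⊗≫ 𝟙 _ := by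
      rw [ltrace, ptr]; monoidal
    _ = 𝟙 _ ⊗≫ (p.coevr U ▷ 𝟙_ C ≫ (Uᘁ ⊗ U) ◁ η_ V Vᘁ) ⊗≫ (Uᘁ ◁ f) ▷ Vᘁ ⊗≫
        (ε_ U Uᘁ ▷ (V ⊗ Vᘁ) ≫ 𝟙_ C ◁ p.evr V) ⊗≫ 𝟙 _ := by
      rw [whisker_exchange (ε_ U Uᘁ)]
    _ = _ := by
      rw [← whisker_exchange, trace_def, lptr]; monoidal

lemma ltrace_cyclic {X Y : C} (f : X ⟶ Y) (g : Y ⟶ X) : p.ltrace (f ≫ g) = p.ltrace (g ≫ f) := by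
  have h1 : p.coevr X ≫ Xᘁ ◁ f = p.coevr Y ≫ rightAdjointMate f ▷ Y := by
    have := coevaluation_comp_rightAdjointMate (rightAdjointMate f)
    rw [coevr, coevr, Category.assoc, Category.assoc, whisker_exchange, ← reassoc_of% this,
      ← whiskerLeft_comp, ← whiskerLeft_comp]
    congr 2
    rw [Iso.inv_comp_eq, ← Category.assoc, Iso.eq_comp_inv, p.naturality]
  rw [ltrace, ltrace, whiskerLeft_comp_assoc, reassoc_of% h1, ← whisker_exchange_assoc,
    rightAdjointMate_comp_evaluation, whiskerLeft_comp_assoc]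

lemma iso_hom_eq (X : C) : (p.iso X).hom = (ρ_ X).inv ≫ X ◁ η_ Xᘁ (doubleDual X) ≫
    (α_ _ _ _).inv ≫ p.evr X ▷ doubleDual X ≫ (λ_ _).hom := by
  calc
    _ = (p.iso X).hom ⊗≫ (doubleDual X ◁ η_ Xᘁ (doubleDual X) ⊗≫
        ε_ Xᘁ (doubleDual X) ▷ doubleDual X) ⊗≫ 𝟙 _ := by
      rw [ExactPairing.coevaluation_evaluation'']; monoidal
    _ = 𝟙 _ ⊗≫ ((p.iso X).hom ▷ 𝟙_ C ≫ doubleDual X ◁ η_ Xᘁ (doubleDual X)) ⊗≫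
        ε_ Xᘁ (doubleDual X) ▷ doubleDual X ⊗≫ 𝟙 _ := by monoidal
    _ = _ := by
      rw [← whisker_exchange, evr]; monoidal

/-- Precomposing the trace pairing of `X*` with the pivotal isomorphism gives the evaluation, up
to the dimension of the unit object. -/
lemma whiskerLeft_iso_evr_aux (X : C) {B : C} (i : B ≅ 𝟙_ C) :
    Xᘁ ◁ (p.iso X).hom ≫ p.evr Xᘁ = ε_ X Xᘁ ≫ p.trace (𝟙 B) := by
  have h1 := p.evr_naturality (ε_ X Xᘁ ≫ i.inv)
  have h2 := coevaluation_comp_rightAdjointMate (ε_ X Xᘁ ≫ i.inv)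
  have h3 := p.evr_tensor Xᘁ X
  have h4 := coevaluation_tensor Xᘁ X
  -- The coevaluation of `X* ⊗ X`, pushed along the evaluation to `B`, is the coevaluation of `B`
  -- followed by a dual morphism; `h1` then moves that dual morphism back through the pivotal
  -- evaluation.
  have h5 : η_ Xᘁ (doubleDual X) = (η_ B Bᘁ ≫ i.hom ▷ Bᘁ ≫ (λ_ _).hom) ≫
      rightAdjointMate (ε_ X Xᘁ ≫ i.inv) ≫ (rightDualTensorIso Xᘁ X).hom := by
    calc
      η_ Xᘁ (doubleDual X) = η_ Xᘁ (doubleDual X) ⊗≫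
          (Xᘁ ◁ η_ X Xᘁ ⊗≫ ε_ X Xᘁ ▷ Xᘁ) ▷ doubleDual X ⊗≫ 𝟙 _ := by
        rw [ExactPairing.coevaluation_evaluation'']; monoidal
      _ = (η_ (Xᘁ ⊗ X) (Xᘁ ⊗ X)ᘁ ≫ (Xᘁ ⊗ X) ◁ (rightDualTensorIso Xᘁ X).hom) ≫
            (ε_ X Xᘁ ≫ i.inv ≫ i.hom) ▷ (Xᘁ ⊗ doubleDual X) ≫ (λ_ _).hom := by
        rw [h4, Iso.inv_hom_id]; monoidal
      _ = (η_ (Xᘁ ⊗ X) (Xᘁ ⊗ X)ᘁ ≫ (ε_ X Xᘁ ≫ i.inv) ▷ (Xᘁ ⊗ X)ᘁ) ≫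
            B ◁ (rightDualTensorIso Xᘁ X).hom ≫ i.hom ▷ _ ≫ (λ_ _).hom := by
        rw [Category.assoc, Category.assoc, ← whisker_exchange_assoc, comp_whiskerRight_assoc,
          comp_whiskerRight_assoc, comp_whiskerRight_assoc]
      _ = _ := by
        rw [← h2]
        calc
          _ = η_ B Bᘁ ≫ (B ◁ (rightAdjointMate (ε_ X Xᘁ ≫ i.inv) ≫ (rightDualTensorIso Xᘁ X).hom) ≫
              i.hom ▷ ((Xᘁ : C) ⊗ doubleDual X)) ≫ (λ_ _).hom := by monoidal
          _ = _ := by rw [whisker_exchange]; monoidal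
  calc
    _ = (ρ_ _).inv ≫ ((Xᘁ : C) ⊗ X) ◁ η_ Xᘁ (doubleDual X) ⊗≫
          Xᘁ ◁ p.evr X ▷ doubleDual X ⊗≫ p.evr Xᘁ := by
      rw [iso_hom_eq]; monoidal
    _ = (ρ_ _).inv ≫ ((Xᘁ : C) ⊗ X) ◁ (η_ B Bᘁ ≫ i.hom ▷ Bᘁ ≫ (λ_ _).hom) ≫
          (((Xᘁ : C) ⊗ X) ◁ rightAdjointMate (ε_ X Xᘁ ≫ i.inv) ≫ p.evr (Xᘁ ⊗ X)) := by
      rw [h5, h3]; monoidal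
    _ = (ρ_ _).inv ≫ (((Xᘁ : C) ⊗ X) ◁ (η_ B Bᘁ ≫ i.hom ▷ Bᘁ ≫ (λ_ _).hom) ≫
          (ε_ X Xᘁ ≫ i.inv) ▷ Bᘁ) ≫ p.evr B := by
      rw [← h1, Category.assoc]
    _ = ε_ X Xᘁ ≫ η_ B Bᘁ ⊗≫ (i.hom ≫ i.inv) ▷ Bᘁ ⊗≫ p.evr B := by
      calc
        _ = ε_ X Xᘁ ≫ (ρ_ _).inv ≫ (i.inv ▷ 𝟙_ C ≫
            B ◁ (η_ B Bᘁ ≫ i.hom ▷ Bᘁ ≫ (λ_ _).hom)) ≫ p.evr B := by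
          rw [whisker_exchange]; monoidal
        _ = _ := by rw [← whisker_exchange]; monoidal
    _ = _ := by
      rw [trace_def, Iso.hom_inv_id]; monoidal

lemma whiskerLeft_iso_evr (hp : p.trace (𝟙 (𝟙_ C)) = 𝟙 _) (X : C) : Xᘁ ◁ (p.iso X).hom ≫ p.evr Xᘁ = ε_ X Xᘁ := by
  rw [p.whiskerLeft_iso_evr_aux X (Iso.refl _), hp, Category.comp_id]

/-- Two exact pairings between `X**` and `X*` have the same evaluation by `whiskerLeft_iso_evr`, and
the evaluation determines the coevaluation. -/
lemma coevr_rightDual (hp : p.trace (𝟙 (𝟙_ C)) = 𝟙 _) (X : C) : p.coevr Xᘁ = η_ X Xᘁ ≫ (p.iso X).hom ▷ Xᘁ := by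
  refine coevaluation_eq_of_evaluation_eq (p.dualPairing Xᘁ)
    (exactPairingCongrLeft (X' := X) (p.iso X).symm) ?_
  change p.evr Xᘁ = Xᘁ ◁ (p.iso X).inv ≫ ε_ X Xᘁ
  rw [← p.whiskerLeft_iso_evr hp, ← whiskerLeft_comp_assoc, Iso.inv_hom_id]
  simp

lemma ltrace_id (hp : p.trace (𝟙 (𝟙_ C)) = 𝟙 _) (X : C) : p.ltrace (𝟙 X) = p.trace (𝟙 Xᘁ) := by
  rw [ltrace, trace_def, coevr, ← p.whiskerLeft_iso_evr hp]
  simp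

/-- The left partial trace over a dual object. -/
lemma lptr_rightDual (hp : p.trace (𝟙 (𝟙_ C)) = 𝟙 _) {X V Y : C} (f : Xᘁ ⊗ V ⟶ Xᘁ ⊗ Y) :
    p.lptr Xᘁ f = 𝟙 _ ⊗≫ η_ X Xᘁ ▷ V ⊗≫ X ◁ f ⊗≫ p.evr X ▷ Y ⊗≫ 𝟙 _ := by
  calc
    _ = 𝟙 _ ⊗≫ η_ X Xᘁ ▷ V ⊗≫ ((p.iso X).hom ▷ (Xᘁ ⊗ V) ≫ _ ◁ f) ⊗≫
        ε_ Xᘁ (doubleDual X) ▷ Y ⊗≫ 𝟙 _ := by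
      rw [lptr, p.coevr_rightDual hp]; monoidal
    _ = _ := by rw [← whisker_exchange, evr]; monoidal

lemma iso_inv_eq (hp : p.trace (𝟙 (𝟙_ C)) = 𝟙 _) (X : C) :
    (p.iso X).inv = (λ_ _).inv ≫ η_ X Xᘁ ▷ doubleDual X ≫ (α_ _ _ _).hom ≫ X ◁ p.evr Xᘁ ≫
      (ρ_ X).hom := by
  have h : p.evr Xᘁ = Xᘁ ◁ (p.iso X).inv ≫ ε_ X Xᘁ := by
    rw [← p.whiskerLeft_iso_evr hp, ← whiskerLeft_comp_assoc, Iso.inv_hom_id]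
    simp
  calc
    _ = (p.iso X).inv ⊗≫ (η_ X Xᘁ ▷ X ⊗≫ X ◁ ε_ X Xᘁ) ⊗≫ 𝟙 _ := by
      rw [ExactPairing.evaluation_coevaluation'']; monoidal
    _ = 𝟙 _ ⊗≫ (𝟙_ C ◁ (p.iso X).inv ≫ η_ X Xᘁ ▷ X) ⊗≫ X ◁ ε_ X Xᘁ ⊗≫ 𝟙 _ := by monoidal
    _ = _ := by
      rw [whisker_exchange, h]; monoidal

end PivotalStructure

end PartialTrace

end

section

/-! ### Semisimplicity with respect to a finite family of simple objects -/

section SimpleBasis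

/-- `V` is a finite family of objects with scalar endomorphisms and no other morphisms between
them, such that every object is a finite direct sum of members of the family. -/
structure SimpleBasis (k : Type w) [Field k] {𝒟 : Type u} [Category.{v} 𝒟] [Preadditive 𝒟]
    [Linear k 𝒟] {ι : Type u'} [Fintype ι] (V : ι → 𝒟) : Prop where
  hom_eq_zero : ∀ i j, i ≠ j → ∀ f : V i ⟶ V j, f = 0
  end_scalar : ∀ i (f : V i ⟶ V i), ∃ c : k, f = c • 𝟙 (V i)
  id_ne_zero : ∀ i, 𝟙 (V i) ≠ 0
  decomp : ∀ X : 𝒟, ∃ (n : ι → ℕ) (a : ∀ l, Fin (n l) → (X ⟶ V l))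
    (b : ∀ l, Fin (n l) → (V l ⟶ X)), ∑ l, ∑ α, a l α ≫ b l α = 𝟙 X

variable {k : Type w} [Field k] {𝒟 : Type u} [Category.{v} 𝒟] [Preadditive 𝒟]
    [Linear k 𝒟] {ι : Type u'} [Fintype ι] {V : ι → 𝒟}

namespace SimpleBasis

variable (hV : SimpleBasis k V)

include hV in
lemma hom_ext_source {X Y : 𝒟} {f g : X ⟶ Y} (h : ∀ i (t : V i ⟶ X), t ≫ f = t ≫ g) : f = g := by
  obtain ⟨n, a, b, hab⟩ := hV.decomp X
  rw [← Category.id_comp f, ← Category.id_comp g, ← hab]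
  simp only [Preadditive.sum_comp, Category.assoc, h]

include hV in
lemma hom_ext_target {X Y : 𝒟} {f g : X ⟶ Y} (h : ∀ i (t : Y ⟶ V i), f ≫ t = g ≫ t) : f = g := by
  obtain ⟨n, a, b, hab⟩ := hV.decomp Y
  rw [← Category.comp_id f, ← Category.comp_id g, ← hab]
  simp only [Preadditive.comp_sum, ← Category.assoc, h]

include hV in
lemma smul_id_injective (i : ι) {c d : k} (h : c • 𝟙 (V i) = d • 𝟙 (V i)) : c = d := by
  by_contra hne
  apply hV.id_ne_zero i
  have h' : (c - d) • 𝟙 (V i) = 0 := by rw [sub_smul, h, sub_self]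
  exact (smul_eq_zero_iff_right (sub_ne_zero.mpr hne)).mp h'

include hV in
/-- A simple object that receives a nonzero morphism is a retract of the source. -/
lemma retract_of_ne_zero {X : 𝒟} {i : ι} {f : X ⟶ V i} (hf : f ≠ 0) :
    Nonempty (Retract (V i) X) := by
  by_contra h
  apply hf
  refine hV.hom_ext_source fun j t => ?_
  rw [comp_zero]
  by_cases hij : j = i
  · subst hij
    obtain ⟨c, hc⟩ := hV.end_scalar j (t ≫ f)
    by_cases hc0 : c = 0
    · rw [hc, hc0, zero_smul]
    · refine absurd ⟨⟨c⁻¹ • t, f, ?_⟩⟩ h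
      rw [Linear.smul_comp, hc, smul_smul, inv_mul_cancel₀ hc0, one_smul]
  · exact hV.hom_eq_zero _ _ hij _

include hV in
/-- A simple object with a nonzero morphism to an object is a retract of it. -/
lemma retract_of_ne_zero' {X : 𝒟} {i : ι} {f : V i ⟶ X} (hf : f ≠ 0) :
    Nonempty (Retract (V i) X) := by
  by_contra h
  apply hf
  refine hV.hom_ext_target fun j t => ?_
  rw [zero_comp]
  by_cases hij : i = j
  · subst hij
    obtain ⟨c, hc⟩ := hV.end_scalar i (f ≫ t)
    by_cases hc0 : c = 0
    · rw [hc, hc0, zero_smul]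
    · refine absurd ⟨⟨c⁻¹ • f, t, ?_⟩⟩ h
      rw [Linear.smul_comp, hc, smul_smul, inv_mul_cancel₀ hc0, one_smul]
  · exact hV.hom_eq_zero _ _ hij _

end SimpleBasis

end SimpleBasis

/-! ### Linearity of traces and sphericality -/

section Skein

variable {k : Type w} [Field k] {C : Type u} [Category.{v} C] [Preadditive C] [Linear k C]
  [MonoidalCategory C] [MonoidalPreadditive C] [MonoidalLinear k C] [RightRigidCategory C]
  (p : PivotalStructure C)

namespace PivotalStructure

/-- Closing up a strand that turns back. -/
lemma ptr_turn (hp : p.trace (𝟙 (𝟙_ C)) = 𝟙 _) {X Z : C} (U : C) (g : X ⟶ Z) :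
    p.ptr Uᘁ ((α_ X U Uᘁ).hom ≫ X ◁ p.evr U ≫ (ρ_ X).hom ≫ g ≫ (ρ_ Z).inv ≫ Z ◁ η_ U Uᘁ ≫
      (α_ Z U Uᘁ).inv) = g ▷ U := by
  have h1 : (α_ X U Uᘁ).hom ≫ X ◁ p.evr U ≫ (ρ_ X).hom ≫ g = g ▷ U ▷ Uᘁ ≫
      (α_ Z U Uᘁ).hom ≫ Z ◁ p.evr U ≫ (ρ_ Z).hom := by
    rw [← rightUnitor_naturality, whisker_exchange_assoc]; simp
  rw [reassoc_of% h1, ptr_comp_left]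
  conv_rhs => rw [← Category.comp_id (g ▷ U)]
  congr 1
  have h2 : Z ◁ (p.iso U).hom ≫ Z ◁ (p.iso U).inv = 𝟙 (Z ⊗ U) := by
    rw [← whiskerLeft_comp]; simp
  rw [← h2]
  rw [iso_hom_eq, iso_inv_eq p hp, ptr]; monoidal

lemma ptr_add {X Z V : C} (f g : X ⊗ V ⟶ Z ⊗ V) : p.ptr V (f + g) = p.ptr V f + p.ptr V g := by
  simp [ptr]

lemma ptr_smul {X Z V : C} (c : k) (f : X ⊗ V ⟶ Z ⊗ V) : p.ptr V (c • f) = c • p.ptr V f := by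
  simp [ptr]

lemma ptr_sum {J : Type*} (s : Finset J) {X Z V : C} (f : J → (X ⊗ V ⟶ Z ⊗ V)) :
    p.ptr V (∑ j ∈ s, f j) = ∑ j ∈ s, p.ptr V (f j) :=
  map_sum (AddMonoidHom.mk' (p.ptr V) p.ptr_add) f s

lemma trace_smul {X : C} (c : k) (f : X ⟶ X) : p.trace (c • f) = c • p.trace f := by
  simp [trace_def]

lemma trace_sum {J : Type*} (s : Finset J) {X : C} (f : J → (X ⟶ X)) :
    p.trace (∑ j ∈ s, f j) = ∑ j ∈ s, p.trace (f j) := by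
  simp [trace_def, sum_whiskerRight, Preadditive.comp_sum, Preadditive.sum_comp]

lemma ltrace_smul {X : C} (c : k) (f : X ⟶ X) : p.ltrace (c • f) = c • p.ltrace f := by
  simp [ltrace]

lemma ltrace_sum {J : Type*} (s : Finset J) {X : C} (f : J → (X ⟶ X)) :
    p.ltrace (∑ j ∈ s, f j) = ∑ j ∈ s, p.ltrace (f j) := by
  simp [ltrace, whiskerLeft_sum, Preadditive.comp_sum, Preadditive.sum_comp]

variable {ι : Type u'} [Fintype ι] {V : ι → C}

/-- In a spherical category left and right traces agree. -/
lemma ltrace_eq_trace (hV : SimpleBasis k V) (hp : p.trace (𝟙 (𝟙_ C)) = 𝟙 _)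
    (hs : ∀ X, p.trace (𝟙 X) = p.trace (𝟙 Xᘁ)) {U : C} (g : U ⟶ U) : p.ltrace g = p.trace g := by
  obtain ⟨n, a, b, hab⟩ := hV.decomp U
  rw [← Category.comp_id g, ← hab]
  simp only [Preadditive.comp_sum, ltrace_sum, trace_sum]
  refine Finset.sum_congr rfl fun l _ => Finset.sum_congr rfl fun α _ => ?_
  -- Cyclicity moves both traces to `V l`, where the endomorphism is a scalar; only `dim V = dim V*`
  -- is then needed.
  rw [← Category.assoc, ltrace_cyclic, trace_cyclic]
  obtain ⟨c, hc⟩ := hV.end_scalar l (b l α ≫ g ≫ a l α)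
  rw [hc, ltrace_smul, trace_smul, ltrace_id p hp, ← hs]

/-- The left-hand side is the left trace of the right partial trace, and left traces agree with
right traces. -/
lemma trace_lptr (hV : SimpleBasis k V) (hp : p.trace (𝟙 (𝟙_ C)) = 𝟙 _)
    (hs : ∀ X, p.trace (𝟙 X) = p.trace (𝟙 Xᘁ)) {U W : C} (f : U ⊗ W ⟶ U ⊗ W) :
    p.trace (p.lptr U f) = p.trace f := by
  rw [← ltrace_ptr, ltrace_eq_trace p hV hp hs, ← trace_tensor]

end PivotalStructure

end Skein

end

section

/-! ### Bending of strands and the handle slide -/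

section Skein

variable {k : Type w} [Field k] {C : Type u} [Category.{v} C] [Preadditive C] [Linear k C]
  [MonoidalCategory C] [MonoidalPreadditive C] [MonoidalLinear k C] [RightRigidCategory C]
  (p : PivotalStructure C) {ι : Type u'} [Fintype ι] {V : ι → C}

namespace PivotalStructure

/-- Bending the first strand of the target of a morphism down. -/
def bendDown {L U W : C} (b : L ⟶ U ⊗ W) : Uᘁ ⊗ L ⟶ W :=
  Uᘁ ◁ b ≫ (α_ _ _ _).inv ≫ ε_ U Uᘁ ▷ W ≫ (λ_ W).hom

/-- Bending the first strand of the source of a morphism up. -/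
def bendUp {L U W : C} (a : U ⊗ W ⟶ L) : W ⟶ Uᘁ ⊗ L :=
  (λ_ W).inv ≫ p.coevr U ▷ W ≫ (α_ _ _ _).hom ≫ Uᘁ ◁ a

lemma bendUp_surjective {L U W : C} (t : W ⟶ Uᘁ ⊗ L) : ∃ a : U ⊗ W ⟶ L, p.bendUp a = t :=
  (@tensorLeftHomEquiv C _ _ W Uᘁ U L (p.dualPairing U)).surjective t

lemma bendUp_bendDown {L U W : C} (a : U ⊗ W ⟶ L) (b : L ⟶ U ⊗ W) :
    p.bendUp a ≫ bendDown b = p.lptr U (a ≫ b) := by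
  simp [bendUp, bendDown, lptr]

lemma bendUp_smul {L U W : C} (c : k) (a : U ⊗ W ⟶ L) : p.bendUp (c • a) = c • p.bendUp a := by
  simp [bendUp]

lemma bendUp_sum {J : Type*} (s : Finset J) {L U W : C} (a : J → (U ⊗ W ⟶ L)) :
    p.bendUp (∑ j ∈ s, a j) = ∑ j ∈ s, p.bendUp (a j) := by
  simp [bendUp, whiskerLeft_sum, Preadditive.comp_sum]

/-- A morphism out of `U ⊗ W` in terms of the bent morphism. -/
lemma whiskerLeft_eq_bendUp (X : C) {L U W : C} (a : U ⊗ W ⟶ L) :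
    (α_ X U W).hom ≫ X ◁ a = (X ⊗ U) ◁ p.bendUp a ≫ (α_ (X ⊗ U) Uᘁ L).inv ≫
      ((α_ X U Uᘁ).hom ≫ X ◁ p.evr U ≫ (ρ_ X).hom) ▷ L := by
  calc
    _ = 𝟙 _ ⊗≫ X ◁ (U ◁ p.coevr U ⊗≫ p.evr U ▷ U) ▷ W ⊗≫ X ◁ a := by
      rw [evr_coevr]; monoidal
    _ = 𝟙 _ ⊗≫ X ◁ U ◁ p.coevr U ▷ W ⊗≫ X ◁ (p.evr U ▷ (U ⊗ W) ≫ _ ◁ a) ⊗≫ 𝟙 _ := by monoidal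
    _ = _ := by rw [← whisker_exchange, bendUp]; monoidal

/-- A morphism into `U ⊗ W` in terms of the bent morphism. -/
lemma whiskerLeft_eq_bendDown (Z : C) {L U W : C} (b : L ⟶ U ⊗ W) :
    Z ◁ b ≫ (α_ Z U W).inv = ((ρ_ Z).inv ≫ Z ◁ η_ U Uᘁ ≫ (α_ Z U Uᘁ).inv) ▷ L ≫
      (α_ (Z ⊗ U) Uᘁ L).hom ≫ (Z ⊗ U) ◁ bendDown b := by
  calc
    _ = 𝟙 _ ⊗≫ Z ◁ b ⊗≫ Z ◁ (η_ U Uᘁ ▷ U ⊗≫ U ◁ ε_ U Uᘁ) ▷ W ⊗≫ 𝟙 _ := by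
      rw [ExactPairing.evaluation_coevaluation'']; monoidal
    _ = 𝟙 _ ⊗≫ Z ◁ (_ ◁ b ≫ η_ U Uᘁ ▷ (U ⊗ W)) ⊗≫ Z ◁ U ◁ ε_ U Uᘁ ▷ W ⊗≫ 𝟙 _ := by
      monoidal
    _ = _ := by rw [whisker_exchange, bendDown]; monoidal

/-- Proportionality of the two pairings between bent morphisms. -/
lemma dim_mul_pairing (hV : SimpleBasis k V) (hp : p.trace (𝟙 (𝟙_ C)) = 𝟙 _)
    (h1 : Function.Injective fun c : k => c • 𝟙 (𝟙_ C))
    (hs : ∀ X, p.trace (𝟙 X) = p.trace (𝟙 Xᘁ)) {d : ι → k}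
    (hd : ∀ i, p.trace (𝟙 (V i)) = d i • 𝟙 (𝟙_ C)) {U : C} {i l : ι} (a : U ⊗ V i ⟶ V l)
    (b : V l ⟶ U ⊗ V i) {x y : k} (hx : p.bendUp a ≫ bendDown b = x • 𝟙 (V i))
    (hy : b ≫ a = y • 𝟙 (V l)) : x * d i = y * d l := by
  -- The trace of the bent composite is the trace of `a ≫ b`, hence by cyclicity that of `b ≫ a`.
  have h := congrArg p.trace hx
  rw [bendUp_bendDown, trace_lptr p hV hp hs, trace_cyclic, hy, trace_smul, trace_smul, hd, hd,
    smul_smul, smul_smul] at h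
  exact (h1 h).symm

open scoped Classical in
/-- Bent dual bases are dual bases, up to dimension factors. -/
lemma sum_bendDown_bendUp (hV : SimpleBasis k V) (hp : p.trace (𝟙 (𝟙_ C)) = 𝟙 _)
    (h1 : Function.Injective fun c : k => c • 𝟙 (𝟙_ C))
    (hs : ∀ X, p.trace (𝟙 X) = p.trace (𝟙 Xᘁ)) {d : ι → k}
    (hd : ∀ i, p.trace (𝟙 (V i)) = d i • 𝟙 (𝟙_ C))
    {P : ObjectProperty C} (hPr : ∀ {X Y : C}, Retract X Y → P Y → P X) {U : C} {l : ι}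
    (hUl : P (Uᘁ ⊗ V l))
    (n : ι → ι → ℕ) (a : ∀ i l, Fin (n i l) → (U ⊗ V i ⟶ V l))
    (b : ∀ i l, Fin (n i l) → (V l ⟶ U ⊗ V i))
    (hab : ∀ i, ∑ l, ∑ α, a i l α ≫ b i l α = 𝟙 (U ⊗ V i)) :
    ∑ i : {i // P (V i)}, ∑ α, d i • (bendDown (b i l α) ≫ p.bendUp (a i l α)) =
      d l • 𝟙 (Uᘁ ⊗ V l) := by
  rw [← Finset.sum_subtype (Finset.univ.filter fun i => P (V i)) (by simp)
    (fun i => ∑ α, d i • (bendDown (b i l α) ≫ p.bendUp (a i l α)))]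
  refine hV.hom_ext_source fun j t => ?_
  by_cases hj : P (V j)
  swap
  · have ht : t = 0 := by
      by_contra h
      exact hj (hPr (hV.retract_of_ne_zero' h).some hUl)
    rw [ht, zero_comp, zero_comp]
  -- Every test morphism is the bend of some `U ⊗ V j ⟶ V l`, so the identity can be checked before
  -- bending, where completeness is `hab j`.
  obtain ⟨at', rfl⟩ := p.bendUp_surjective t
  rw [Preadditive.comp_sum, Finset.sum_eq_single j]
  -- The two pairings are the scalars `x` and `y`, and `x * d j = y * d l` exchanges one weight for
  -- the other.
  · have key : ∀ α, p.bendUp at' ≫ (d j • (bendDown (b j l α) ≫ p.bendUp (a j l α))) =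
        d l • p.bendUp (a j l α ≫ b j l α ≫ at') := by
      intro α
      obtain ⟨x, hx⟩ := hV.end_scalar j (p.bendUp at' ≫ bendDown (b j l α))
      obtain ⟨y, hy⟩ := hV.end_scalar l (b j l α ≫ at')
      have hxy := p.dim_mul_pairing hV hp h1 hs hd _ _ hx hy
      rw [Linear.comp_smul, ← Category.assoc, hx, hy, Linear.comp_smul, Category.comp_id,
        bendUp_smul, Linear.smul_comp, Category.id_comp, smul_smul, smul_smul, mul_comm (d j), hxy,
        mul_comm]
    rw [Preadditive.comp_sum]
    simp only [key]
    rw [← Finset.smul_sum, ← bendUp_sum, Linear.comp_smul, Category.comp_id]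
    congr 2
    conv_rhs => rw [← Category.id_comp at', ← hab j, Preadditive.sum_comp]
    rw [Finset.sum_eq_single l]
    · simp [Preadditive.sum_comp]
    · intro l' _ hl'
      rw [Preadditive.sum_comp]
      refine Finset.sum_eq_zero fun α _ => ?_
      rw [Category.assoc, hV.hom_eq_zero l' l hl' (b j l' α ≫ at'), comp_zero]
    · simp
  · intro i _ hij
    rw [Preadditive.comp_sum]
    refine Finset.sum_eq_zero fun α _ => ?_
    rw [Linear.comp_smul, ← Category.assoc, hV.hom_eq_zero j i hij.symm
      (p.bendUp at' ≫ bendDown (b i l α)), zero_comp, smul_zero]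
  · simp [hj]

open scoped Classical in
/-- The handle slide: the weighted sum of partial traces over the simple objects of a fusion
subcategory absorbs an object of the subcategory. -/
theorem sum_ptr_tensor (hV : SimpleBasis k V) (hp : p.trace (𝟙 (𝟙_ C)) = 𝟙 _)
    (h1 : Function.Injective fun c : k => c • 𝟙 (𝟙_ C))
    (hs : ∀ X, p.trace (𝟙 X) = p.trace (𝟙 Xᘁ)) {d : ι → k}
    (hd : ∀ i, p.trace (𝟙 (V i)) = d i • 𝟙 (𝟙_ C))
    {P : ObjectProperty C} (hPr : ∀ {X Y : C}, Retract X Y → P Y → P X)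
    (hPt : ∀ {X Y : C}, P X → P Y → P (X ⊗ Y)) (hPd : ∀ {X : C}, P X → P Xᘁ)
    {X Z : C} (h : ∀ Y, P Y → (X ⊗ Y ⟶ Z ⊗ Y))
    (hnat : ∀ {Y Y' : C} (hY : P Y) (hY' : P Y') (f : Y ⟶ Y'), X ◁ f ≫ h Y' hY' = h Y hY ≫ Z ◁ f)
    {U : C} (hU : P U) :
    ∑ i : {i // P (V i)}, d i • p.ptr (V i)
        ((α_ X U (V i)).hom ≫ h (U ⊗ V i) (hPt hU i.2) ≫ (α_ Z U (V i)).inv) =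
      (∑ i : {i // P (V i)}, d i • p.ptr (V i) (h (V i) i.2)) ▷ U := by
  choose n a b hab using fun i => hV.decomp (U ⊗ V i)
  have ha0 : ∀ (i : {i // P (V i)}) (l : ι) (α), ¬ P (V l) → a i l α = 0 := by
    intro i l α hl
    by_contra h
    exact hl (hPr (hV.retract_of_ne_zero h).some (hPt hU i.2))
  -- the endomorphism of `U* ⊗ V l` obtained by turning the strand `U` back
  let m : ∀ l : {i // P (V i)}, (X ⊗ U) ⊗ (Uᘁ ⊗ V l) ⟶ (Z ⊗ U) ⊗ (Uᘁ ⊗ V l) := fun l =>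
    (α_ (X ⊗ U) Uᘁ (V l)).inv ≫ ((α_ X U Uᘁ).hom ≫ X ◁ p.evr U ≫ (ρ_ X).hom) ▷ V l ≫
      h (V l) l.2 ≫ ((ρ_ Z).inv ≫ Z ◁ η_ U Uᘁ ≫ (α_ Z U Uᘁ).inv) ▷ V l ≫
      (α_ (Z ⊗ U) Uᘁ (V l)).hom
  -- Once `V l` is closed up, the loop `U*` only straightens the turned strand `U`.
  have hm : ∀ l : {i // P (V i)}, p.ptr (Uᘁ ⊗ V l) (m l) = p.ptr (V l) (h (V l) l.2) ▷ U := by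
    intro l
    rw [← p.ptr_turn hp, ptr_tensor]
    congr 1
    simp only [m, Category.assoc, Iso.hom_inv_id_assoc, Iso.hom_inv_id, Category.comp_id]
    rw [ptr_comp_left, ptr_comp_right]
    simp only [Category.assoc]
  -- Cyclicity carries the bent dual bases round the loop, so that a trace over `V i` becomes one
  -- over `U* ⊗ V l`.
  have hterm : ∀ (i l : {i // P (V i)}) (α : Fin (n i l)), p.ptr (V i) ((α_ X U (V i)).hom ≫
      (X ◁ a i l α ≫ h (V l) l.2 ≫ Z ◁ b i l α) ≫ (α_ Z U (V i)).inv) =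
      p.ptr (Uᘁ ⊗ V l) (m l ≫ (Z ⊗ U) ◁ (bendDown (b i l α) ≫ p.bendUp (a i l α))) := by
    intro i l α
    rw [whiskerLeft_comp, ← Category.assoc (m l), ptr_cyclic]
    congr 1
    simp only [Category.assoc]
    rw [whiskerLeft_eq_bendDown, reassoc_of% (p.whiskerLeft_eq_bendUp X (a i l α))]
    simp only [m, Category.assoc]
  -- Naturality cuts the family at `U ⊗ V i` into its components at simple objects; only those
  -- satisfying `P` occur.
  have hdec : ∀ i : {i // P (V i)}, h (U ⊗ V i) (hPt hU i.2) =
      ∑ l : {i // P (V i)}, ∑ α, X ◁ a i l α ≫ h (V l) l.2 ≫ Z ◁ b i l α := by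
    intro i
    have e1 : 𝟙 (U ⊗ V i) = ∑ l : {i // P (V i)}, ∑ α, a i l α ≫ b i l α := by
      rw [← hab i, ← Finset.sum_subtype (Finset.univ.filter fun l => P (V l)) (by simp)
        (fun l => ∑ α, a i l α ≫ b i l α)]
      refine (Finset.sum_subset (Finset.filter_subset _ _) fun l _ hl => ?_).symm
      refine Finset.sum_eq_zero fun α _ => ?_
      rw [ha0 i l α (by simpa using hl), zero_comp]
    conv_lhs => rw [← Category.id_comp (h (U ⊗ V i) (hPt hU i.2)), ← whiskerLeft_id, e1]
    simp only [whiskerLeft_sum, Preadditive.sum_comp]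
    refine Finset.sum_congr rfl fun l _ => Finset.sum_congr rfl fun α _ => ?_
    rw [whiskerLeft_comp, Category.assoc, hnat l.2]
  calc
    _ = ∑ i : {i // P (V i)}, ∑ l : {i // P (V i)}, ∑ α, d i •
        p.ptr (Uᘁ ⊗ V l) (m l ≫ (Z ⊗ U) ◁ (bendDown (b i l α) ≫ p.bendUp (a i l α))) := by
      refine Finset.sum_congr rfl fun i _ => ?_
      rw [hdec]
      simp only [Preadditive.sum_comp, Preadditive.comp_sum, ptr_sum, hterm, Finset.smul_sum]
    _ = ∑ l : {i // P (V i)}, p.ptr (Uᘁ ⊗ V l) (m l ≫ (Z ⊗ U) ◁ (∑ i : {i // P (V i)}, ∑ α, d i •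
        (bendDown (b i l α) ≫ p.bendUp (a i l α)))) := by
      rw [Finset.sum_comm]
      simp only [whiskerLeft_sum, Preadditive.comp_sum, ptr_sum, MonoidalLinear.whiskerLeft_smul,
        Linear.comp_smul, ptr_smul]
    _ = ∑ l : {i // P (V i)}, d l • p.ptr (V l) (h (V l) l.2) ▷ U := by
      refine Finset.sum_congr rfl fun l _ => ?_
      have := p.sum_bendDown_bendUp hV hp h1 hs hd (P := P) hPr (hPt (hPd hU) l.2) n a b hab
      rw [this, MonoidalLinear.whiskerLeft_smul, whiskerLeft_id, Linear.comp_smul, Category.comp_id,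
        ptr_smul, hm]
    _ = _ := by
      simp [sum_whiskerRight]

end PivotalStructure

end Skein

end

section

/-! ### Natural transformations and their components at simple objects -/

section NatTrans

variable {k : Type w} [Field k] {𝒟 : Type u} [Category.{v} 𝒟] [Preadditive 𝒟]
    [Linear k 𝒟] {ι : Type u'} [Fintype ι] {V : ι → 𝒟} {ℰ : Type*} [Category* ℰ] [Preadditive ℰ]

lemma SimpleBasis.natTrans_ext (hV : SimpleBasis k V) {G H : 𝒟 ⥤ ℰ} [G.Additive] {φ ψ : G ⟶ H}
    (h : ∀ i, φ.app (V i) = ψ.app (V i)) : φ = ψ := by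
  ext Y
  obtain ⟨n, a, b, hab⟩ := hV.decomp Y
  rw [← Category.id_comp (φ.app Y), ← Category.id_comp (ψ.app Y), ← G.map_id, ← hab]
  simp only [Functor.map_sum, Functor.map_comp, Preadditive.sum_comp, Category.assoc,
    NatTrans.naturality, reassoc_of% h]

/-- Between simple objects there are only scalars, so any choice of components is natural on them;
decompositions of identities spread it to all objects. -/
lemma SimpleBasis.exists_natTrans [Linear k ℰ] (hV : SimpleBasis k V) (G H : 𝒟 ⥤ ℰ) [G.Additive]
    [H.Additive] [G.Linear k] [H.Linear k] (c : ∀ i, G.obj (V i) ⟶ H.obj (V i)) :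
    ∃ φ : G ⟶ H, ∀ i, φ.app (V i) = c i := by
  choose n a b hab using hV.decomp
  have key : ∀ l l' (t : V l ⟶ V l'), G.map t ≫ c l' = c l ≫ H.map t := by
    intro l l' t
    by_cases h : l = l'
    · subst h
      obtain ⟨x, rfl⟩ := hV.end_scalar l t
      simp [Functor.map_smul]
    · rw [hV.hom_eq_zero l l' h t]; simp
  refine ⟨{ app := fun Y => ∑ l, ∑ α, G.map (a Y l α) ≫ c l ≫ H.map (b Y l α)
            naturality := fun Y Y' f => ?_ }, fun i => ?_⟩
  · have h1 : ∀ l α, G.map f ≫ G.map (a Y' l α) ≫ c l ≫ H.map (b Y' l α) =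
        ∑ m, ∑ β, G.map (a Y m β) ≫ c m ≫ H.map (b Y m β ≫ f ≫ a Y' l α ≫ b Y' l α) := by
      intro l α
      conv_lhs => rw [← Category.id_comp (G.map f ≫ _), ← G.map_id, ← hab Y]
      simp only [Functor.map_sum, Preadditive.sum_comp]
      refine Finset.sum_congr rfl fun m _ => Finset.sum_congr rfl fun β _ => ?_
      have := key _ _ (b Y m β ≫ f ≫ a Y' l α)
      simp only [Functor.map_comp, Category.assoc] at this ⊢
      rw [reassoc_of% this]
    have h2 : ∀ l α, (G.map (a Y l α) ≫ c l ≫ H.map (b Y l α)) ≫ H.map f =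
        ∑ m, ∑ β, G.map (a Y l α) ≫ c l ≫ H.map (b Y l α ≫ f ≫ a Y' m β ≫ b Y' m β) := by
      intro l α
      conv_lhs => rw [Category.assoc, Category.assoc, ← Functor.map_comp,
        ← Category.comp_id (b Y l α ≫ f), ← hab Y']
      simp only [Functor.map_sum, Preadditive.comp_sum, Category.assoc]
    simp only [Preadditive.comp_sum, Preadditive.sum_comp, h1, h2]
    rw [Finset.sum_congr rfl fun l _ => Finset.sum_comm, Finset.sum_comm]
    refine Finset.sum_congr rfl fun m _ => ?_
    rw [Finset.sum_congr rfl fun l _ => Finset.sum_comm, Finset.sum_comm]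
  · simp only [← Category.assoc, key]
    simp only [Category.assoc, ← Functor.map_comp, ← Preadditive.comp_sum, ← Functor.map_sum, hab]
    simp

end NatTrans

/-! ### Invertibility of lax half-braidings -/

section LaxHalfBraiding

variable {𝒟 : Type u} [Category.{v} 𝒟] [MonoidalCategory 𝒟]

/-- A lax half-braiding is invertible at the objects that have a left dual. -/
lemma isIso_laxHalfBraiding {A : 𝒟} (σ : ∀ X, A ⊗ X ⟶ X ⊗ A)
    (hnat : ∀ {X Y : 𝒟} (f : X ⟶ Y), A ◁ f ≫ σ Y = σ X ≫ f ▷ A)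
    (hunit : σ (𝟙_ 𝒟) = (ρ_ A).hom ≫ (λ_ A).inv)
    (htens : ∀ X Y, σ (X ⊗ Y) = (α_ A X Y).inv ≫ σ X ▷ Y ≫ (α_ X A Y).hom ≫ X ◁ σ Y ≫
      (α_ X Y A).inv) (X : 𝒟) [HasLeftDual X] : IsIso (σ X) := by
  have h1 := hnat (η_ (ᘁX : 𝒟) X)
  have h2 := hnat (ε_ (ᘁX : 𝒟) X)
  rw [hunit, htens] at h1 h2
  -- The inverse is the half-braiding with the left dual, bent round; naturality at the cap and at
  -- the cup gives the two inverse laws.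
  refine ⟨𝟙 _ ⊗≫ (X ⊗ A) ◁ η_ (ᘁX : 𝒟) X ⊗≫ X ◁ σ (ᘁX) ▷ X ⊗≫ ε_ (ᘁX : 𝒟) X ▷ (A ⊗ X) ⊗≫ 𝟙 _,
    ?_, ?_⟩
  · calc
      _ = 𝟙 _ ⊗≫ (σ X ▷ 𝟙_ 𝒟 ≫ (X ⊗ A) ◁ η_ (ᘁX : 𝒟) X) ⊗≫ X ◁ σ (ᘁX) ▷ X ⊗≫
          ε_ (ᘁX : 𝒟) X ▷ (A ⊗ X) ⊗≫ 𝟙 _ := by monoidal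
      _ = 𝟙 _ ⊗≫ (A ⊗ X) ◁ η_ (ᘁX : 𝒟) X ⊗≫ (((α_ A X (ᘁX)).inv ≫ σ X ▷ (ᘁX) ≫
            (α_ X A (ᘁX)).hom ≫ X ◁ σ (ᘁX) ≫ (α_ X (ᘁX) A).inv) ≫ ε_ (ᘁX : 𝒟) X ▷ A) ▷ X ⊗≫
            𝟙 _ := by
        rw [← whisker_exchange]; monoidal
      _ = 𝟙 _ ⊗≫ A ◁ (X ◁ η_ (ᘁX : 𝒟) X ⊗≫ ε_ (ᘁX : 𝒟) X ▷ X) ⊗≫ 𝟙 _ := by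
        rw [← h2]; monoidal
      _ = _ := by rw [ExactPairing.coevaluation_evaluation'']; monoidal
  · calc
      _ = 𝟙 _ ⊗≫ (X ⊗ A) ◁ η_ (ᘁX : 𝒟) X ⊗≫ X ◁ σ (ᘁX) ▷ X ⊗≫
          (ε_ (ᘁX : 𝒟) X ▷ (A ⊗ X) ≫ 𝟙_ 𝒟 ◁ σ X) ⊗≫ 𝟙 _ := by monoidal
      _ = 𝟙 _ ⊗≫ X ◁ (A ◁ η_ (ᘁX : 𝒟) X ≫ (α_ A (ᘁX) X).inv ≫ σ (ᘁX) ▷ X ≫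
            (α_ (ᘁX) A X).hom ≫ (ᘁX) ◁ σ X ≫ (α_ (ᘁX) X A).inv) ⊗≫
            ε_ (ᘁX : 𝒟) X ▷ (X ⊗ A) ⊗≫ 𝟙 _ := by
        rw [← whisker_exchange]; monoidal
      _ = 𝟙 _ ⊗≫ (X ◁ η_ (ᘁX : 𝒟) X ⊗≫ ε_ (ᘁX : 𝒟) X ▷ X) ▷ A ⊗≫ 𝟙 _ := by
        rw [h1]; monoidal
      _ = _ := by rw [ExactPairing.coevaluation_evaluation'']; monoidal

end LaxHalfBraiding

end

section

/-! ### Universal families and cofree objects of the center -/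

section UniversalFamily

/-- The tensor axiom at `1 ⊗ 1` and naturality along the unitor make this component idempotent up to
coherence, and it is invertible. -/
lemma _root_.CategoryTheory.HalfBraiding.β_unit {𝒟 : Type u} [Category.{v} 𝒟] [MonoidalCategory 𝒟]
    {A : 𝒟} (b : HalfBraiding A) : (b.β (𝟙_ 𝒟)).hom = (ρ_ A).hom ≫ (λ_ A).inv := by
  have h1 := b.naturality (λ_ (𝟙_ 𝒟)).hom
  rw [b.monoidal] at h1
  have h2 : A ◁ (λ_ (𝟙_ 𝒟)).hom ≫ (b.β (𝟙_ 𝒟)).hom = (((α_ _ _ _).inv ≫ (b.β (𝟙_ 𝒟)).hom ▷ 𝟙_ 𝒟 ≫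
      (α_ _ _ _).hom ≫ (λ_ _).hom)) ≫ (b.β (𝟙_ 𝒟)).hom := by
    rw [h1]; monoidal
  rw [cancel_mono] at h2
  calc
    _ = (ρ_ _).inv ≫ (α_ A (𝟙_ 𝒟) (𝟙_ 𝒟)).hom ≫ ((α_ _ _ _).inv ≫ (b.β (𝟙_ 𝒟)).hom ▷ 𝟙_ 𝒟 ≫
      (α_ _ _ _).hom ≫ (λ_ _).hom) ≫ (ρ_ A).hom ≫ (λ_ A).inv := by monoidal
    _ = _ := by rw [← h2]; monoidal

variable {𝒟 : Type u} [Category.{v} 𝒟] [MonoidalCategory 𝒟]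

/-- A universal natural family `A ⊗ Y ⟶ Y ⊗ T`, in a form that is stable under tensoring. -/
structure UniversalFamily (T : 𝒟) where
  /-- the representing object -/
  A : 𝒟
  /-- the universal family -/
  π : tensorLeft A ⟶ tensorRight T
  univ : ∀ (X W : 𝒟) (φ : tensorLeft W ⟶ tensorRight T ⋙ tensorLeft X),
    ∃! f : W ⟶ X ⊗ A, ∀ Y, f ▷ Y ≫ (α_ X A Y).hom ≫ X ◁ π.app Y = φ.app Y

namespace UniversalFamily

variable {T : 𝒟} (u : UniversalFamily T)

/-- The components of the universal family. -/
def pi (Y : 𝒟) : u.A ⊗ Y ⟶ Y ⊗ T := u.π.app Y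

lemma pi_naturality {Y Y' : 𝒟} (f : Y ⟶ Y') : u.A ◁ f ≫ u.pi Y' = u.pi Y ≫ f ▷ T :=
  u.π.naturality f

lemma ext {X W : 𝒟} {f g : W ⟶ X ⊗ u.A} (h : ∀ Y, f ▷ Y ≫ (α_ X u.A Y).hom ≫ X ◁ u.pi Y =
    g ▷ Y ≫ (α_ X u.A Y).hom ≫ X ◁ u.pi Y) : f = g :=
  (u.univ X W { app := fun Y => g ▷ Y ≫ (α_ X u.A Y).hom ≫ X ◁ u.pi Y
                naturality := fun Y Y' t => by
                  have := u.pi_naturality t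
                  change W ◁ t ≫ g ▷ Y' ≫ (α_ X u.A Y').hom ≫ X ◁ u.pi Y' =
                    (g ▷ Y ≫ (α_ X u.A Y).hom ≫ X ◁ u.pi Y) ≫ X ◁ t ▷ T
                  simp only [Category.assoc]
                  rw [whisker_exchange_assoc, ← whiskerLeft_comp, ← this]
                  simp }).unique h fun _ => rfl

lemma ext' {W : 𝒟} {f g : W ⟶ u.A} (h : ∀ Y, f ▷ Y ≫ u.pi Y = g ▷ Y ≫ u.pi Y) : f = g := by
  have : f ≫ (λ_ u.A).inv = g ≫ (λ_ u.A).inv := u.ext fun Y => by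
    have h' : ∀ e : W ⟶ u.A, (e ≫ (λ_ u.A).inv) ▷ Y ≫ (α_ (𝟙_ 𝒟) u.A Y).hom ≫ 𝟙_ 𝒟 ◁ u.pi Y =
        (e ▷ Y ≫ u.pi Y) ≫ (λ_ _).inv := fun e => by monoidal
    rw [h', h', h]
  simpa using this

lemma exists_of_nat (W : 𝒟) (φ : ∀ Y, W ⊗ Y ⟶ Y ⊗ T)
    (hφ : ∀ {Y Y' : 𝒟} (f : Y ⟶ Y'), W ◁ f ≫ φ Y' = φ Y ≫ f ▷ T) :
    ∃ f : W ⟶ u.A, ∀ Y, f ▷ Y ≫ u.pi Y = φ Y := by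
  obtain ⟨f, hf, -⟩ := u.univ (𝟙_ 𝒟) W
    { app := fun Y => φ Y ≫ (λ_ _).inv
      naturality := fun Y Y' f => by
        change W ◁ f ≫ φ Y' ≫ (λ_ _).inv = (φ Y ≫ (λ_ _).inv) ≫ 𝟙_ 𝒟 ◁ f ▷ T
        rw [reassoc_of% (hφ f)]; simp }
  refine ⟨f ≫ (λ_ _).hom, fun Y => ?_⟩
  have h1 := hf Y
  dsimp only at h1
  rw [← cancel_mono (λ_ (Y ⊗ T)).inv]
  refine Eq.trans ?_ h1
  change (_ ▷ Y ≫ u.pi Y) ≫ _ = f ▷ Y ≫ _ ≫ 𝟙_ 𝒟 ◁ u.pi Y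
  monoidal

/-- The family `Y ↦ π_{X ⊗ Y}` is natural in `Y`; this is why universality is required with values
in `X ⊗ A` and not only in `A`. -/
lemma exists_braid (X : 𝒟) : ∃ f : u.A ⊗ X ⟶ X ⊗ u.A,
    ∀ Y, f ▷ Y ≫ (α_ X u.A Y).hom ≫ X ◁ u.pi Y =
      (α_ u.A X Y).hom ≫ u.pi (X ⊗ Y) ≫ (α_ X Y T).hom :=
  (u.univ X (u.A ⊗ X)
    { app := fun Y => (α_ u.A X Y).hom ≫ u.pi (X ⊗ Y) ≫ (α_ X Y T).hom
      naturality := fun Y Y' t => by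
        have := u.pi_naturality (X ◁ t)
        change (u.A ⊗ X) ◁ t ≫ (α_ u.A X Y').hom ≫ u.pi (X ⊗ Y') ≫ (α_ X Y' T).hom =
          ((α_ u.A X Y).hom ≫ u.pi (X ⊗ Y) ≫ (α_ X Y T).hom) ≫ X ◁ t ▷ T
        simp only [tensor_whiskerLeft, Category.assoc, Iso.inv_hom_id_assoc]
        rw [reassoc_of% this]
        simp }).exists

/-- The half-braiding of the representing object. -/
def braid (X : 𝒟) : u.A ⊗ X ⟶ X ⊗ u.A := (u.exists_braid X).choose

lemma braid_spec (X Y : 𝒟) : u.braid X ▷ Y ≫ (α_ X u.A Y).hom ≫ X ◁ u.pi Y =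
      (α_ u.A X Y).hom ≫ u.pi (X ⊗ Y) ≫ (α_ X Y T).hom :=
  (u.exists_braid X).choose_spec Y

lemma braid_naturality {X X' : 𝒟} (f : X ⟶ X') : u.A ◁ f ≫ u.braid X' = u.braid X ≫ f ▷ u.A := by
  refine u.ext fun Y => ?_
  have h := u.pi_naturality (f ▷ Y)
  calc
    _ = (u.A ◁ f) ▷ Y ≫ u.braid X' ▷ Y ≫ (α_ X' u.A Y).hom ≫ X' ◁ u.pi Y := by simp
    _ = (α_ _ _ _).hom ≫ (u.A ◁ f ▷ Y ≫ u.pi (X' ⊗ Y)) ≫ (α_ _ _ _).hom := by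
      rw [braid_spec]; monoidal
    _ = ((α_ u.A X Y).hom ≫ u.pi (X ⊗ Y) ≫ (α_ X Y T).hom) ≫ f ▷ (Y ⊗ T) := by
      rw [h]; monoidal
    _ = u.braid X ▷ Y ≫ (α_ X u.A Y).hom ≫ (X ◁ u.pi Y ≫ f ▷ (Y ⊗ T)) := by
      rw [← braid_spec]; simp
    _ = _ := by
      rw [whisker_exchange]; monoidal

lemma braid_tensor (X X' : 𝒟) : u.braid (X ⊗ X') = (α_ u.A X X').inv ≫ u.braid X ▷ X' ≫
    (α_ X u.A X').hom ≫ X ◁ u.braid X' ≫ (α_ X X' u.A).inv := by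
  refine u.ext fun Y => ?_
  have h := u.pi_naturality (α_ X X' Y).hom
  calc
    _ = (α_ _ _ _).hom ≫ (u.pi ((X ⊗ X') ⊗ Y) ≫ (α_ X X' Y).hom ▷ T) ≫ (α_ _ _ _).hom ≫
        X ◁ (α_ _ _ _).hom ≫ (α_ _ _ _).inv := by
      rw [braid_spec]; monoidal
    _ = 𝟙 _ ⊗≫ ((α_ u.A X (X' ⊗ Y)).hom ≫ u.pi (X ⊗ (X' ⊗ Y)) ≫ (α_ X (X' ⊗ Y) T).hom) ⊗≫ 𝟙 _ := by
      rw [← h]; monoidal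
    _ = 𝟙 _ ⊗≫ u.braid X ▷ (X' ⊗ Y) ⊗≫
        X ◁ ((α_ u.A X' Y).hom ≫ u.pi (X' ⊗ Y) ≫ (α_ X' Y T).hom) ⊗≫ 𝟙 _ := by
      rw [← braid_spec]; monoidal
    _ = _ := by
      rw [← braid_spec]; monoidal

lemma braid_unit : u.braid (𝟙_ 𝒟) = (ρ_ u.A).hom ≫ (λ_ u.A).inv := by
  refine u.ext fun Y => ?_
  have h := u.pi_naturality (λ_ Y).hom
  calc
    _ = (α_ _ _ _).hom ≫ (u.pi (𝟙_ 𝒟 ⊗ Y) ≫ (λ_ Y).hom ▷ T) ≫ (λ_ _).inv := by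
      rw [braid_spec]; monoidal
    _ = _ := by
      rw [← h]; monoidal

variable [LeftRigidCategory 𝒟]

/-- The representing object as an object of the center. -/
def center : Center 𝒟 :=
  ⟨u.A,
    { β := fun X =>
        haveI := isIso_laxHalfBraiding u.braid u.braid_naturality u.braid_unit u.braid_tensor X
        asIso (u.braid X)
      monoidal := fun X X' => u.braid_tensor X X'
      naturality := fun f => u.braid_naturality f }⟩

/-- The counit on the representing object. -/
def counit : u.A ⟶ T := (ρ_ _).inv ≫ u.pi (𝟙_ 𝒟) ≫ (λ_ T).hom

/-- The defining property of the half-braiding at `Y = 1`. The universal family thus has the same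
shape as `action`. -/
lemma pi_eq_braid (X : 𝒟) : u.pi X = u.braid X ≫ X ◁ u.counit := by
  have h := u.braid_spec X (𝟙_ 𝒟)
  have h' := u.pi_naturality (ρ_ X).hom
  calc
    _ = (ρ_ _).inv ≫ (α_ _ _ _).hom ≫ u.A ◁ (ρ_ X).hom ≫ u.pi X := by
      monoidal
    _ = (ρ_ _).inv ≫ ((α_ u.A X (𝟙_ 𝒟)).hom ≫ u.pi (X ⊗ 𝟙_ 𝒟) ≫ (α_ X (𝟙_ 𝒟) T).hom) ≫
          X ◁ (λ_ T).hom := by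
      rw [h']; monoidal
    _ = _ := by
      rw [← h, counit]; monoidal

/-- The half-braiding of `Z` spreads `g` to a natural family `Z ⊗ Y ⟶ Y ⊗ T`, which factors through
the universal one; the tensor axiom of the half-braiding makes the factor a morphism of the center.
So `u.center` is cofree on `T`. -/
lemma exists_unique_center_hom (Z : Center 𝒟) (g : Z.1 ⟶ T) :
    ∃! g' : Z ⟶ u.center, g'.f ≫ u.counit = g := by
  have hn : ∀ {Y Y' : 𝒟} (f : Y ⟶ Y'), Z.1 ◁ f ≫ (Z.2.β Y').hom ≫ Y' ◁ g =
      ((Z.2.β Y).hom ≫ Y ◁ g) ≫ f ▷ T := by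
    intro Y Y' f
    rw [Z.2.naturality_assoc, Category.assoc, whisker_exchange]
  obtain ⟨f, hf⟩ := u.exists_of_nat Z.1 (fun Y => (Z.2.β Y).hom ≫ Y ◁ g) hn
  refine ⟨⟨f, fun X => ?_⟩, ?_, ?_⟩
  · change f ▷ X ≫ u.braid X = _
    refine u.ext fun Y => ?_
    calc
      _ = f ▷ X ▷ Y ≫ u.braid X ▷ Y ≫ (α_ X u.A Y).hom ≫ X ◁ u.pi Y := by simp
      _ = (α_ _ _ _).hom ≫ (f ▷ (X ⊗ Y) ≫ u.pi (X ⊗ Y)) ≫ (α_ _ _ _).hom := by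
        rw [braid_spec]; monoidal
      _ = (Z.2.β X).hom ▷ Y ≫ (α_ _ _ _).hom ≫ X ◁ ((Z.2.β Y).hom ≫ Y ◁ g) := by
        rw [hf, Z.2.monoidal]; monoidal
      _ = _ := by
        rw [← hf]; monoidal
  · change f ≫ u.counit = g
    have h1 := hf (𝟙_ 𝒟)
    have h2 := Z.2.β_unit
    calc
      _ = (ρ_ _).inv ≫ (f ▷ 𝟙_ 𝒟 ≫ u.pi (𝟙_ 𝒟)) ≫ (λ_ T).hom := by
        rw [counit]; monoidal
      _ = _ := by rw [h1, h2]; monoidal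
  · intro g' hg'
    apply Center.ext
    refine u.ext' fun Y => ?_
    change g'.f ▷ Y ≫ _ = f ▷ Y ≫ _
    have := g'.comm Y
    change g'.f ▷ Y ≫ u.braid Y = _ at this
    rw [hf, pi_eq_braid]
    refine ((Category.assoc _ _ _).symm.trans (congrArg (· ≫ Y ◁ u.counit) this)).trans ?_
    change ((Z.2.β Y).hom ≫ Y ◁ g'.f) ≫ Y ◁ u.counit = _
    rw [← hg', Category.assoc]
    exact congrArg _ (MonoidalCategory.whiskerLeft_comp _ _ _).symm

end UniversalFamily

end UniversalFamily

end

section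

/-! ### The right adjoint of the forgetful functor and the universal action -/

section RightAdjoint

variable {k : Type w} [Field k] {𝒟 : Type u} [Category.{v} 𝒟] [Preadditive 𝒟] [Linear k 𝒟]
  [MonoidalCategory 𝒟] [MonoidalPreadditive 𝒟] [MonoidalLinear k 𝒟] [RigidCategory 𝒟]
  {ι : Type u'} [Fintype ι] {V : ι → 𝒟}

/-- Finite direct sums of `ι`-indexed families exist. -/
def HasSums (ι : Type u') [Fintype ι] (𝒟 : Type u) [Category.{v} 𝒟] [Preadditive 𝒟] : Prop :=
  ∀ f : ι → 𝒟, ∃ (A : 𝒟) (s : ∀ i, f i ⟶ A) (r : ∀ i, A ⟶ f i),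
    (∀ i, s i ≫ r i = 𝟙 (f i)) ∧ (∀ i j, i ≠ j → s i ≫ r j = 0) ∧ ∑ i, r i ≫ s i = 𝟙 A

/-- The representing object is `⨁ (V_i ⊗ T) ⊗ V_i*`: natural families amount to arbitrary components
at the `V_i`, and by duality such a component is a morphism to the `i`-th summand. -/
lemma SimpleBasis.nonempty_universalFamily (hV : SimpleBasis k V) (hB : HasSums ι 𝒟) (T : 𝒟) :
    Nonempty (UniversalFamily T) := by
  obtain ⟨A, s, r, hsr, hsr0, hrs⟩ := hB fun i => (V i ⊗ T) ⊗ (V i)ᘁ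
  obtain ⟨π, hπ⟩ := hV.exists_natTrans (tensorLeft A) (tensorRight T)
    fun i => (tensorRightHomEquiv A (V i) (V i)ᘁ (V i ⊗ T)).symm (r i)
  -- the component at `V i` of a morphism in terms of the projections
  have key : ∀ (X W : 𝒟) (f : W ⟶ X ⊗ A) (i : ι),
      f ▷ V i ≫ (α_ X A (V i)).hom ≫ X ◁ π.app (V i) =
        (tensorRightHomEquiv W (V i) (V i)ᘁ (X ⊗ (V i ⊗ T))).symm
          (f ≫ X ◁ r i ≫ (α_ _ _ _).inv) := by
    intro X W f i
    rw [hπ]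
    simp only [tensorRightHomEquiv, Equiv.coe_fn_symm_mk]
    simp only [MonoidalCategory.whiskerLeft_comp, comp_whiskerRight, Category.assoc]
    monoidal
  refine ⟨⟨A, π, fun X W φ => ?_⟩⟩
  have heq : ∀ f : W ⟶ X ⊗ A, (∀ Y, f ▷ Y ≫ (α_ X A Y).hom ≫ X ◁ π.app Y = φ.app Y) ↔
      ∀ i, f ▷ V i ≫ (α_ X A (V i)).hom ≫ X ◁ π.app (V i) = φ.app (V i) := by
    intro f
    refine ⟨fun h i => h _, fun h Y => ?_⟩
    let ψ : tensorLeft W ⟶ tensorRight T ⋙ tensorLeft X :=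
      { app := fun Y => f ▷ Y ≫ (α_ X A Y).hom ≫ X ◁ π.app Y
        naturality := fun Y Y' t => by
          have := π.naturality t
          change A ◁ t ≫ π.app Y' = π.app Y ≫ t ▷ T at this
          change W ◁ t ≫ f ▷ Y' ≫ (α_ X A Y').hom ≫ X ◁ π.app Y' =
            (f ▷ Y ≫ (α_ X A Y).hom ≫ X ◁ π.app Y) ≫ X ◁ t ▷ T
          simp only [Category.assoc]
          rw [whisker_exchange_assoc, ← MonoidalCategory.whiskerLeft_comp, ← this]
          simp }
    have : ψ = φ := hV.natTrans_ext h
    exact congrArg (fun χ => χ.app Y) this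
  simp only [heq]
  let c : ∀ i, W ⟶ (X ⊗ (V i ⊗ T)) ⊗ (V i)ᘁ := fun i =>
    tensorRightHomEquiv W (V i) (V i)ᘁ (X ⊗ (V i ⊗ T)) (φ.app (V i))
  have hcond : ∀ f : W ⟶ X ⊗ A, (∀ i, f ▷ V i ≫ (α_ X A (V i)).hom ≫ X ◁ π.app (V i) =
      φ.app (V i)) ↔ ∀ i, f ≫ X ◁ r i = c i ≫ (α_ _ _ _).hom := by
    intro f
    refine forall_congr' fun i => ?_
    rw [key, Equiv.symm_apply_eq, ← Category.assoc, Iso.comp_inv_eq]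
  simp only [hcond]
  classical
  refine ⟨∑ i, c i ≫ (α_ _ _ _).hom ≫ X ◁ s i, fun i => ?_, fun f hf => ?_⟩
  · rw [Preadditive.sum_comp, Finset.sum_eq_single i]
    · simp only [Category.assoc, ← MonoidalCategory.whiskerLeft_comp, hsr]
      simp
    · intro j _ hj
      simp only [Category.assoc, ← MonoidalCategory.whiskerLeft_comp, hsr0 j i hj]
      simp
    · simp
  · rw [← Category.comp_id f, ← MonoidalCategory.whiskerLeft_id, ← hrs, whiskerLeft_sum,
      Preadditive.comp_sum]
    refine Finset.sum_congr rfl fun i _ => ?_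
    rw [MonoidalCategory.whiskerLeft_comp, ← Category.assoc, hf, Category.assoc]

/-- The forgetful functor of the center of a fusion category has a right adjoint. -/
theorem SimpleBasis.isLeftAdjoint_forget (hV : SimpleBasis k V) (hB : HasSums ι 𝒟) :
    (Center.forget 𝒟).IsLeftAdjoint := by
  have : ∀ T, HasTerminal (CostructuredArrow (Center.forget 𝒟) T) := by
    intro T
    obtain ⟨u⟩ := hV.nonempty_universalFamily hB T
    have huniv := u.exists_unique_center_hom
    let t : CostructuredArrow (Center.forget 𝒟) T :=
      CostructuredArrow.mk (Y := u.center) u.counit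
    refine IsTerminal.hasTerminal (X := t) (IsTerminal.ofUniqueHom (fun Z => ?_) fun Z m => ?_)
    · exact CostructuredArrow.homMk (huniv Z.left Z.hom).choose (huniv Z.left Z.hom).choose_spec.1
    · refine CostructuredArrow.hom_ext _ _ ?_
      exact (huniv Z.left Z.hom).choose_spec.2 _ (CostructuredArrow.w m)
  exact isLeftAdjoint_of_costructuredArrowTerminals _

variable {R : 𝒟 ⥤ Center 𝒟} (adj : Center.forget 𝒟 ⊣ R)

/-- The adjoint algebra of any right adjoint carries the universal action. -/
lemma exists_iso_universalFamily (u : UniversalFamily (𝟙_ 𝒟)) :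
    ∃ θ : adjAlg R ≅ u.A, ∀ X, θ.hom ▷ X ≫ u.pi X ≫ (ρ_ X).hom = action adj X := by
  obtain ⟨θ, hθ, -⟩ := u.exists_unique_center_hom (R.obj (𝟙_ 𝒟)) (adj.counit.app (𝟙_ 𝒟))
  let θ' : u.center ⟶ R.obj (𝟙_ 𝒟) := adj.homEquiv u.center (𝟙_ 𝒟) u.counit
  have hθ' : θ'.f ≫ adj.counit.app (𝟙_ 𝒟) = u.counit := by
    have := (adj.homEquiv u.center (𝟙_ 𝒟)).symm_apply_apply u.counit
    rwa [Adjunction.homEquiv_counit] at this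
  have h1 : θ ≫ θ' = 𝟙 _ := by
    apply (adj.homEquiv _ _).symm.injective
    rw [Adjunction.homEquiv_counit, Adjunction.homEquiv_counit]
    exact (Category.assoc θ.f θ'.f _).trans ((congrArg (θ.f ≫ ·) hθ').trans
      (hθ.trans (Category.id_comp (adj.counit.app (𝟙_ 𝒟))).symm))
  have h2 : θ' ≫ θ = 𝟙 _ := by
    refine (u.exists_unique_center_hom u.center u.counit).unique ?_ ?_
    · change (θ'.f ≫ θ.f) ≫ u.counit = u.counit
      exact (Category.assoc θ'.f θ.f _).trans ((congrArg (θ'.f ≫ ·) hθ).trans hθ')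
    · exact Category.id_comp _
  refine ⟨(Center.forget 𝒟).mapIso ⟨θ, θ', h1, h2⟩, fun X => ?_⟩
  change θ.f ▷ X ≫ u.pi X ≫ (ρ_ X).hom = (halfBraid (R.obj (𝟙_ 𝒟)) X).hom ≫
    X ◁ adj.counit.app (𝟙_ 𝒟) ≫ (ρ_ X).hom
  have aux : ∀ {A B T X : 𝒟} (t : A ⟶ B) (b : A ⊗ X ⟶ X ⊗ A) (b' : B ⊗ X ⟶ X ⊗ B) (c : B ⟶ T)
      (e : A ⟶ T) (r : X ⊗ T ⟶ X), t ▷ X ≫ b' = b ≫ X ◁ t → t ≫ c = e →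
      t ▷ X ≫ (b' ≫ X ◁ c) ≫ r = b ≫ X ◁ e ≫ r := by
    rintro A B T X t b b' c e r h rfl
    rw [MonoidalCategory.whiskerLeft_comp, Category.assoc, Category.assoc, reassoc_of% h]
  rw [u.pi_eq_braid]
  exact aux θ.f _ (u.braid X) u.counit _ _ (θ.comm X) hθ

lemma action_naturality {X Y : 𝒟} (f : X ⟶ Y) :
    adjAlg R ◁ f ≫ action adj Y = action adj X ≫ f := by
  have h := halfBraid_naturality (R.obj (𝟙_ 𝒟)) f
  simp only [action, Category.assoc]
  rw [reassoc_of% h, ← whisker_exchange_assoc]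
  exact congrArg (_ ≫ _ ≫ ·) (rightUnitor_naturality f)

/-- A morphism into the adjoint algebra is determined by its action. -/
lemma SimpleBasis.adjAlg_ext (hV : SimpleBasis k V) (hB : HasSums ι 𝒟) {W : 𝒟}
    {f g : W ⟶ adjAlg R}
    (h : ∀ i, f ▷ V i ≫ action adj (V i) = g ▷ V i ≫ action adj (V i)) : f = g := by
  obtain ⟨u⟩ := hV.nonempty_universalFamily hB (𝟙_ 𝒟)
  obtain ⟨θ, hθ⟩ := exists_iso_universalFamily adj u
  let φ (e : W ⟶ adjAlg R) : tensorLeft W ⟶ 𝟭 𝒟 :=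
    { app := fun Y => e ▷ Y ≫ action adj Y
      naturality := fun Y Y' t => by
        change W ◁ t ≫ e ▷ Y' ≫ action adj Y' = (e ▷ Y ≫ action adj Y) ≫ t
        rw [whisker_exchange_assoc, action_naturality, Category.assoc] }
  have hφ : φ f = φ g := hV.natTrans_ext h
  rw [← cancel_mono θ.hom]
  refine u.ext' fun Y => ?_
  have h1 : f ▷ Y ≫ action adj Y = g ▷ Y ≫ action adj Y := congrArg (fun χ => χ.app Y) hφ
  rw [← hθ, ← cancel_mono (ρ_ Y).inv] at h1
  simpa using h1

/-- Every natural family `W ⊗ Y ⟶ Y` is the action of a morphism into the adjoint algebra. -/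
lemma SimpleBasis.exists_action_eq (hV : SimpleBasis k V) (hB : HasSums ι 𝒟) (W : 𝒟)
    (φ : tensorLeft W ⟶ 𝟭 𝒟) : ∃ f : W ⟶ adjAlg R, ∀ Y, f ▷ Y ≫ action adj Y = φ.app Y := by
  obtain ⟨u⟩ := hV.nonempty_universalFamily hB (𝟙_ 𝒟)
  obtain ⟨θ, hθ⟩ := exists_iso_universalFamily adj u
  obtain ⟨f, hf⟩ := u.exists_of_nat W (fun Y => φ.app Y ≫ (ρ_ Y).inv) fun {Y Y'} t => by
    have := φ.naturality t
    change W ◁ t ≫ φ.app Y' = φ.app Y ≫ t at this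
    rw [reassoc_of% this, Category.assoc]
    simp
  refine ⟨f ≫ θ.inv, fun Y => ?_⟩
  have h : (f ≫ θ.inv) ▷ Y ≫ θ.hom ▷ Y = f ▷ Y := by
    rw [← comp_whiskerRight, Category.assoc, θ.inv_hom_id, Category.comp_id]
  rw [← hθ, reassoc_of% h, reassoc_of% (hf Y)]
  simp

/-- The action of the adjoint algebra is a morphism of families that is determined by, and can be
prescribed on, the simple objects. -/
lemma SimpleBasis.exists_action_eq_on_simples (hV : SimpleBasis k V) (hB : HasSums ι 𝒟) (W : 𝒟)
    (φ : ∀ i, W ⊗ V i ⟶ V i) : ∃ f : W ⟶ adjAlg R, ∀ i, f ▷ V i ≫ action adj (V i) = φ i := by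
  obtain ⟨φ', h⟩ := hV.exists_natTrans (tensorLeft W) (𝟭 𝒟) φ
  obtain ⟨f, hf⟩ := hV.exists_action_eq adj hB W φ'
  exact ⟨f, fun i => (hf _).trans (h i)⟩

/-- This is the universal property of the action for the source `W = 1`. -/
theorem SimpleBasis.toNat_bijective (hV : SimpleBasis k V) (hB : HasSums ι 𝒟) :
    Function.Bijective (toNat adj) := by
  refine ⟨fun a b h => ?_, fun ξ => ?_⟩
  · refine hV.adjAlg_ext adj hB fun i => ?_
    have h1 : (toNat adj a).app (V i) = (toNat adj b).app (V i) := by rw [h]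
    exact (cancel_epi _).1 h1
  · obtain ⟨f, hf⟩ := hV.exists_action_eq adj hB (𝟙_ 𝒟)
      { app := fun Y => (λ_ Y).hom ≫ ξ.app Y
        naturality := fun Y Y' t => by
          have := ξ.naturality t
          change t ≫ ξ.app Y' = ξ.app Y ≫ t at this
          change 𝟙_ 𝒟 ◁ t ≫ (λ_ Y').hom ≫ ξ.app Y' = ((λ_ Y).hom ≫ ξ.app Y) ≫ t
          rw [leftUnitor_naturality_assoc, this, Category.assoc] }
    refine ⟨f, ?_⟩
    ext Y
    change (λ_ Y).inv ≫ f ▷ Y ≫ action adj Y = _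
    rw [hf]
    simp

end RightAdjoint

end

section

/-! ### Spherical fusion categories and their simple objects -/

section SphericalBasis

/-- A finite family of simple objects of a spherical category, with dimensions `d`, to which the
category is semisimple. -/
structure SphericalBasis (k : Type w) [Field k] {C : Type u} [Category.{v} C] [Preadditive C]
    [Linear k C] [MonoidalCategory C] [RigidCategory C] (p : PivotalStructure C)
    {ι : Type u'} [Fintype ι] (V : ι → C) (d : ι → k) : Prop extends SimpleBasis k V where
  sums : HasSums ι C
  unit_bijective : Function.Bijective fun c : k => c • 𝟙 (𝟙_ C)
  trace_unit : p.trace (𝟙 (𝟙_ C)) = 𝟙 _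
  spherical : ∀ X, p.trace (𝟙 X) = p.trace (𝟙 Xᘁ)
  dim_eq : ∀ i, p.trace (𝟙 (V i)) = d i • 𝟙 (𝟙_ C)
  finite : ∀ X Y : C, FiniteDimensional k (X ⟶ Y)

lemma PivotalStructure.trace_id_congr {C : Type u} [Category.{v} C] [MonoidalCategory C]
    [RightRigidCategory C] (p : PivotalStructure C) {X Y : C} (e : X ≅ Y) :
    p.trace (𝟙 X) = p.trace (𝟙 Y) := by
  rw [← e.hom_inv_id, p.trace_cyclic, e.inv_hom_id]

section

variable {k : Type w} [Field k] {C : Type u} [Category.{v} C] [Preadditive C]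
    [Linear k C] [MonoidalCategory C] [MonoidalPreadditive C] [MonoidalLinear k C]
    [RightRigidCategory C]

lemma scalar_smul (h : Function.Bijective fun c : k => c • 𝟙 (𝟙_ C)) (f : 𝟙_ C ⟶ 𝟙_ C) :
    scalar k f • 𝟙 (𝟙_ C) = f :=
  Function.invFun_eq (h.2 f)

lemma scalar_eq (h : Function.Bijective fun c : k => c • 𝟙 (𝟙_ C)) {f : 𝟙_ C ⟶ 𝟙_ C} {c : k}
    (hf : f = c • 𝟙 (𝟙_ C)) : scalar k f = c :=
  h.1 ((scalar_smul h f).trans hf)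

/-- The unit object of a pivotal category with scalar endomorphisms of the unit has dimension `1`. -/
lemma PivotalStructure.trace_id_unit (p : PivotalStructure C)
    (h : Function.Bijective fun c : k => c • 𝟙 (𝟙_ C)) : p.trace (𝟙 (𝟙_ C)) = 𝟙 _ := by
  obtain ⟨z, hz⟩ := h.2 (p.trace (𝟙 (𝟙_ C)))
  dsimp only at hz
  -- Multiplicativity of the trace on `1 ⊗ 1 ≅ 1` makes the dimension of the unit idempotent.
  have h1 : z * z = z := by
    apply h.1
    have h2 := p.trace_tensor (𝟙 (𝟙_ C ⊗ 𝟙_ C))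
    rw [p.trace_id_congr (λ_ (𝟙_ C))] at h2
    have h3 : p.ptr (𝟙_ C) (𝟙 (𝟙_ C ⊗ 𝟙_ C)) = p.trace (𝟙 (𝟙_ C)) := by
      rw [← ptr_unit]; simp
    rw [h3, ← hz, p.trace_smul, ← hz, smul_smul] at h2
    exact h2.symm
  -- If it were zero, `whiskerLeft_iso_evr_aux` would make all pivotal evaluations on dual objects
  -- vanish, and the zigzag identities would make every object zero.
  have h0 : z ≠ 0 := by
    rintro rfl
    have key : ∀ X : C, 𝟙 X = 0 := by
      intro X
      have h2 := p.whiskerLeft_iso_evr_aux X (Iso.refl _)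
      rw [← hz, zero_smul, comp_zero] at h2
      have h3 : p.evr Xᘁ = 0 := by
        have h4 : Xᘁ ◁ (p.iso X).inv ≫ Xᘁ ◁ (p.iso X).hom ≫ p.evr Xᘁ = 0 := by
          rw [h2, comp_zero]
        rwa [← MonoidalCategory.whiskerLeft_comp_assoc, Iso.inv_hom_id,
          MonoidalCategory.whiskerLeft_id, Category.id_comp] at h4
      have h6 : 𝟙 Xᘁ = 0 := by
        have h5 : 𝟙 (Xᘁ : C) = 𝟙 _ ⊗≫ ((Xᘁ : C) ◁ p.coevr (Xᘁ : C) ⊗≫ p.evr (Xᘁ : C) ▷ (Xᘁ : C)) ⊗≫ 𝟙 _ := by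
          rw [evr_coevr]; monoidal
        rw [h5, h3]
        simp [monoidalComp]
      have h7 : 𝟙 X = 𝟙 _ ⊗≫ (η_ X Xᘁ ▷ X ⊗≫ X ◁ (𝟙 Xᘁ ▷ X) ⊗≫ X ◁ ε_ X Xᘁ) ⊗≫ 𝟙 _ := by
        have h8 := ExactPairing.evaluation_coevaluation'' X Xᘁ
        calc
          𝟙 X = 𝟙 _ ⊗≫ (η_ X Xᘁ ▷ X ⊗≫ X ◁ ε_ X Xᘁ) ⊗≫ 𝟙 _ := by rw [h8]; monoidal
          _ = _ := by monoidal
      rw [h7, h6]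
      simp [monoidalComp]
    have h9 := key (𝟙_ C)
    have h10 : (1 : k) = 0 := h.1 (by simp [h9])
    exact one_ne_zero h10
  have : z = 1 := by
    have := mul_right_cancel₀ h0 (h1.trans (one_mul z).symm)
    exact this
  rw [← hz, this, one_smul]

end

variable {k : Type w} [Field k] [IsAlgClosed k]
    {C : Type u} [Category.{v} C] [Abelian C] [Linear k C]
    [MonoidalCategory C] [MonoidalPreadditive C] [MonoidalLinear k C] [RigidCategory C]

lemma hasSums_of_abelian (ι : Type u') [Fintype ι] : HasSums ι C := by
  intro f
  have := Abelian.hasFiniteBiproducts (C := C)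
  have : HasBiproductsOfShape ι C := inferInstance
  classical
  refine ⟨⨁ f, biproduct.ι f, biproduct.π f, fun i => biproduct.ι_π_self f i,
    fun i j h => biproduct.ι_π_ne f h, ?_⟩
  refine biproduct.hom_ext _ _ fun j => ?_
  rw [Preadditive.sum_comp, Finset.sum_eq_single j]
  · simp
  · intro i _ hij
    rw [Category.assoc, biproduct.ι_π_ne f hij, comp_zero]
  · simp

theorem IsFusion.simpleBasis (hC : IsFusion k C) {ι : Type u'} [Fintype ι] {V : ι → C}
    (hV : IsSimpleFamily V) : SimpleBasis k V where
  hom_eq_zero i j hij f := by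
    by_contra hf
    have := hV.simple i
    have := hV.simple j
    have := isIso_of_hom_simple hf
    exact hij (hV.distinct i j ⟨asIso f⟩)
  end_scalar i f := by
    have := hV.simple i
    have := hC.finiteDimensional (V i) (V i)
    obtain ⟨c, hc⟩ := endomorphism_simple_eq_smul_id k f
    exact ⟨c, hc.symm⟩
  id_ne_zero i := by
    have := hV.simple i
    exact id_nonzero _
  decomp X := by
    classical
    have := Abelian.hasFiniteBiproducts (C := C)
    obtain ⟨n, S, hS, ⟨e⟩⟩ := hC.semisimple X
    choose g hg using fun i => hV.complete (S i) (hS i)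
    let φ := fun i => (hg i).some
    -- `E l` enumerates the summands of `X` that are isomorphic to `V l`, so its length is the
    -- multiplicity.
    let E := fun l => (Fintype.equivFin {i // g i = l}).symm
    refine ⟨fun l => Fintype.card {i // g i = l},
      fun l α => e.hom ≫ biproduct.π S _ ≫ (φ (E l α).1).hom ≫ eqToHom (congrArg V (E l α).2),
      fun l α => eqToHom (congrArg V (E l α).2.symm) ≫ (φ (E l α).1).inv ≫
        biproduct.ι S _ ≫ e.inv, ?_⟩
    have h1 : ∀ l, ∑ α, (e.hom ≫ biproduct.π S _ ≫ (φ (E l α).1).hom ≫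
        eqToHom (congrArg V (E l α).2)) ≫ (eqToHom (congrArg V (E l α).2.symm) ≫
          (φ (E l α).1).inv ≫ biproduct.ι S _ ≫ e.inv) =
        ∑ i : {i // g i = l}, e.hom ≫ (biproduct.π S i.1 ≫ biproduct.ι S i.1) ≫ e.inv := by
      intro l
      rw [← Equiv.sum_comp (E l)]
      refine Finset.sum_congr rfl fun α _ => ?_
      simp
    rw [Finset.sum_congr rfl fun l _ => h1 l]
    rw [Fintype.sum_fiberwise g fun i => e.hom ≫ (biproduct.π S i ≫ biproduct.ι S i) ≫ e.inv]
    rw [← Preadditive.comp_sum, ← Preadditive.sum_comp, biproduct.total]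
    simp

theorem IsFusion.sphericalBasis (hC : IsFusion k C) (p : SphericalStructure C) {ι : Type u'}
    [Fintype ι] {V : ι → C} (hV : IsSimpleFamily V) :
    SphericalBasis k p.toPivotalStructure V fun i => p.dim k (V i) where
  toSimpleBasis := hC.simpleBasis hV
  sums := hasSums_of_abelian ι
  unit_bijective := hC.end_unit
  trace_unit := p.trace_id_unit hC.end_unit
  spherical := p.spherical
  dim_eq _ := (scalar_smul hC.end_unit _).symm
  finite := hC.finiteDimensional

end SphericalBasis

end

section

/-! ### Scalars of endomorphisms of simple objects -/

section Coefficient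

variable {k : Type w} [Field k] {𝒟 : Type u} [Category.{v} 𝒟] [Preadditive 𝒟]
    [Linear k 𝒟] {ι : Type u'} [Fintype ι] {V : ι → 𝒟}

/-- The scalar by which an endomorphism of a simple object acts. -/
def SimpleBasis.coeff (hV : SimpleBasis k V) (i : ι) (f : V i ⟶ V i) : k :=
  (hV.end_scalar i f).choose

lemma SimpleBasis.coeff_smul (hV : SimpleBasis k V) (i : ι) (f : V i ⟶ V i) :
    f = hV.coeff i f • 𝟙 (V i) :=
  (hV.end_scalar i f).choose_spec

lemma SimpleBasis.coeff_eq (hV : SimpleBasis k V) (i : ι) {f : V i ⟶ V i} {c : k}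
    (h : f = c • 𝟙 (V i)) : hV.coeff i f = c :=
  hV.smul_id_injective i ((hV.coeff_smul i f).symm.trans h)

lemma SimpleBasis.exists_retract (hV : SimpleBasis k V) {X : 𝒟} (hX : 𝟙 X ≠ 0) :
    ∃ i, Nonempty (Retract (V i) X) := by
  by_contra! h
  apply hX
  refine hV.hom_ext_target fun i t => ?_
  by_contra ht
  rw [Category.id_comp, zero_comp] at ht
  exact (h i).false (hV.retract_of_ne_zero ht).some

end Coefficient

/-! ### The regular partial trace of a fusion subcategory -/

section Closure

variable {k : Type w} [Field k] {C : Type u} [Category.{v} C] [Abelian C] [Linear k C]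
  [MonoidalCategory C] [MonoidalPreadditive C] [MonoidalLinear k C] [RigidCategory C]

/-- The whole category as a fusion subcategory. -/
def FusionSubcategory.whole : FusionSubcategory C where
  prop _ := True
  isMonoidal := { prop_unit := trivial, prop_tensor := fun _ _ _ _ => trivial }
  retract := ⟨fun _ _ => trivial⟩
  biprod _ _ _ _ := trivial
  dual _ _ := trivial

variable (p : PivotalStructure C) {ι : Type u'} [Fintype ι] (V : ι → C) (d : ι → k)
  (D : FusionSubcategory C)

open scoped Classical in
/-- The partial trace over the regular object of a fusion subcategory. -/
def regTrace {X Z : C} (h : ∀ Y, D.prop Y → (X ⊗ Y ⟶ Z ⊗ Y)) : X ⟶ Z :=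
  ∑ i : {i // D.prop (V i)}, d i • p.ptr (V i) (h (V i) i.2)

open scoped Classical in
/-- The global dimension of a fusion subcategory. -/
def globalDim : k := ∑ i : {i // D.prop (V i)}, d i * d i

variable {p V d}

lemma SphericalBasis.ptr_id (hV : SphericalBasis k p V d) (X : C) (i : ι) :
    p.ptr (V i) (𝟙 (X ⊗ V i)) = d i • 𝟙 X := by
  have h : p.ptr (V i) (𝟙 (X ⊗ V i)) = (ρ_ X).inv ≫ X ◁ p.trace (𝟙 (V i)) ≫ (ρ_ X).hom := by
    rw [p.trace_def, PivotalStructure.ptr]; monoidal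
  rw [h, hV.dim_eq]
  simp

lemma SphericalBasis.ptr_whiskerRight (hV : SphericalBasis k p V d) {X Z : C} (f : X ⟶ Z) (i : ι) :
    p.ptr (V i) (f ▷ V i) = d i • f := by
  rw [← Category.comp_id (f ▷ V i), p.ptr_comp_left, hV.ptr_id]
  simp

lemma SphericalBasis.regTrace_whiskerRight (hV : SphericalBasis k p V d) {X Z : C} (f : X ⟶ Z) :
    regTrace p V d D (fun Y _ => f ▷ Y) = globalDim V d D • f := by
  simp only [regTrace, globalDim, hV.ptr_whiskerRight, smul_smul, Finset.sum_smul]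

lemma regTrace_comp {X' X Z Z' : C} (f : X' ⟶ X) (g : Z ⟶ Z')
    (h : ∀ Y, D.prop Y → (X ⊗ Y ⟶ Z ⊗ Y)) :
    regTrace p V d D (fun Y hY => f ▷ Y ≫ h Y hY ≫ g ▷ Y) = f ≫ regTrace p V d D h ≫ g := by
  simp only [regTrace, p.ptr_comp_left, p.ptr_comp_right, Preadditive.comp_sum,
    Preadditive.sum_comp, Linear.comp_smul, Linear.smul_comp]

variable {D}

/-- The partial trace over the regular object commutes with half-braidings. -/
theorem SphericalBasis.regTrace_central (hV : SphericalBasis k p V d) {X Z : C}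
    (h : ∀ Y, D.prop Y → (X ⊗ Y ⟶ Z ⊗ Y))
    (hnat : ∀ {Y Y' : C} (hY : D.prop Y) (hY' : D.prop Y') (f : Y ⟶ Y'),
      X ◁ f ≫ h Y' hY' = h Y hY ≫ Z ◁ f)
    {U : C} (hU : D.prop U) (b : X ⊗ U ⟶ U ⊗ X) (b' : U ⊗ Z ⟶ Z ⊗ U)
    (hb : ∀ W (hW : D.prop W), h (U ⊗ W) (D.isMonoidal.prop_tensor U W hU hW) =
      (α_ X U W).inv ≫ b ▷ W ≫ (α_ U X W).hom ≫ U ◁ h W hW ≫ (α_ U Z W).inv ≫ b' ▷ W ≫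
        (α_ Z U W).hom) :
    b ≫ U ◁ regTrace p V d D h ≫ b' = regTrace p V d D h ▷ U := by
  have := p.sum_ptr_tensor hV.toSimpleBasis hV.trace_unit hV.unit_bijective.1 hV.spherical
    hV.dim_eq (P := D.prop) (fun r hY => D.retract.of_retract r hY)
    (fun hX hY => D.isMonoidal.prop_tensor _ _ hX hY) (fun hX => D.dual _ hX) h hnat hU
  rw [regTrace, ← this]
  simp only [whiskerLeft_sum, Preadditive.comp_sum, Preadditive.sum_comp]
  refine Finset.sum_congr rfl fun i _ => ?_
  -- By `hb` the crossings with `U` lie outside the loop `V i`, so they can be pulled out of the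
  -- partial trace.
  have h1 : (α_ X U (V i)).hom ≫ h (U ⊗ V i) (D.isMonoidal.prop_tensor U _ hU i.2) ≫
      (α_ Z U (V i)).inv = b ▷ V i ≫ ((α_ U X (V i)).hom ≫ U ◁ h (V i) i.2 ≫
        (α_ U Z (V i)).inv) ≫ b' ▷ V i := by
    rw [hb _ i.2]; simp
  have h2 := p.ptr_whiskerLeft U (h (V i) i.2)
  rw [h1, p.ptr_comp_left, p.ptr_comp_right, h2]
  simp

end Closure

/-! ### Monodromy and centralizers -/

section Centralizer

variable {C : Type u} [Category.{v} C] [MonoidalCategory C] [BraidedCategory C]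

/-- The inverse of the monodromy. -/
def invMono (X Y : C) : X ⊗ Y ⟶ X ⊗ Y := (β_ Y X).inv ≫ (β_ X Y).inv

lemma invMono_eq_id_iff (X Y : C) :
    invMono X Y = 𝟙 _ ↔ (β_ X Y).hom ≫ (β_ Y X).hom = 𝟙 (X ⊗ Y) := by
  rw [invMono, Iso.inv_comp_eq, Category.comp_id, ← cancel_epi (β_ X Y).hom, Iso.hom_inv_id, eq_comm]

lemma invMono_eq_id_symm {X Y : C} (h : invMono X Y = 𝟙 _) : invMono Y X = 𝟙 _ := by
  rw [invMono, Iso.inv_comp_eq, Category.comp_id] at h ⊢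
  rw [← cancel_epi (β_ Y X).hom, Iso.hom_inv_id, ← h, Iso.inv_hom_id]

lemma invMono_naturality (X : C) {Y Y' : C} (f : Y ⟶ Y') :
    X ◁ f ≫ invMono X Y' = invMono X Y ≫ X ◁ f := by
  simp [invMono]

/-- This is the shape that `regTrace_central` asks for, with inverse braidings as the two crossings.
-/
lemma invMono_tensor (X U W : C) : invMono X (U ⊗ W) =
    (α_ X U W).inv ≫ (β_ U X).inv ▷ W ≫ (α_ U X W).hom ≫ U ◁ invMono X W ≫ (α_ U X W).inv ≫
      (β_ X U).inv ▷ W ≫ (α_ X U W).hom := by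
  simp [invMono, BraidedCategory.braiding_tensor_right_inv,
    BraidedCategory.braiding_tensor_left_inv]

lemma invMono_unit (X : C) : invMono X (𝟙_ C) = 𝟙 _ := by
  simp [invMono]

lemma invMono_tensor_eq_id {X U W : C} (hU : invMono X U = 𝟙 _) (hW : invMono X W = 𝟙 _) :
    invMono X (U ⊗ W) = 𝟙 _ := by
  rw [invMono_tensor, hW]
  rw [invMono] at hU
  simp [← comp_whiskerRight_assoc, hU]

lemma invMono_retract_eq_id {X Y Y' : C} (r : Retract Y Y') (h : invMono X Y' = 𝟙 _) :
    invMono X Y = 𝟙 _ := by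
  have h1 := invMono_naturality X r.i
  rw [h, Category.comp_id] at h1
  calc
    _ = (invMono X Y ≫ X ◁ r.i) ≫ X ◁ r.r := by
      rw [Category.assoc, ← MonoidalCategory.whiskerLeft_comp, r.retract]; simp
    _ = _ := by
      rw [← h1, ← MonoidalCategory.whiskerLeft_comp, r.retract]; simp

/-- Naturality along the evaluation of `Y` makes the monodromy with `Y* ⊗ Y` invisible after
evaluating. Since `Y` contributes nothing, the monodromy with `Y*` is trivial by duality. -/
lemma invMono_rightDual_eq_id [RightRigidCategory C] {X Y : C} (h : invMono X Y = 𝟙 _) :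
    invMono X Yᘁ = 𝟙 _ := by
  have h1 := invMono_naturality X (ε_ Y Yᘁ)
  rw [invMono_unit, Category.comp_id, invMono_tensor, h] at h1
  refine (tensorRightHomEquiv (X ⊗ Yᘁ) Y Yᘁ X).symm.injective ?_
  simp only [tensorRightHomEquiv, Equiv.coe_fn_symm_mk]
  rw [← cancel_epi (α_ X Yᘁ Y).inv, invMono]
  simpa using h1.symm =≫ (ρ_ X).hom

section

variable [RigidCategory C] [Abelian C] [MonoidalPreadditive C]

lemma invMono_biprod_eq_id {X Y Y' : C} (h : invMono X Y = 𝟙 _) (h' : invMono X Y' = 𝟙 _) :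
    invMono X (Y ⊞ Y') = 𝟙 _ := by
  have h1 := invMono_naturality X (biprod.fst : Y ⊞ Y' ⟶ Y)
  have h2 := invMono_naturality X (biprod.snd : Y ⊞ Y' ⟶ Y')
  rw [h, Category.comp_id] at h1
  rw [h', Category.comp_id] at h2
  have h3 : X ◁ (biprod.fst : Y ⊞ Y' ⟶ Y) ≫ X ◁ biprod.inl +
      X ◁ (biprod.snd : Y ⊞ Y' ⟶ Y') ≫ X ◁ biprod.inr = 𝟙 _ := by
    rw [← MonoidalCategory.whiskerLeft_comp, ← MonoidalCategory.whiskerLeft_comp,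
      ← MonoidalPreadditive.whiskerLeft_add, biprod.total, MonoidalCategory.whiskerLeft_id]
  calc
    _ = invMono X (Y ⊞ Y') ≫ 𝟙 _ := (Category.comp_id _).symm
    _ = _ := by
      rw [← h3, Preadditive.comp_add, ← Category.assoc, ← h1, ← Category.assoc, ← h2]

/-- The objects that centralize all objects of `D`, as a fusion subcategory. -/
def FusionSubcategory.centralizing (D : FusionSubcategory C) : FusionSubcategory C where
  prop X := ∀ Y, D.prop Y → invMono Y X = 𝟙 _
  isMonoidal :=
    { prop_unit := fun _ _ => invMono_unit _
      prop_tensor := fun _ _ h h' Y hY => invMono_tensor_eq_id (h Y hY) (h' Y hY) }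
  retract := ⟨fun r h Y hY => invMono_retract_eq_id r (h Y hY)⟩
  biprod _ _ h h' Y hY := invMono_biprod_eq_id (h Y hY) (h' Y hY)
  dual _ h Y hY := invMono_rightDual_eq_id (h Y hY)

/-- The centralizing objects already form a fusion subcategory, so generation adds no further simple
objects. -/
lemma FusionSubcategory.centralizer_prop_iff (D : FusionSubcategory C) {X : C} (hX : Simple X) :
    D.centralizer.prop X ↔ ∀ Y, D.prop Y → invMono X Y = 𝟙 _ := by
  refine ⟨fun h Y hY => ?_, fun h E hE => hE X ⟨hX, fun Y hY => ?_⟩⟩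
  · refine invMono_eq_id_symm (h D.centralizing (fun Z hZ W hW => ?_) Y hY)
    exact invMono_eq_id_symm ((invMono_eq_id_iff _ _).2 (hZ.2 W hW))
  · exact (invMono_eq_id_iff _ _).1 (h Y hY)

end

end Centralizer

end

section

/-! ### The S-matrix, the killing property and the double centralizer theorem -/

section RingMatrix

/-- Sliding the cup and the cap across `Y` replaces the braidings with `X*` by inverse braidings
with `X`. This reconciles the S-matrix, defined with `V_i*`, with the inverse monodromy of the
Drinfeld map. -/
lemma PivotalStructure.lptr_monodromy {C : Type u} [Category.{v} C] [MonoidalCategory C]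
    [BraidedCategory C] [RightRigidCategory C] (p : PivotalStructure C)
    (hp : p.trace (𝟙 (𝟙_ C)) = 𝟙 _) (X Y : C) :
    p.lptr Xᘁ ((β_ Xᘁ Y).hom ≫ (β_ Y Xᘁ).hom) = p.ptr X (invMono Y X) := by
  have h1 : (λ_ Y).inv ≫ η_ X Xᘁ ▷ Y ≫ (α_ X Xᘁ Y).hom ≫ X ◁ (β_ Xᘁ Y).hom =
      (ρ_ Y).inv ≫ Y ◁ η_ X Xᘁ ≫ (α_ Y X Xᘁ).inv ≫ (β_ X Y).inv ▷ Xᘁ ≫ (α_ X Y Xᘁ).hom := by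
    have h := BraidedCategory.braiding_naturality_left (η_ X Xᘁ) Y
    rw [BraidedCategory.braiding_tensor_left_hom, braiding_tensorUnit_left] at h
    rw [← cancel_mono (α_ X Y Xᘁ).inv, ← cancel_mono ((β_ X Y).hom ▷ Xᘁ),
      ← cancel_mono (α_ Y X Xᘁ).hom]
    simp only [Category.assoc, Iso.hom_inv_id_assoc, Iso.inv_hom_id, Category.comp_id,
      ← comp_whiskerRight_assoc, id_whiskerRight, Category.id_comp] at h ⊢
    rw [h]; simp
  have h2 : X ◁ (β_ Y Xᘁ).hom ≫ (α_ X Xᘁ Y).inv ≫ p.evr X ▷ Y ≫ (λ_ Y).hom =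
      (α_ X Y Xᘁ).inv ≫ (β_ Y X).inv ▷ Xᘁ ≫ (α_ Y X Xᘁ).hom ≫ Y ◁ p.evr X ≫ (ρ_ Y).hom := by
    have h := BraidedCategory.braiding_naturality_right Y (p.evr X)
    rw [BraidedCategory.braiding_tensor_right_hom, braiding_tensorUnit_right] at h
    rw [← cancel_epi (α_ X Y Xᘁ).hom, ← cancel_epi ((β_ Y X).hom ▷ Xᘁ),
      ← cancel_epi (α_ Y X Xᘁ).inv]
    simp only [Category.assoc, Iso.hom_inv_id_assoc, ← comp_whiskerRight_assoc, Iso.hom_inv_id,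
      id_whiskerRight, Category.id_comp, Iso.inv_hom_id_assoc] at h ⊢
    have h' := h =≫ (λ_ Y).hom
    simp only [Category.assoc, Iso.inv_hom_id, Category.comp_id] at h'
    exact h'.symm
  rw [p.lptr_rightDual hp]
  calc
    _ = ((λ_ Y).inv ≫ η_ X Xᘁ ▷ Y ≫ (α_ X Xᘁ Y).hom ≫ X ◁ (β_ Xᘁ Y).hom) ≫
        (X ◁ (β_ Y Xᘁ).hom ≫ (α_ X Xᘁ Y).inv ≫ p.evr X ▷ Y ≫ (λ_ Y).hom) := by monoidal
    _ = _ := by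
      rw [h1, h2, invMono, PivotalStructure.ptr]
      simp

variable {k : Type w} [Field k] {C : Type u} [Category.{v} C] [Abelian C] [Linear k C]
  [MonoidalCategory C] [MonoidalPreadditive C] [MonoidalLinear k C] [RigidCategory C]
  [BraidedCategory C] {p : PivotalStructure C} {ι : Type u'} [Fintype ι] {V : ι → C} {d : ι → k}

variable (hV : SphericalBasis k p V d)

/-- The scalar by which a strand `V j` encircled by a loop `V i` acts. -/
def SphericalBasis.ring (i j : ι) : k := hV.coeff j (p.ptr (V i) (invMono (V j) (V i)))

namespace SphericalBasis

lemma ptr_invMono (i j : ι) : p.ptr (V i) (invMono (V j) (V i)) = hV.ring i j • 𝟙 (V j) :=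
  hV.coeff_smul j _

lemma sMatrix_eq (i j : ι) : p.sMatrix k V i j = hV.ring i j * d j := by
  refine scalar_eq hV.unit_bijective ?_
  rw [← p.trace_lptr hV.toSimpleBasis hV.trace_unit hV.spherical, p.lptr_monodromy hV.trace_unit,
    hV.ptr_invMono, p.trace_smul, hV.dim_eq, smul_smul]

open scoped Classical in
/-- Killing property of the regular object of a fusion subcategory. -/
lemma sum_dim_mul_ring (D : FusionSubcategory C) (j : ι) :
    ∑ i : {i // D.prop (V i)}, d i * hV.ring i j =
      if ∀ Y, D.prop Y → invMono (V j) Y = 𝟙 _ then globalDim V d D else 0 := by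
  have h0 : regTrace p V d D (fun Y _ => invMono (V j) Y) =
      (∑ i : {i // D.prop (V i)}, d i * hV.ring i j) • 𝟙 (V j) := by
    simp only [regTrace, hV.ptr_invMono, smul_smul, Finset.sum_smul]
  split_ifs with h
  · refine hV.smul_id_injective j ?_
    rw [← h0, ← hV.regTrace_whiskerRight]
    congr 1
    ext Y hY
    rw [h Y hY, id_whiskerRight]
  · by_contra hne
    refine h fun Y hY => ?_
    -- The handle slide says that the scalar times the inverse monodromy is the scalar times the
    -- identity; a nonzero scalar cancels.
    have h1 := hV.regTrace_central (D := D) (fun Y _ => invMono (V j) Y)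
      (fun _ _ f => invMono_naturality (V j) f) hY (β_ Y (V j)).inv (β_ (V j) Y).inv
      (fun W _ => invMono_tensor (V j) Y W)
    rw [h0] at h1
    have h2 : (∑ i : {i // D.prop (V i)}, d i * hV.ring i j) • invMono (V j) Y =
        (∑ i : {i // D.prop (V i)}, d i * hV.ring i j) • 𝟙 (V j ⊗ Y) := by
      simpa [invMono] using h1
    exact smul_right_injective _ hne h2

open scoped Classical in
/-- The vector of dimensions of the simple objects of a fusion subcategory. -/
def _root_.FusionCat.dimVector (V : ι → C) (d : ι → k) (D : FusionSubcategory C) (i : ι) : k :=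
  if D.prop (V i) then d i else 0

include hV in
open scoped Classical in
-- This is the killing property multiplied by `d j`. Together with injectivity of the S-matrix it
-- yields the nonvanishing of global dimensions and the double centralizer theorem.
lemma dimVector_vecMul_sMatrix (D : FusionSubcategory C) :
    Matrix.vecMul (dimVector V d D) (p.sMatrix k V) =
      globalDim V d D • dimVector V d D.centralizing := by
  ext j
  have h := hV.sum_dim_mul_ring D j
  rw [← Finset.sum_subtype (Finset.univ.filter fun i => D.prop (V i)) (by simp)
    (fun i => d i * hV.ring i j), Finset.sum_filter] at h
  have h1 : Matrix.vecMul (dimVector V d D) (p.sMatrix k V) j =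
      (∑ i, if D.prop (V i) then d i * hV.ring i j else 0) * d j := by
    simp only [Matrix.vecMul, dotProduct, hV.sMatrix_eq, dimVector, Finset.sum_mul]
    refine Finset.sum_congr rfl fun i _ => ?_
    split_ifs <;> ring
  have h2 : D.centralizing.prop (V j) ↔ ∀ Y, D.prop Y → invMono (V j) Y = 𝟙 _ :=
    forall₂_congr fun Y _ => ⟨invMono_eq_id_symm, invMono_eq_id_symm⟩
  rw [h1, h, Pi.smul_apply, dimVector, smul_eq_mul]
  simp only [h2]
  split_ifs <;> simp

variable [DecidableEq ι] (hS : IsUnit (p.sMatrix k V))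
include hV hS

/-- Column `j` of the S-matrix is a multiple of `d j`. -/
lemma dim_ne_zero (j : ι) : d j ≠ 0 := by
  intro h
  have h1 : (p.sMatrix k V).mulVec (Pi.single j 1) = (p.sMatrix k V).mulVec 0 := by
    ext i
    simp [hV.sMatrix_eq, h]
  have h2 := congrFun (Matrix.mulVec_injective_of_isUnit hS h1) j
  simp at h2

/-- Otherwise the S-matrix would annihilate the dimension vector of `D`, whose entry at the simple
object found in the unit is nonzero. No assumption on the characteristic is needed. -/
lemma globalDim_ne_zero (D : FusionSubcategory C) : globalDim V d D ≠ 0 := by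
  intro h
  have h1 := hV.dimVector_vecMul_sMatrix D
  rw [h, zero_smul, ← Matrix.zero_vecMul (p.sMatrix k V)] at h1
  have h2 := Matrix.vecMul_injective_of_isUnit hS h1
  have h0 : 𝟙 (𝟙_ C) ≠ 0 := fun h0 => one_ne_zero (α := k) (hV.unit_bijective.1 (by simp [h0]))
  obtain ⟨i, ⟨r⟩⟩ := hV.exists_retract h0
  have h3 := congrFun h2 i
  rw [dimVector, if_pos (D.retract.of_retract r D.isMonoidal.prop_unit)] at h3
  exact hV.dim_ne_zero hS i h3

lemma ring_injective : Function.Injective fun t : ι → k => fun j => ∑ i, t i * hV.ring i j := by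
  intro t t' h
  refine Matrix.vecMul_injective_of_isUnit hS ?_
  ext j
  have := congrFun h j
  simp only [Matrix.vecMul, dotProduct, hV.sMatrix_eq, ← mul_assoc, ← Finset.sum_mul]
  simp only at this
  rw [this]

omit hV hS in
lemma _root_.FusionCat.FusionSubcategory.centralizing_anti {D E : FusionSubcategory C}
    (h : ∀ X, D.prop X → E.prop X) (X : C) (hX : E.centralizing.prop X) : D.centralizing.prop X :=
  fun Y hY => hX Y (h Y hY)

/-- The double centralizer theorem, on simple objects. -/
lemma centralizing_centralizing (D : FusionSubcategory C) (j : ι) :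
    D.centralizing.centralizing.prop (V j) ↔ D.prop (V j) := by
  have hle : ∀ (E : FusionSubcategory C) (X : C), E.prop X → E.centralizing.centralizing.prop X :=
    fun E X hX Y hY => invMono_eq_id_symm (hY X hX)
  -- Taking centralizers is an order-reversing Galois connection, so the triple centralizer is the
  -- single one.
  have h3 : D.centralizing.centralizing.centralizing.prop = D.centralizing.prop := by
    ext X
    exact ⟨FusionSubcategory.centralizing_anti (hle D) X, hle D.centralizing X⟩
  have h1 := hV.dimVector_vecMul_sMatrix D
  have h2 := hV.dimVector_vecMul_sMatrix D.centralizing.centralizing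
  have h4 : dimVector V d D.centralizing.centralizing.centralizing =
      dimVector V d D.centralizing := by
    ext i
    have h3' : D.centralizing.centralizing.centralizing.prop (V i) ↔ D.centralizing.prop (V i) := by
      rw [h3]
    by_cases h : D.centralizing.prop (V i)
    · exact (if_pos (h3'.2 h)).trans (if_pos h).symm
    · exact (if_neg fun h' => h (h3'.1 h')).trans (if_neg h).symm
  rw [h4] at h2
  -- The S-matrix sends the dimension vectors of `D` and `D''` to multiples of the vector of the
  -- same centralizer, so the two are proportional with nonzero factors and have the same support.
  have h5 : globalDim V d D.centralizing.centralizing • dimVector V d D =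
      globalDim V d D • dimVector V d D.centralizing.centralizing := by
    refine Matrix.vecMul_injective_of_isUnit hS ?_
    simp only [Matrix.smul_vecMul, h1, h2, smul_smul, mul_comm]
  have h6 := congrFun h5 j
  have n1 := hV.globalDim_ne_zero hS D
  have n2 := hV.dim_ne_zero hS j
  refine ⟨fun h => ?_, hle D _⟩
  by_contra hD
  simp [dimVector, h, hD, n1, n2] at h6

end SphericalBasis

end RingMatrix

end

section

/-! ### The adjoint algebra, its action, and cointegrals as central class functions -/

section Action

variable {𝒟 : Type u} [Category.{v} 𝒟] [MonoidalCategory 𝒟]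
  {R : 𝒟 ⥤ Center 𝒟} (adj : Center.forget 𝒟 ⊣ R)

/-- The half-braiding of the adjoint algebra. -/
def adjBraid (R : 𝒟 ⥤ Center 𝒟) (X : 𝒟) : adjAlg R ⊗ X ⟶ X ⊗ adjAlg R :=
  (halfBraid (R.obj (𝟙_ 𝒟)) X).hom

/-- The counit of the adjunction at the unit object. -/
def adjCounit : adjAlg R ⟶ 𝟙_ 𝒟 := adj.counit.app (𝟙_ 𝒟)

/-- An object with a half-braiding, as an object of the center. -/
def centerMk {W : 𝒟} (b : HalfBraiding W) : Center 𝒟 := ⟨W, b⟩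

/-- The half-braiding of the adjoint algebra, bundled. -/
def adjHalfBraiding (R : 𝒟 ⥤ Center 𝒟) : HalfBraiding (adjAlg R) := (R.obj (𝟙_ 𝒟)).2

lemma adjHalfBraiding_hom (X : 𝒟) : ((adjHalfBraiding R).β X).hom = adjBraid R X := rfl

/-- The morphism into the adjoint algebra that is adjoint to a morphism from an object with
half-braiding to the unit. -/
def adjLift {W : 𝒟} (b : HalfBraiding W) (t : W ⟶ 𝟙_ 𝒟) : W ⟶ adjAlg R :=
  Center.Hom.f ((adj.homEquiv (centerMk b) (𝟙_ 𝒟)) t)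

lemma adjLift_comm {W : 𝒟} (b : HalfBraiding W) (t : W ⟶ 𝟙_ 𝒟) (X : 𝒟) :
    adjLift adj b t ▷ X ≫ adjBraid R X = (b.β X).hom ≫ X ◁ adjLift adj b t :=
  Center.Hom.comm ((adj.homEquiv (centerMk b) (𝟙_ 𝒟)) t) X

lemma adjLift_counit {W : 𝒟} (b : HalfBraiding W) (t : W ⟶ 𝟙_ 𝒟) :
    adjLift adj b t ≫ adjCounit adj = t := by
  have h := (adj.homEquiv (centerMk b) (𝟙_ 𝒟)).symm_apply_apply t
  exact (adj.homEquiv_counit (centerMk b) (𝟙_ 𝒟) _).symm.trans h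

lemma adjLift_unique {W : 𝒟} (b : HalfBraiding W) (t : W ⟶ 𝟙_ 𝒟) (g : W ⟶ adjAlg R)
    (hg : ∀ X, g ▷ X ≫ adjBraid R X = (b.β X).hom ≫ X ◁ g) (ht : g ≫ adjCounit adj = t) :
    g = adjLift adj b t := by
  let g' : centerMk b ⟶ R.obj (𝟙_ 𝒟) := { f := g, comm := hg }
  have h : g' = adj.homEquiv (centerMk b) (𝟙_ 𝒟) t := by
    exact (Equiv.symm_apply_eq (adj.homEquiv (centerMk b) (𝟙_ 𝒟))).1
      ((adj.homEquiv_counit (centerMk b) (𝟙_ 𝒟) g').trans ht)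
  exact congrArg Center.Hom.f h

lemma adjBraid_tensor (X Y : 𝒟) : adjBraid R (X ⊗ Y) =
    (α_ _ X Y).inv ≫ adjBraid R X ▷ Y ≫ (α_ X _ Y).hom ≫ X ◁ adjBraid R Y ≫ (α_ X Y _).inv :=
  (R.obj (𝟙_ 𝒟)).2.monoidal X Y

lemma adjBraid_naturality {X Y : 𝒟} (f : X ⟶ Y) :
    adjAlg R ◁ f ≫ adjBraid R Y = adjBraid R X ≫ f ▷ adjAlg R :=
  halfBraid_naturality _ f

lemma action_eq (X : 𝒟) : action adj X = adjBraid R X ≫ X ◁ adjCounit adj ≫ (ρ_ X).hom := rfl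

lemma action_tensor (X Y : 𝒟) : action adj (X ⊗ Y) = (α_ _ X Y).inv ≫
    adjBraid R X ▷ Y ≫ (α_ X _ Y).hom ≫ X ◁ action adj Y := by
  simp only [action_eq, adjBraid_tensor]
  monoidal

lemma adjLift_action {W : 𝒟} (b : HalfBraiding W) (t : W ⟶ 𝟙_ 𝒟) (X : 𝒟) :
    adjLift adj b t ▷ X ≫ action adj X = (b.β X).hom ≫ X ◁ t ≫ (ρ_ X).hom := by
  rw [action_eq, reassoc_of% (adjLift_comm adj b t X), ← MonoidalCategory.whiskerLeft_comp_assoc,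
    adjLift_counit]

/-- The trivial half-braiding of the unit object. -/
def unitHalfBraiding : HalfBraiding (𝟙_ 𝒟) := (𝟙_ (Center 𝒟)).2

lemma unitHalfBraiding_hom (X : 𝒟) :
    ((unitHalfBraiding (𝒟 := 𝒟)).β X).hom = (λ_ X).hom ≫ (ρ_ X).inv := rfl

lemma algUnit_eq : algUnit adj = adjLift adj unitHalfBraiding (𝟙 (𝟙_ 𝒟)) :=
  Category.id_comp (adjLift adj unitHalfBraiding (𝟙 (𝟙_ 𝒟)))

lemma algUnit_action (X : 𝒟) : algUnit adj ▷ X ≫ action adj X = (λ_ X).hom := by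
  rw [algUnit_eq, adjLift_action, unitHalfBraiding_hom]
  simp

lemma algUnit_counit : algUnit adj ≫ adjCounit adj = 𝟙 _ := by
  rw [algUnit_eq, adjLift_counit]

lemma algUnit_adjBraid (X : 𝒟) : algUnit adj ▷ X ≫ adjBraid R X =
    (λ_ X).hom ≫ (ρ_ X).inv ≫ X ◁ algUnit adj := by
  rw [algUnit_eq, adjLift_comm, unitHalfBraiding_hom, Category.assoc]

/-- The half-braiding of the square of the adjoint algebra. -/
def adjSqHalfBraiding (R : 𝒟 ⥤ Center 𝒟) : HalfBraiding (adjAlg R ⊗ adjAlg R) :=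
  (R.obj (𝟙_ 𝒟) ⊗ R.obj (𝟙_ 𝒟)).2

lemma adjSqHalfBraiding_hom (X : 𝒟) : ((adjSqHalfBraiding R).β X).hom =
    (α_ _ _ _).hom ≫ adjAlg R ◁ adjBraid R X ≫ (α_ _ _ _).inv ≫
      adjBraid R X ▷ adjAlg R ≫ (α_ _ _ _).hom := rfl

lemma algMul_eq : algMul adj = adjLift adj (adjSqHalfBraiding R)
    ((adjCounit adj ⊗ₘ adjCounit adj) ≫ (λ_ (𝟙_ 𝒟)).hom) := by
  have h : Functor.OplaxMonoidal.δ (Center.forget 𝒟) (R.obj (𝟙_ 𝒟)) (R.obj (𝟙_ 𝒟)) ≫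
      (adj.counit.app (𝟙_ 𝒟) ⊗ₘ adj.counit.app (𝟙_ 𝒟)) ≫ (λ_ (𝟙_ 𝒟)).hom =
      (adjCounit adj ⊗ₘ adjCounit adj) ≫ (λ_ (𝟙_ 𝒟)).hom :=
    Category.id_comp ((adjCounit adj ⊗ₘ adjCounit adj) ≫ (λ_ (𝟙_ 𝒟)).hom)
  rw [algMul, h]
  exact Category.id_comp (adjLift adj _ _)

/-- The counit is multiplicative by construction, and naturality of the half-braiding lets the inner
action be carried out before the outer crossing. -/
lemma algMul_action (X : 𝒟) : algMul adj ▷ X ≫ action adj X =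
    (α_ _ _ _).hom ≫ adjAlg R ◁ action adj X ≫ action adj X := by
  rw [algMul_eq, adjLift_action, adjSqHalfBraiding_hom]
  have h1 := adjBraid_naturality (R := R) (X ◁ adjCounit adj ≫ (ρ_ X).hom)
  calc
    _ = ((α_ _ _ _).hom ≫ adjAlg R ◁ adjBraid R X ≫ (α_ _ _ _).inv ≫
      adjBraid R X ▷ adjAlg R ≫ (α_ _ _ _).hom) ≫ X ◁ (adjCounit adj ⊗ₘ adjCounit adj) ≫
        X ◁ (λ_ (𝟙_ 𝒟)).hom ≫ (ρ_ X).hom := by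
      simp only [MonoidalCategory.whiskerLeft_comp, Category.assoc]
    _ = (α_ _ _ _).hom ≫ adjAlg R ◁ adjBraid R X ≫ (α_ _ _ _).inv ≫
      (adjBraid R X ▷ adjAlg R ≫ (X ⊗ adjAlg R) ◁ adjCounit adj) ≫ (ρ_ _).hom ≫
        X ◁ adjCounit adj ≫ (ρ_ X).hom := by
      rw [tensorHom_def']; monoidal
    _ = (α_ _ _ _).hom ≫ adjAlg R ◁ adjBraid R X ≫
      (adjAlg R ◁ (X ◁ adjCounit adj ≫ (ρ_ X).hom) ≫ adjBraid R X) ≫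
        X ◁ adjCounit adj ≫ (ρ_ X).hom := by
      rw [← whisker_exchange]; monoidal
    _ = _ := by
      simp only [action_eq]; monoidal

/-- A class function that commutes with the half-braiding of the adjoint algebra. -/
def IsCentralFunction (lam : CF R) : Prop :=
  ∀ X : 𝒟, adjBraid R X ≫ X ◁ lam ≫ (ρ_ X).hom = lam ▷ X ≫ (λ_ X).hom

/-- The lift is the only endomorphism in the center with counit `lam`. The composite `lam ≫ algUnit
adj` has this counit, so equality means exactly that it respects the half-braidings. -/
lemma isCentralFunction_iff (lam : CF R) : IsCentralFunction lam ↔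
    adjLift adj (adjHalfBraiding R) lam = lam ≫ algUnit adj := by
  constructor
  · intro hc
    refine (adjLift_unique adj _ _ _ (fun X => ?_) ?_).symm
    · rw [adjHalfBraiding_hom, comp_whiskerRight, Category.assoc, algUnit_adjBraid, ← reassoc_of% hc X]
      simp
    · rw [Category.assoc, algUnit_counit, Category.comp_id]
  · intro hc X
    have h1 : adjLift adj (adjHalfBraiding R) lam ▷ X ≫ adjBraid R X =
        adjBraid R X ≫ X ◁ adjLift adj (adjHalfBraiding R) lam :=
      adjLift_comm adj (adjHalfBraiding R) lam X
    rw [hc, comp_whiskerRight, Category.assoc, algUnit_adjBraid] at h1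
    have h2 := h1 =≫ X ◁ adjCounit adj
    simp only [Category.assoc, ← MonoidalCategory.whiskerLeft_comp, algUnit_counit,
      Category.comp_id] at h2
    simp only [MonoidalCategory.whiskerLeft_id, Category.comp_id] at h2
    rw [← cancel_mono (ρ_ X).inv]
    simpa using h2.symm

/-- The composite of `δ` with `Z(lam)` is the adjoint transpose of `lam`, so the cointegral equation
is the condition of `isCentralFunction_iff`. -/
lemma isIdempotentCointegral_iff (lam : CF R) : IsIdempotentCointegral adj lam ↔
    IsCentralFunction lam ∧ algUnit adj ≫ lam = 𝟙 _ := by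
  have hδ : adj.toComonad.δ.app (𝟙_ 𝒟) ≫ (Center.forget 𝒟).map (R.map lam) =
      adjLift adj (adjHalfBraiding R) lam := by
    change _ = (Center.forget 𝒟).map (adj.homEquiv (R.obj (𝟙_ 𝒟)) (𝟙_ 𝒟) lam)
    rw [Adjunction.homEquiv_unit, Functor.map_comp]
    rfl
  rw [isCentralFunction_iff adj, ← hδ]
  exact ⟨fun ⟨h1, h2⟩ => ⟨h1, h2⟩, fun ⟨h1, h2⟩ => ⟨h1, h2⟩⟩

end Action

end

section

/-! ### Fusion subcategories as categories in their own right -/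

section FullSubcategory

variable {k : Type w} [Field k] {C : Type u} [Category.{v} C] [Abelian C] [Linear k C]
  [MonoidalCategory C] [MonoidalPreadditive C] [MonoidalLinear k C] [RigidCategory C]
  (D : FusionSubcategory C)

instance : D.prop.IsMonoidal := D.isMonoidal

lemma fullSubcategory_sum_hom {J : Type*} (s : Finset J) {X Y : D.prop.FullSubcategory}
    (f : J → (X ⟶ Y)) : (∑ j ∈ s, f j).hom = ∑ j ∈ s, (f j).hom :=
  D.prop.ι.map_sum f s

variable {ι : Type u'} [Fintype ι] {V : ι → C}

open scoped Classical in
/-- The simple objects of a fusion subcategory. -/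
lemma SimpleBasis.fullSubcategory (hV : SimpleBasis k V) :
    SimpleBasis k fun i : {i // D.prop (V i)} => (⟨V i, i.2⟩ : D.prop.FullSubcategory) where
  hom_eq_zero i j hij f := by
    ext
    exact hV.hom_eq_zero i.1 j.1 (fun h => hij (Subtype.ext h)) f.hom
  end_scalar i f := by
    obtain ⟨c, hc⟩ := hV.end_scalar i.1 f.hom
    exact ⟨c, by ext; exact hc⟩
  id_ne_zero i h := hV.id_ne_zero i.1 (congrArg (fun t => t.hom) h)
  decomp X := by
    obtain ⟨n, a, b, hab⟩ := hV.decomp X.obj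
    refine ⟨fun l => n l.1, fun l α => ObjectProperty.homMk (a l.1 α),
      fun l α => ObjectProperty.homMk (b l.1 α), ?_⟩
    ext
    simp only [fullSubcategory_sum_hom, ObjectProperty.FullSubcategory.comp_hom,
      ObjectProperty.FullSubcategory.id_hom]
    refine (Finset.sum_subtype (Finset.univ.filter fun i => D.prop (V i)) (by simp)
      (fun l => ∑ α, a l α ≫ b l α)).symm.trans ?_
    rw [Finset.sum_filter, ← hab]
    refine Finset.sum_congr rfl fun l _ => ?_
    split_ifs with hl
    · rfl
    · refine (Finset.sum_eq_zero fun α _ => ?_).symm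
      have : a l α = 0 := by
        by_contra h
        obtain ⟨r⟩ := hV.retract_of_ne_zero h
        exact hl (D.retract.of_retract r X.property)
      rw [this, zero_comp]

/-- Fusion subcategories contain the finite direct sums of their objects. -/
lemma FusionSubcategory.prop_of_sum {J : Type*} [Fintype J] (f : J → C) (hf : ∀ j, D.prop (f j))
    {A : C} (s : ∀ j, f j ⟶ A) (r : ∀ j, A ⟶ f j) (hrs : ∑ j, r j ≫ s j = 𝟙 A) : D.prop A := by
  classical
  -- Partial sums of the identity factor through objects of `D`; the full sum exhibits `A` as a
  -- retract of such an object.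
  have key : ∀ S : Finset J, ∃ (B : C) (s' : A ⟶ B) (r' : B ⟶ A), D.prop B ∧
      s' ≫ r' = ∑ j ∈ S, r j ≫ s j := by
    intro S
    induction S using Finset.induction_on with
    | empty => exact ⟨𝟙_ C, 0, 0, D.isMonoidal.prop_unit, by simp⟩
    | insert a S ha ih =>
      obtain ⟨B, s', r', hB, h⟩ := ih
      refine ⟨f a ⊞ B, biprod.lift (r a) s', biprod.desc (s a) r', D.biprod _ _ (hf a) hB, ?_⟩
      rw [biprod.lift_desc, h, Finset.sum_insert ha]
  obtain ⟨B, s', r', hB, h⟩ := key Finset.univ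
  exact D.retract.of_retract ⟨s', r', h.trans hrs⟩ hB

lemma FusionSubcategory.hasSums {J : Type u'} [Fintype J] :
    HasSums J D.prop.FullSubcategory := by
  intro f
  obtain ⟨A, s, r, h1, h2, h3⟩ := hasSums_of_abelian J fun j => (f j).obj
  refine ⟨⟨A, D.prop_of_sum (fun j => (f j).obj) (fun j => (f j).property) s r h3⟩,
    fun j => ObjectProperty.homMk (s j), fun j => ObjectProperty.homMk (r j), fun j => ?_,
    fun i j hij => ?_, ?_⟩
  · ext; exact h1 j
  · ext; exact h2 i j hij
  · ext
    rw [fullSubcategory_sum_hom]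
    exact h3

/-- Duals in a fusion subcategory. -/
@[reducible] def FusionSubcategory.rightRigid : RightRigidCategory D.prop.FullSubcategory where
  rightDual X :=
    { rightDual := ⟨X.objᘁ, D.dual _ X.property⟩
      exact :=
        { coevaluation' := ObjectProperty.homMk (η_ X.obj X.objᘁ)
          evaluation' := ObjectProperty.homMk (ε_ X.obj X.objᘁ)
          coevaluation_evaluation' := by
            ext; exact ExactPairing.coevaluation_evaluation X.obj X.objᘁ
          evaluation_coevaluation' := by
            ext; exact ExactPairing.evaluation_coevaluation X.obj X.objᘁ } }

/-- Duals in a fusion subcategory of a braided category. -/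
@[reducible] def FusionSubcategory.rigid [BraidedCategory C] :
    RigidCategory D.prop.FullSubcategory :=
  haveI := D.rightRigid
  BraidedCategory.rigidCategoryOfRightRigidCategory

end FullSubcategory

end

section

/-! ### The Drinfeld map as a lift of the evaluation -/

section Drinfeld

variable {C : Type u} [Category.{v} C] [MonoidalCategory C] [BraidedCategory C]
  [RightRigidCategory C]

/-- The half-braiding of `Y* ⊗ Y` given by the braiding of `Y*` and the inverse braiding of `Y`. -/
def hopfHalfBraiding (Y : C) : HalfBraiding (Yᘁ ⊗ Y) := (hopfObj Y).2

lemma hopfHalfBraiding_hom (Y X : C) : ((hopfHalfBraiding Y).β X).hom =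
    (α_ (Yᘁ : C) Y X).hom ≫ (Yᘁ : C) ◁ (β_ X Y).inv ≫ (α_ (Yᘁ : C) X Y).inv ≫
      (β_ (Yᘁ : C) X).hom ▷ Y ≫ (α_ X (Yᘁ : C) Y).hom :=
  rfl

variable {R : C ⥤ Center C} (adj : Center.forget C ⊣ R)

lemma drinfeldQ_eq (Y : C) : drinfeldQ adj Y = adjLift adj (hopfHalfBraiding Y) (ε_ Y Yᘁ) := rfl

/-- Naturality of the braiding along the evaluation trades the crossing of `Y*` for the inverse
crossing of `Y`; with the inverse crossing already present this gives the inverse monodromy. -/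
lemma hopfHalfBraiding_evaluation (Y X : C) :
    ((hopfHalfBraiding Y).β X).hom ≫ X ◁ ε_ Y Yᘁ ≫ (ρ_ X).hom =
      (α_ Yᘁ Y X).hom ≫ Yᘁ ◁ invMono Y X ≫ (α_ Yᘁ Y X).inv ≫ ε_ Y Yᘁ ▷ X ≫ (λ_ X).hom := by
  have h := BraidedCategory.braiding_naturality_left (ε_ Y Yᘁ) X
  rw [BraidedCategory.braiding_tensor_left_hom, braiding_tensorUnit_left] at h
  have h1 : ε_ Y Yᘁ ▷ X ≫ (λ_ X).hom = (α_ Yᘁ Y X).hom ≫ Yᘁ ◁ (β_ Y X).hom ≫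
      (α_ Yᘁ X Y).inv ≫ (β_ Yᘁ X).hom ▷ Y ≫ (α_ X Yᘁ Y).hom ≫ X ◁ ε_ Y Yᘁ ≫ (ρ_ X).hom := by
    rw [← cancel_mono (ρ_ X).inv]
    simpa using h
  rw [h1, hopfHalfBraiding_hom, invMono]
  simp only [Category.assoc, Iso.inv_hom_id_assoc, ← MonoidalCategory.whiskerLeft_comp_assoc,
    Iso.inv_hom_id, Category.comp_id]

lemma drinfeldQ_action (Y X : C) : drinfeldQ adj Y ▷ X ≫ action adj X =
    (α_ Yᘁ Y X).hom ≫ Yᘁ ◁ invMono Y X ≫ (α_ Yᘁ Y X).inv ≫ ε_ Y Yᘁ ▷ X ≫ (λ_ X).hom := by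
  rw [drinfeldQ_eq, adjLift_action, hopfHalfBraiding_evaluation]

lemma invMono_eq_id_of_evaluation {Y X : C} (h : Yᘁ ◁ invMono Y X ≫ (α_ Yᘁ Y X).inv ≫
    ε_ Y Yᘁ ▷ X ≫ (λ_ X).hom = (α_ Yᘁ Y X).inv ≫ ε_ Y Yᘁ ▷ X ≫ (λ_ X).hom) :
    invMono Y X = 𝟙 _ := by
  apply (tensorLeftHomEquiv (Y ⊗ X) Y Yᘁ X).symm.injective
  simp only [tensorLeftHomEquiv, Equiv.coe_fn_symm_mk]
  simpa using h

lemma tensorLeft_evaluation (Y : C) : (λ_ Y).inv ≫ η_ Y Yᘁ ▷ Y ≫ (α_ Y Yᘁ Y).hom ≫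
    Y ◁ ε_ Y Yᘁ ≫ (ρ_ Y).hom = 𝟙 Y := by
  rw [← Category.assoc (α_ Y Yᘁ Y).hom, ← Category.assoc (η_ Y Yᘁ ▷ Y),
    ExactPairing.evaluation_coevaluation]
  simp

end Drinfeld

/-! ### Linearity of lifts and endomorphisms of the adjoint algebra -/

section Linear

variable {k : Type w} [Field k] {𝒟 : Type u} [Category.{v} 𝒟] [Preadditive 𝒟] [Linear k 𝒟]
  [MonoidalCategory 𝒟] [MonoidalPreadditive 𝒟] [MonoidalLinear k 𝒟]
  {R : 𝒟 ⥤ Center 𝒟} (adj : Center.forget 𝒟 ⊣ R)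

lemma adjLift_add {W : 𝒟} (b : HalfBraiding W) (s t : W ⟶ 𝟙_ 𝒟) :
    adjLift adj b (s + t) = adjLift adj b s + adjLift adj b t := by
  refine (adjLift_unique adj b _ _ (fun X => ?_) ?_).symm
  · simp [adjLift_comm]
  · simp [adjLift_counit]

lemma adjLift_smul {W : 𝒟} (b : HalfBraiding W) (c : k) (t : W ⟶ 𝟙_ 𝒟) :
    adjLift adj b (c • t) = c • adjLift adj b t := by
  refine (adjLift_unique adj b _ _ (fun X => ?_) ?_).symm
  · simp [adjLift_comm]
  · simp [adjLift_counit]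

/-- The endomorphism of the adjoint algebra that corresponds to a class function. -/
def adjEnd (f : CF R) : adjAlg R ⟶ adjAlg R := adjLift adj (adjHalfBraiding R) f

lemma adjLift_adjEnd {W : 𝒟} (b : HalfBraiding W) (t : W ⟶ 𝟙_ 𝒟) (f : CF R) :
    adjLift adj b t ≫ adjEnd adj f = adjLift adj b (adjLift adj b t ≫ f) := by
  refine adjLift_unique adj b _ _ (fun X => ?_) ?_
  · rw [comp_whiskerRight, Category.assoc, adjEnd, adjLift_comm, adjHalfBraiding_hom,
      reassoc_of% (adjLift_comm adj b t X), MonoidalCategory.whiskerLeft_comp]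
  · rw [Category.assoc, adjEnd, adjLift_counit]

end Linear

/-! ### Characters and the coefficients of the Drinfeld map -/

section Characters

variable {k : Type w} [Field k] {C : Type u} [Category.{v} C] [Abelian C] [Linear k C]
  [MonoidalCategory C] [MonoidalPreadditive C] [MonoidalLinear k C] [RigidCategory C]
  [BraidedCategory C] {p : PivotalStructure C} {ι : Type u'} [Fintype ι] {V : ι → C} {d : ι → k}
  (hV : SphericalBasis k p V d) {R : C ⥤ Center C} (adj : Center.forget C ⊣ R)

/-- The scalars by which the image of a class function under the Drinfeld map acts on the simple
objects. -/
def SphericalBasis.drinfeldCoeff (f : CF R) (j : ι) : k :=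
  hV.coeff j ((drinfeldNat adj f).app (V j))

/-- The character of an object. -/
def character (p : PivotalStructure C) (X : C) : CF R := p.ptr X (action adj X ≫ (λ_ X).inv)

namespace SphericalBasis

/-- By duality `Hom(V_j* ⊗ V_j, 1) = End(V_j)` is spanned by the evaluation. This is the working
form of the Drinfeld map. -/
lemma drinfeldQ_comp (f : CF R) (j : ι) :
    drinfeldQ adj (V j) ≫ f = hV.drinfeldCoeff adj f j • ε_ (V j) (V j)ᘁ := by
  apply (tensorLeftHomEquiv (V j) (V j) (V j)ᘁ (𝟙_ C)).injective
  simp only [tensorLeftHomEquiv, Equiv.coe_fn_mk]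
  rw [← cancel_mono (ρ_ (V j)).hom]
  have h := hV.coeff_smul j ((drinfeldNat adj f).app (V j))
  simp only [Category.assoc]
  refine Eq.trans ?_ (h.trans ?_)
  · rfl
  · rw [drinfeldCoeff, MonoidalLinear.whiskerLeft_smul]
    simp only [Linear.comp_smul, Linear.smul_comp]
    congr 1
    exact (tensorLeft_evaluation (V j)).symm

lemma drinfeldCoeff_eq {f : CF R} {j : ι} {c : k}
    (h : drinfeldQ adj (V j) ≫ f = c • ε_ (V j) (V j)ᘁ) : hV.drinfeldCoeff adj f j = c := by
  refine hV.coeff_eq j ?_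
  simp only [drinfeldNat]
  rw [h, MonoidalLinear.whiskerLeft_smul]
  simp only [Linear.comp_smul, Linear.smul_comp]
  congr 1
  exact tensorLeft_evaluation (V j)

/-- The adjoint transpose of `drinfeldQ_comp`: endomorphisms of `R(1)` act on `drinfeldQ` by
scalars. Products of endomorphisms thereby become products of coefficients. -/
lemma drinfeldQ_adjEnd (f : CF R) (j : ι) :
    drinfeldQ adj (V j) ≫ adjEnd adj f = hV.drinfeldCoeff adj f j • drinfeldQ adj (V j) := by
  have h := hV.drinfeldQ_comp adj f j
  rw [drinfeldQ_eq] at h ⊢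
  rw [adjLift_adjEnd, h, adjLift_smul]

lemma drinfeldCoeff_add (f g : CF R) (j : ι) : hV.drinfeldCoeff adj (f + g) j =
    hV.drinfeldCoeff adj f j + hV.drinfeldCoeff adj g j := by
  refine hV.drinfeldCoeff_eq adj ?_
  rw [Preadditive.comp_add, hV.drinfeldQ_comp, hV.drinfeldQ_comp, add_smul]

lemma drinfeldCoeff_smul (c : k) (f : CF R) (j : ι) : hV.drinfeldCoeff adj (c • f) j =
    c * hV.drinfeldCoeff adj f j := by
  refine hV.drinfeldCoeff_eq adj ?_
  rw [Linear.comp_smul, hV.drinfeldQ_comp, smul_smul]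

lemma drinfeldCoeff_sum {J : Type*} (s : Finset J) (f : J → CF R) (j : ι) :
    hV.drinfeldCoeff adj (∑ i ∈ s, f i) j = ∑ i ∈ s, hV.drinfeldCoeff adj (f i) j :=
  map_sum (AddMonoidHom.mk' (fun f => hV.drinfeldCoeff adj f j)
    fun f g => hV.drinfeldCoeff_add adj f g j) f s

/-- The Drinfeld map acts by the inverse monodromy followed by evaluation, so closing up `V i`
leaves a loop `V i` around the strand `V j`. -/
lemma drinfeldCoeff_character (i j : ι) :
    hV.drinfeldCoeff adj (character adj p (V i)) j = hV.ring i j := by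
  refine hV.drinfeldCoeff_eq adj ?_
  have h : drinfeldQ adj (V j) ▷ V i ≫ action adj (V i) ≫ (λ_ (V i)).inv =
      ((α_ (V j)ᘁ (V j) (V i)).hom ≫ (V j)ᘁ ◁ invMono (V j) (V i) ≫
        (α_ (V j)ᘁ (V j) (V i)).inv) ≫ ε_ (V j) (V j)ᘁ ▷ V i := by
    rw [reassoc_of% (drinfeldQ_action adj (V j) (V i))]
    simp
  rw [character, ← p.ptr_comp_left, h, p.ptr_comp_right, p.ptr_whiskerLeft, hV.ptr_invMono]
  simp

include hV in
/-- The adjoint algebra is the direct sum of the objects `V i ⊗ (V i)ᘁ`. -/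
lemma exists_adjAlg_decomposition : ∃ (r : ∀ i, adjAlg R ⟶ V i ⊗ (V i)ᘁ)
    (s : ∀ i, V i ⊗ (V i)ᘁ ⟶ adjAlg R), ∑ i, r i ≫ s i = 𝟙 (adjAlg R) ∧
      (∀ i, s i ≫ r i = 𝟙 _) ∧ (∀ i j, i ≠ j → s i ≫ r j = 0) ∧
      ∀ i, r i ≫ p.evr (V i) = character adj p (V i) := by
  classical
  -- The inclusion of the `i`-th summand acts on `V i` through the evaluation and on the other
  -- simple objects by zero; the projection `r i` is the transpose of the action.
  choose s hs using fun i : ι => hV.exists_action_eq_on_simples adj hV.sums (V i ⊗ (V i)ᘁ)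
    (fun j => if h : i = j then (α_ _ _ _).hom ≫ V i ◁ (V i)ᘁ ◁ eqToHom (by rw [h]) ≫
      V i ◁ ε_ (V i) (V i)ᘁ ≫ (ρ_ (V i)).hom ≫ eqToHom (by rw [h]) else 0)
  let r : ∀ i, adjAlg R ⟶ V i ⊗ (V i)ᘁ := fun i => tensorRightHomEquiv _ (V i) (V i)ᘁ (V i)
    (action adj (V i))
  have hr : ∀ i, r i ▷ V i ≫ (α_ _ _ _).hom ≫ V i ◁ ε_ (V i) (V i)ᘁ ≫ (ρ_ (V i)).hom =
      action adj (V i) := fun i =>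
    (tensorRightHomEquiv _ (V i) (V i)ᘁ (V i)).symm_apply_apply (action adj (V i))
  have hsr : ∀ i j, s i ≫ r j = tensorRightHomEquiv _ (V j) (V j)ᘁ (V j)
      (s i ▷ V j ≫ action adj (V j)) := by
    intro i j
    rw [← Equiv.symm_apply_eq]
    change (s i ≫ r j) ▷ V j ≫ (α_ _ _ _).hom ≫ V j ◁ ε_ (V j) (V j)ᘁ ≫ (ρ_ (V j)).hom = _
    rw [comp_whiskerRight, Category.assoc, hr]
  refine ⟨r, s, ?_, fun i => ?_, fun i j hij => ?_, fun i => ?_⟩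
  · refine hV.adjAlg_ext adj hV.sums fun j => ?_
    rw [sum_whiskerRight, Preadditive.sum_comp, Finset.sum_eq_single j]
    · rw [comp_whiskerRight, Category.assoc, hs]
      simp only [dif_pos]
      simpa using hr j
    · intro i _ hij
      rw [comp_whiskerRight, Category.assoc, hs, dif_neg hij, comp_zero]
    · simp
  · rw [hsr, ← Equiv.eq_symm_apply, hs]
    change _ = 𝟙 (V i ⊗ (V i)ᘁ) ▷ V i ≫ (α_ _ _ _).hom ≫ V i ◁ ε_ (V i) (V i)ᘁ ≫ (ρ_ (V i)).hom
    simp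
  · rw [hsr, hs, dif_neg hij, ← Equiv.eq_symm_apply]
    change _ = (0 : V i ⊗ (V i)ᘁ ⟶ V j ⊗ (V j)ᘁ) ▷ V j ≫ (α_ _ _ _).hom ≫
      V j ◁ ε_ (V j) (V j)ᘁ ≫ (ρ_ (V j)).hom
    simp
  · simp only [r, tensorRightHomEquiv, Equiv.coe_fn_mk, character, PivotalStructure.ptr]
    monoidal

include hV in
/-- The characters of the simple objects span the space of class functions. -/
lemma exists_eq_sum_character (f : CF R) :
    ∃ t : ι → k, f = ∑ i, t i • character adj p (V i) := by
  obtain ⟨r, s, hrs, -, -, hr⟩ := hV.exists_adjAlg_decomposition adj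
  -- With the pivotal pairing, functionals on `V i ⊗ V i*` are transposes of endomorphisms of `V i`,
  -- hence multiples of the pivotal evaluation.
  have h2 : ∀ i (g : V i ⊗ (V i)ᘁ ⟶ 𝟙_ C), ∃ c : k, g = c • p.evr (V i) := by
    intro i g
    let E := @tensorRightHomEquiv C _ _ (V i) (V i)ᘁ (V i) (𝟙_ C) (p.dualPairing (V i))
    obtain ⟨c, hc⟩ := hV.end_scalar i (E g ≫ (λ_ _).hom)
    have h3 : E g = c • (λ_ (V i)).inv := by
      rw [← cancel_mono (λ_ (V i)).hom, hc]; simp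
    refine ⟨c, ?_⟩
    rw [← E.symm_apply_apply g, h3]
    change (c • (λ_ (V i)).inv) ▷ (V i)ᘁ ≫ (α_ _ _ _).hom ≫ 𝟙_ C ◁ p.evr (V i) ≫ (ρ_ (𝟙_ C)).hom = _
    rw [MonoidalLinear.smul_whiskerRight, Linear.smul_comp]
    congr 1
    monoidal
  choose t ht using fun i => h2 i (s i ≫ f)
  refine ⟨t, ?_⟩
  rw [← Category.id_comp f, ← hrs, Preadditive.sum_comp]
  refine Finset.sum_congr rfl fun i _ => ?_
  rw [Category.assoc, ht, Linear.comp_smul, hr]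

lemma drinfeldCoeff_sum_character (t : ι → k) (j : ι) :
    hV.drinfeldCoeff adj (∑ i, t i • character adj p (V i)) j = ∑ i, t i * hV.ring i j := by
  simp only [drinfeldCoeff_sum, drinfeldCoeff_smul, drinfeldCoeff_character]

variable [DecidableEq ι] (hS : IsUnit (p.sMatrix k V))

include hS

/-- Characters span, and their coefficient vectors are the rows of the S-matrix with columns
rescaled, hence independent. -/
lemma drinfeldCoeff_injective : Function.Injective (hV.drinfeldCoeff adj) := by
  intro f g h
  obtain ⟨s, rfl⟩ := hV.exists_eq_sum_character adj f
  obtain ⟨t, rfl⟩ := hV.exists_eq_sum_character adj g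
  have : s = t := hV.ring_injective hS (funext fun j => by
    have := congrFun h j
    rwa [hV.drinfeldCoeff_sum_character, hV.drinfeldCoeff_sum_character] at this)
  rw [this]

lemma ring_surjective (y : ι → k) : ∃ t : ι → k, ∀ j, ∑ i, t i * hV.ring i j = y j := by
  let M : (ι → k) →ₗ[k] (ι → k) := (Matrix.of fun i j => hV.ring i j).vecMulLinear
  have hM : Function.Injective M := hV.ring_injective hS
  obtain ⟨t, ht⟩ := LinearMap.injective_iff_surjective.1 hM y
  exact ⟨t, congrFun ht⟩

lemma exists_drinfeldCoeff_eq (y : ι → k) : ∃ f : CF R, ∀ j, hV.drinfeldCoeff adj f j = y j := by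
  obtain ⟨t, ht⟩ := hV.ring_surjective hS y
  exact ⟨∑ i, t i • character adj p (V i), fun j => by rw [hV.drinfeldCoeff_sum_character, ht]⟩

end SphericalBasis

end Characters

end

section

/-! ### The antipodal operation on simple objects -/

section DualNat

variable {k : Type w} [Field k] {𝒟 : Type u} [Category.{v} 𝒟] [Preadditive 𝒟] [Linear k 𝒟]
  [MonoidalCategory 𝒟] [MonoidalPreadditive 𝒟] [MonoidalLinear k 𝒟] [LeftRigidCategory 𝒟]

lemma dualOfLeft_injective {X Y : 𝒟} :
    Function.Injective (dualOfLeft : ((ᘁY : 𝒟) ⟶ (ᘁX : 𝒟)) → (X ⟶ Y)) := by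
  intro f g h
  have key : ∀ f : (ᘁY : 𝒟) ⟶ (ᘁX : 𝒟), η_ (ᘁX : 𝒟) X ≫ (ᘁX : 𝒟) ◁ dualOfLeft f =
      η_ (ᘁY : 𝒟) Y ≫ f ▷ Y := fun f =>
    @coevaluation_comp_rightAdjointMate 𝒟 _ _ (ᘁY) (ᘁX) hasRightDualLeftDual
      hasRightDualLeftDual f
  have h1 := (key f).symm.trans ((congrArg (fun t => η_ (ᘁX : 𝒟) X ≫ (ᘁX : 𝒟) ◁ t) h).trans (key g))
  have h2 := congrArg (tensorRightHomEquiv _ (ᘁY : 𝒟) Y _).symm h1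
  rwa [tensorRightHomEquiv_symm_coevaluation_comp_whiskerRight,
    tensorRightHomEquiv_symm_coevaluation_comp_whiskerRight, cancel_epi] at h2

lemma dualOfLeft_smul_id (c : k) (X : 𝒟) : dualOfLeft (c • 𝟙 (ᘁX : 𝒟)) = c • 𝟙 X := by
  have h : leftAdjointMate (c • 𝟙 X) = c • 𝟙 (ᘁX : 𝒟) := by
    rw [← leftAdjointMate_id]
    simp [leftAdjointMate]
  rw [← h, dualOfLeft_leftAdjointMate]

lemma dualOfLeft_zero (X Y : 𝒟) : dualOfLeft (0 : (ᘁY : 𝒟) ⟶ (ᘁX : 𝒟)) = 0 := by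
  have h : leftAdjointMate (0 : X ⟶ Y) = 0 := by
    simp [leftAdjointMate]
  rw [← h, dualOfLeft_leftAdjointMate]

variable {ι : Type u'} [Fintype ι] {V : ι → 𝒟}

/-- The operation `ξ ↦ ξ^!` permutes the components at the simple objects. -/
lemma SimpleBasis.exists_dualNat_coeff (hV : SimpleBasis k V) : ∃ τ : ι ≃ ι, ∀ (ξ : 𝟭 𝒟 ⟶ 𝟭 𝒟) j,
    hV.coeff j ((dualNat ξ).app (V j)) = hV.coeff (τ j) (ξ.app (V (τ j))) := by
  have h1 : ∀ j, 𝟙 (ᘁ(V j) : 𝒟) ≠ 0 := by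
    intro j h
    apply hV.id_ne_zero j
    have h2 := dualOfLeft_smul_id (1 : k) (V j)
    rw [h, smul_zero, dualOfLeft_zero, one_smul] at h2
    exact h2.symm
  -- Dualization is injective on morphisms, so the left dual of `V j` has only scalar endomorphisms;
  -- a nonzero retract of it is then all of it.
  have h2 : ∀ j, ∃ l, Nonempty ((ᘁ(V j) : 𝒟) ≅ V l) := by
    intro j
    obtain ⟨l, ⟨r⟩⟩ := hV.exists_retract (h1 j)
    obtain ⟨c, hc⟩ := hV.end_scalar j (dualOfLeft (r.r ≫ r.i))
    have h3 : r.r ≫ r.i = c • 𝟙 (ᘁ(V j) : 𝒟) :=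
      dualOfLeft_injective (hc.trans (dualOfLeft_smul_id c (V j)).symm)
    have h4 : c • 𝟙 (V l) = 𝟙 (V l) := by
      have : r.i ≫ (r.r ≫ r.i) ≫ r.r = 𝟙 _ := by simp
      rw [h3] at this
      simpa using this
    have h5 : c = 1 := hV.smul_id_injective l (h4.trans (one_smul _ _).symm)
    exact ⟨l, ⟨⟨r.r, r.i, by rw [h3, h5, one_smul], r.retract⟩⟩⟩
  choose τ hτ using h2
  have hinj : Function.Injective τ := by
    intro i j hij
    by_contra hne
    let e : (ᘁ(V j) : 𝒟) ≅ (ᘁ(V i) : 𝒟) :=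
      (hτ j).some ≪≫ eqToIso (by rw [hij]) ≪≫ (hτ i).some.symm
    have he : e.hom = 0 := dualOfLeft_injective
      ((hV.hom_eq_zero i j hne _).trans (dualOfLeft_zero _ _).symm)
    apply h1 j
    rw [← e.hom_inv_id, he, zero_comp]
  refine ⟨Equiv.ofBijective τ (Finite.injective_iff_bijective.1 hinj), fun ξ j => ?_⟩
  refine hV.coeff_eq j ?_
  have hξ := hV.coeff_smul (τ j) (ξ.app (V (τ j)))
  have hn := ξ.naturality (hτ j).some.hom
  have h3 : ξ.app (ᘁ(V j) : 𝒟) = hV.coeff (τ j) (ξ.app (V (τ j))) • 𝟙 (ᘁ(V j) : 𝒟) := by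
    rw [← cancel_mono (hτ j).some.hom]
    refine hn.symm.trans ?_
    conv_lhs => rw [hξ]
    simp
  change dualOfLeft (ξ.app (ᘁ(V j) : 𝒟)) = _
  rw [h3, dualOfLeft_smul_id]
  rfl

end DualNat

/-! ### Centrality of the regular character -/

section Cointegral

variable {k : Type w} [Field k] {C : Type u} [Category.{v} C] [Abelian C] [Linear k C]
  [MonoidalCategory C] [MonoidalPreadditive C] [MonoidalLinear k C] [RigidCategory C]
  {p : PivotalStructure C} {ι : Type u'} [Fintype ι] {V : ι → C} {d : ι → k}

/-- The normalized regular character is central. -/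
lemma SphericalBasis.regTrace_action (hV : SphericalBasis k p V d) (D : FusionSubcategory C)
    (hD : globalDim V d D ≠ 0) {A : C} (act : ∀ Y, D.prop Y → (A ⊗ Y ⟶ Y))
    (hnat : ∀ {Y Y' : C} (hY : D.prop Y) (hY' : D.prop Y') (f : Y ⟶ Y'),
      A ◁ f ≫ act Y' hY' = act Y hY ≫ f)
    (b : ∀ U, D.prop U → (A ⊗ U ⟶ U ⊗ A))
    (hb : ∀ U W (hU : D.prop U) (hW : D.prop W),
      act (U ⊗ W) (D.isMonoidal.prop_tensor U W hU hW) =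
        (α_ A U W).inv ≫ b U hU ▷ W ≫ (α_ U A W).hom ≫ U ◁ act W hW)
    (e : 𝟙_ C ⟶ A) (he : ∀ Y (hY : D.prop Y), e ▷ Y ≫ act Y hY = (λ_ Y).hom)
    {lam : A ⟶ 𝟙_ C} (hlam : lam = (globalDim V d D)⁻¹ •
      regTrace p V d D fun Y hY => act Y hY ≫ (λ_ Y).inv) :
    (∀ U hU, b U hU ≫ U ◁ lam ≫ (ρ_ U).hom = lam ▷ U ≫ (λ_ U).hom) ∧ e ≫ lam = 𝟙 _ := by
  subst hlam
  constructor
  · intro U hU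
    -- The handle slide is applied with the unit object as target, whose crossing with `U` is the
    -- coherence isomorphism.
    have h := hV.regTrace_central (D := D) (fun Y hY => act Y hY ≫ (λ_ Y).inv)
      (fun {Y Y'} hY hY' f => by
        rw [reassoc_of% (hnat hY hY' f), Category.assoc, leftUnitor_inv_naturality]) hU
      (b U hU) ((ρ_ U).hom ≫ (λ_ U).inv) (fun W hW => by
        rw [hb U W hU hW]; monoidal)
    rw [MonoidalLinear.whiskerLeft_smul, MonoidalLinear.smul_whiskerRight, Linear.smul_comp,
      Linear.smul_comp, Linear.comp_smul, ← h]
    simp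
  · have h := regTrace_comp (p := p) (V := V) (d := d) D e (𝟙 _)
      (fun Y hY => act Y hY ≫ (λ_ Y).inv)
    have h2 := hV.regTrace_whiskerRight D (𝟙 (𝟙_ C))
    rw [Category.comp_id] at h
    rw [Linear.comp_smul, ← h]
    have h3 : (fun Y (hY : D.prop Y) => e ▷ Y ≫ (act Y hY ≫ (λ_ Y).inv) ≫ 𝟙 (𝟙_ C) ▷ Y) =
        fun Y (_ : D.prop Y) => 𝟙 (𝟙_ C) ▷ Y := by
      funext Y hY
      rw [Category.assoc, reassoc_of% (he Y hY)]
      simp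
    rw [h3, h2, smul_smul, inv_mul_cancel₀ hD, one_smul]

end Cointegral

/-! ### The Fourier transform on characters -/

section Fourier

variable {k : Type w} [Field k] {C : Type u} [Category.{v} C] [Abelian C] [Linear k C]
  [MonoidalCategory C] [MonoidalPreadditive C] [MonoidalLinear k C] [RigidCategory C]
  {R : C ⥤ Center C} (adj : Center.forget C ⊣ R)

lemma algMul_left_action (a : CE R) (X : C) :
    ((λ_ (adjAlg R)).inv ≫ a ▷ adjAlg R ≫ algMul adj) ▷ X ≫ action adj X =
      action adj X ≫ (toNat adj a).app X := by
  simp only [comp_whiskerRight, Category.assoc, algMul_action]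
  change _ = action adj X ≫ (λ_ X).inv ≫ a ▷ X ≫ action adj X
  calc
    _ = (λ_ _).inv ≫ (a ▷ (adjAlg R ⊗ X) ≫ adjAlg R ◁ action adj X) ≫ action adj X := by monoidal
    _ = _ := by rw [← whisker_exchange]; simp

variable [BraidedCategory C] {p : PivotalStructure C} {ι : Type u'} [Fintype ι] {V : ι → C}
  {d : ι → k} (hV : SphericalBasis k p V d)

namespace SphericalBasis

/-- Multiplication by `a` inserts the action of `a` on `V i` under the trace, and this is a scalar.
-/
lemma algMul_left_character (a : CE R) (i : ι) :
    ((λ_ (adjAlg R)).inv ≫ a ▷ adjAlg R ≫ algMul adj) ≫ character adj p (V i) =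
      hV.coeff i ((toNat adj a).app (V i)) • character adj p (V i) := by
  rw [character, ← p.ptr_comp_left, reassoc_of% (algMul_left_action adj a (V i)),
    hV.coeff_smul i ((toNat adj a).app (V i))]
  have h : action adj (V i) ≫ (hV.coeff i ((toNat adj a).app (V i)) • 𝟙 (V i)) ≫ (λ_ (V i)).inv =
      hV.coeff i ((toNat adj a).app (V i)) • (action adj (V i) ≫ (λ_ (V i)).inv) := by simp
  rw [← hV.coeff_smul i ((toNat adj a).app (V i))]
  conv_lhs => rw [hV.coeff_smul i ((toNat adj a).app (V i))]
  exact (congrArg _ h).trans (p.ptr_smul _ _)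

include hV in
lemma toNat_antipode (a : CE R) : toNat adj (antipode adj a) = dualNat (toNat adj a) :=
  Function.invFun_eq ((hV.toNat_bijective adj hV.sums).2 _)

lemma fourier_eq (t : ι → k) (a : CE R) : fourier adj (∑ i, t i • character adj p (V i)) a =
    ∑ i, (t i * hV.coeff i ((dualNat (toNat adj a)).app (V i))) • character adj p (V i) := by
  have h : fourier adj (∑ i, t i • character adj p (V i)) a =
      ((λ_ (adjAlg R)).inv ≫ antipode adj a ▷ adjAlg R ≫ algMul adj) ≫
        ∑ i, t i • character adj p (V i) := by
    simp [fourier]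
  rw [h, Preadditive.comp_sum]
  refine Finset.sum_congr rfl fun i _ => ?_
  rw [Linear.comp_smul, hV.algMul_left_character, hV.toNat_antipode, smul_smul]

variable [DecidableEq ι] (hS : IsUnit (p.sMatrix k V))

include hV hS in
-- In the basis of characters the coordinates of the transform are the scalars of `a` on the simple
-- objects, permuted by duality and rescaled by the nonzero `t i`.
theorem fourier_bijective {t : ι → k} (ht : ∀ i, t i ≠ 0) :
    Function.Bijective (fourier adj (∑ i, t i • character adj p (V i))) := by
  obtain ⟨τ, hτ⟩ := hV.exists_dualNat_coeff
  constructor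
  · intro a b h
    rw [hV.fourier_eq, hV.fourier_eq] at h
    have h1 := hV.ring_injective hS (funext fun j =>
      (hV.drinfeldCoeff_sum_character adj _ j).symm.trans
        ((congrArg (fun f => hV.drinfeldCoeff adj f j) h).trans
          (hV.drinfeldCoeff_sum_character adj _ j)))
    refine (hV.toNat_bijective adj hV.sums).1 (hV.natTrans_ext fun i => ?_)
    obtain ⟨j, rfl⟩ := τ.surjective i
    have h2 := mul_left_cancel₀ (ht j) (congrFun h1 j)
    rw [hτ, hτ] at h2
    rw [hV.coeff_smul _ ((toNat adj a).app (V (τ j))), h2, ← hV.coeff_smul]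
  · intro f
    obtain ⟨s, rfl⟩ := hV.exists_eq_sum_character adj f
    obtain ⟨ξ, hξ⟩ := hV.exists_natTrans (𝟭 C) (𝟭 C)
      fun i => (s (τ.symm i) / t (τ.symm i)) • 𝟙 (V i)
    obtain ⟨a, rfl⟩ := (hV.toNat_bijective adj hV.sums).2 ξ
    refine ⟨a, ?_⟩
    rw [hV.fourier_eq]
    refine Finset.sum_congr rfl fun i _ => ?_
    rw [hτ, hV.coeff_eq _ (hξ (τ i)), Equiv.symm_apply_apply, mul_div_cancel₀ _ (ht i)]

/-- Pulled back along `drinfeldQ`, centrality compares the evaluation after the inverse monodromy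
with the plain evaluation, both times the coefficient. A nonzero coefficient cancels, and the
evaluation is nondegenerate. -/
lemma centralizes_of_drinfeldCoeff_ne_zero {D : FusionSubcategory C} {mu : CF R}
    (hmu : ∀ Y, D.prop Y → adjBraid R Y ≫ Y ◁ mu ≫ (ρ_ Y).hom = mu ▷ Y ≫ (λ_ Y).hom) {j : ι}
    (hj : hV.drinfeldCoeff adj mu j ≠ 0) (Y : C) (hY : D.prop Y) : invMono (V j) Y = 𝟙 _ := by
  apply invMono_eq_id_of_evaluation
  have h1 := hV.drinfeldQ_comp adj mu j
  have h2 : drinfeldQ adj (V j) ▷ Y ≫ adjBraid R Y ≫ Y ◁ mu ≫ (ρ_ Y).hom =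
      ((hopfHalfBraiding (V j)).β Y).hom ≫ Y ◁ (drinfeldQ adj (V j) ≫ mu) ≫ (ρ_ Y).hom := by
    have := adjLift_comm adj (hopfHalfBraiding (V j)) (ε_ (V j) (V j)ᘁ) Y
    rw [← drinfeldQ_eq] at this
    rw [reassoc_of% this, MonoidalCategory.whiskerLeft_comp, Category.assoc]
  have h3 : drinfeldQ adj (V j) ▷ Y ≫ mu ▷ Y ≫ (λ_ Y).hom =
      (drinfeldQ adj (V j) ≫ mu) ▷ Y ≫ (λ_ Y).hom := by simp
  rw [hmu Y hY, h3, h1, MonoidalLinear.whiskerLeft_smul, MonoidalLinear.smul_whiskerRight,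
    Linear.smul_comp, Linear.smul_comp, Linear.comp_smul, hopfHalfBraiding_evaluation] at h2
  have h4 := smul_right_injective _ hj h2
  rw [← cancel_epi (α_ (V j)ᘁ (V j) Y).hom, ← h4]
  simp

end SphericalBasis

end Fourier

end

section

/-! ### Morphisms into a tensor product with the adjoint algebra -/

section TensorExt

variable {k : Type w} [Field k] {𝒟 : Type u} [Category.{v} 𝒟] [Preadditive 𝒟] [Linear k 𝒟]
  [MonoidalCategory 𝒟] [MonoidalPreadditive 𝒟] [MonoidalLinear k 𝒟] [RigidCategory 𝒟]
  {ι : Type u'} [Fintype ι] {V : ι → 𝒟} {R : 𝒟 ⥤ Center 𝒟} (adj : Center.forget 𝒟 ⊣ R)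

lemma SimpleBasis.tensor_adjAlg_ext (hV : SimpleBasis k V) (hB : HasSums ι 𝒟) {X W : 𝒟}
    {f g : W ⟶ X ⊗ adjAlg R}
    (h : ∀ Y, f ▷ Y ≫ (α_ X (adjAlg R) Y).hom ≫ X ◁ action adj Y =
      g ▷ Y ≫ (α_ X (adjAlg R) Y).hom ≫ X ◁ action adj Y) : f = g := by
  obtain ⟨u⟩ := hV.nonempty_universalFamily hB (𝟙_ 𝒟)
  obtain ⟨θ, hθ⟩ := exists_iso_universalFamily adj u
  have h1 : ∀ (f : W ⟶ X ⊗ adjAlg R) (Y : 𝒟), (f ≫ X ◁ θ.hom) ▷ Y ≫ (α_ X u.A Y).hom ≫ X ◁ u.pi Y =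
      (f ▷ Y ≫ (α_ X (adjAlg R) Y).hom ≫ X ◁ action adj Y) ≫ X ◁ (ρ_ Y).inv := by
    intro f Y
    rw [← hθ]
    simp
  have h2 : f ≫ X ◁ θ.hom = g ≫ X ◁ θ.hom := u.ext fun Y => by rw [h1, h1, h]
  rwa [cancel_mono] at h2

end TensorExt

variable {k : Type w} [Field k] {C : Type u} [Category.{v} C] [Abelian C] [Linear k C]
  [MonoidalCategory C] [MonoidalPreadditive C] [MonoidalLinear k C] [RigidCategory C]
  [BraidedCategory C] {p : PivotalStructure C} {ι : Type u'} [Fintype ι] {V : ι → C} {d : ι → k}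
  (hV : SphericalBasis k p V d) {R : C ⥤ Center C} (adj : Center.forget C ⊣ R)

/-! ### The cointegral of the modular category -/

section Absolute

namespace SphericalBasis

lemma drinfeldCoeff_eq_one {mu : CF R} {j : ι} (hmu : drinfeldQ adj (V j) ≫ mu = ε_ (V j) (V j)ᘁ) :
    hV.drinfeldCoeff adj mu j = 1 :=
  hV.drinfeldCoeff_eq adj (by rw [hmu, one_smul])

lemma action_natural_family (D : FusionSubcategory C) {Y Y' : C} (_ : D.prop Y) (_ : D.prop Y')
    (f : Y ⟶ Y') : adjAlg R ◁ f ≫ action adj Y' = action adj Y ≫ f :=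
  action_naturality adj f

variable [DecidableEq ι] (hS : IsUnit (p.sMatrix k V))
include hV hS

/-- The idempotent cointegral of a modular category is a combination of the characters with
nonzero coefficients. -/
theorem exists_cointegral : ∃ t : ι → k, (∀ i, t i ≠ 0) ∧ ∀ mu : CF R,
    IsIdempotentCointegral adj mu ↔ mu = ∑ i, t i • character adj p (V i) := by
  classical
  have hD := hV.globalDim_ne_zero hS FusionSubcategory.whole
  -- These weights give the regular character divided by the global dimension.
  refine ⟨fun i => (globalDim V d FusionSubcategory.whole)⁻¹ * d i,
    fun i => mul_ne_zero (inv_ne_zero hD) (hV.dim_ne_zero hS i), ?_⟩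
  have hlam : ∑ i, ((globalDim V d FusionSubcategory.whole)⁻¹ * d i) • character adj p (V i) =
      (globalDim V d FusionSubcategory.whole)⁻¹ •
        regTrace p V d FusionSubcategory.whole fun Y _ => action adj Y ≫ (λ_ Y).inv := by
    simp only [mul_smul, ← Finset.smul_sum]
    congr 1
    exact Finset.sum_subtype _ (fun x => (iff_true_intro (Finset.mem_univ x)).trans Iff.rfl) _
  have h1 := hV.regTrace_action FusionSubcategory.whole hD (fun Y _ => action adj Y)
    (action_natural_family adj _) (fun U _ => adjBraid R U) (fun U W _ _ => action_tensor adj U W)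
    (algUnit adj) (fun Y _ => algUnit_action adj Y) hlam
  have h2 : IsIdempotentCointegral adj
      (∑ i, ((globalDim V d FusionSubcategory.whole)⁻¹ * d i) • character adj p (V i)) :=
    (isIdempotentCointegral_iff adj _).2 ⟨fun X => h1.1 X trivial, h1.2⟩
  -- Any normalized cointegral has the indicator of the transparent simple objects as coefficients,
  -- which gives uniqueness.
  have key : ∀ mu : CF R, IsIdempotentCointegral adj mu → ∀ j, hV.drinfeldCoeff adj mu j =
      if (∀ Y, FusionSubcategory.whole.prop Y → invMono (V j) Y = 𝟙 _) then 1 else 0 := by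
    intro mu hmu j
    rw [isIdempotentCointegral_iff] at hmu
    split_ifs with hj
    · refine hV.drinfeldCoeff_eq_one adj ?_
      -- For transparent `V j` the Drinfeld map acts by plain evaluation, so it factors through the
      -- unit and normalization applies.
      have h3 : drinfeldQ adj (V j) = ε_ (V j) (V j)ᘁ ≫ algUnit adj :=
        hV.adjAlg_ext adj hV.sums fun i => by
          rw [drinfeldQ_action, hj (V i) trivial, comp_whiskerRight, Category.assoc, algUnit_action]
          simp
      rw [h3, Category.assoc, hmu.2, Category.comp_id]
    · by_contra hne
      exact hj (hV.centralizes_of_drinfeldCoeff_ne_zero adj (D := FusionSubcategory.whole)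
        (fun Y _ => hmu.1 Y) hne)
  refine fun mu => ⟨fun hmu => ?_, fun h => h ▸ h2⟩
  exact hV.drinfeldCoeff_injective adj hS (funext fun j => (key _ hmu j).trans (key _ h2 j).symm)

end SphericalBasis

end Absolute

/-! ### Cointegrals of fusion subcategories -/

section Relative

section Auxiliary

variable {𝒟 : Type u} [Category.{v} 𝒟] [MonoidalCategory 𝒟] {A B T Y Z : 𝒟}

lemma whiskerRight_action_eq {q : A ⟶ B} {b : A ⊗ Y ⟶ Y ⊗ A} {b' : B ⊗ Y ⟶ Y ⊗ B}
    {a : A ⊗ Z ⟶ Z} {a' : B ⊗ Z ⟶ Z} {c : A ⊗ (Y ⊗ Z) ⟶ Y ⊗ Z} {c' : B ⊗ (Y ⊗ Z) ⟶ Y ⊗ Z}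
    (hc : c = (α_ A Y Z).inv ≫ b ▷ Z ≫ (α_ Y A Z).hom ≫ Y ◁ a)
    (hc' : c' = (α_ B Y Z).inv ≫ b' ▷ Z ≫ (α_ Y B Z).hom ≫ Y ◁ a')
    (ha : q ▷ Z ≫ a' = a) (hq : q ▷ (Y ⊗ Z) ≫ c' = c) (t : T ⟶ A ⊗ Y) :
    (t ≫ b ≫ Y ◁ q) ▷ Z ≫ (α_ Y B Z).hom ≫ Y ◁ a' =
      (t ≫ q ▷ Y ≫ b') ▷ Z ≫ (α_ Y B Z).hom ≫ Y ◁ a' := by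
  calc
    _ = t ▷ Z ≫ (α_ A Y Z).hom ≫ (α_ A Y Z).inv ≫ b ▷ Z ≫ (α_ Y A Z).hom ≫
        Y ◁ (q ▷ Z ≫ a') := by simp
    _ = t ▷ Z ≫ (α_ A Y Z).hom ≫ q ▷ (Y ⊗ Z) ≫ c' := by rw [ha, ← hc, hq]
    _ = _ := by rw [hc']; simp

lemma central_comp_eq {q : A ⟶ B} {b : A ⊗ Y ⟶ Y ⊗ A} {b' : B ⊗ Y ⟶ Y ⊗ B} {l : B ⟶ 𝟙_ 𝒟}
    (hb : b ≫ Y ◁ q = q ▷ Y ≫ b') (hl : b' ≫ Y ◁ l ≫ (ρ_ Y).hom = l ▷ Y ≫ (λ_ Y).hom) :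
    b ≫ Y ◁ (q ≫ l) ≫ (ρ_ Y).hom = (q ≫ l) ▷ Y ≫ (λ_ Y).hom := by
  rw [MonoidalCategory.whiskerLeft_comp, Category.assoc, reassoc_of% hb, hl]
  simp

end Auxiliary

variable (E : FusionSubcategory C) {RE : E.prop.FullSubcategory ⥤ Center E.prop.FullSubcategory}
  (adjE : Center.forget E.prop.FullSubcategory ⊣ RE)

namespace SphericalBasis

include hV in
-- Simple objects outside `E` have no nonzero morphisms to objects of `E`. This permits universal
-- properties inside `E` to be used for sources that do not lie in `E`.
lemma hom_ext_fullSubcategory {W : C} {T : E.prop.FullSubcategory} {f g : W ⟶ T.obj}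
    (h : ∀ i, E.prop (V i) → ∀ t : V i ⟶ W, t ≫ f = t ≫ g) : f = g := by
  refine hV.hom_ext_source fun i t => ?_
  by_cases hi : E.prop (V i)
  · exact h i hi t
  · have h0 : ∀ e : V i ⟶ T.obj, e = 0 := fun e => by
      by_contra he
      obtain ⟨r⟩ := hV.retract_of_ne_zero' he
      exact hi (E.retract.of_retract r T.property)
    rw [h0 (t ≫ f), h0 (t ≫ g)]

include hV in
/-- The canonical morphism from the adjoint algebra to that of a fusion subcategory exists. -/
lemma exists_restriction : ∃ q : adjAlg R ⟶ (adjAlg RE).obj, ∀ X : E.prop.FullSubcategory,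
    q ▷ X.obj ≫ (action adjE X).hom = action adj X.obj := by
  classical
  let _ := E.rigid
  have hE := hV.toSimpleBasis.fullSubcategory E
  obtain ⟨n, a, b, hab⟩ := hV.decomp (adjAlg R)
  have key : ∀ l (b : V l ⟶ adjAlg R), ∃ f : V l ⟶ (adjAlg RE).obj, ∀ X : E.prop.FullSubcategory,
      f ▷ X.obj ≫ (action adjE X).hom = b ▷ X.obj ≫ action adj X.obj := by
    intro l b
    by_cases hl : E.prop (V l)
    · let W : E.prop.FullSubcategory := ⟨V l, hl⟩
      obtain ⟨f, hf⟩ := hE.exists_action_eq adjE E.hasSums W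
        { app := fun X => ObjectProperty.homMk (b ▷ X.obj ≫ action adj X.obj)
          naturality := fun X Y t => by
            ext
            change V l ◁ t.hom ≫ b ▷ Y.obj ≫ action adj Y.obj =
              (b ▷ X.obj ≫ action adj X.obj) ≫ t.hom
            rw [whisker_exchange_assoc, action_naturality, Category.assoc] }
      exact ⟨f.hom, fun X => congrArg (fun t => t.hom) (hf X)⟩
    -- A simple object outside `E` cannot act on objects of `E`: by duality the action would be a
    -- morphism to `X ⊗ X*`, which lies in `E`.
    · refine ⟨0, fun X => ?_⟩
      have h0 : ∀ e : V l ⊗ X.obj ⟶ X.obj, e = 0 := fun e => by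
        apply (tensorRightHomEquiv (V l) X.obj X.objᘁ X.obj).injective
        have h1 : ∀ e : V l ⟶ X.obj ⊗ X.objᘁ, e = 0 := fun e => by
          by_contra he
          obtain ⟨r⟩ := hV.retract_of_ne_zero' he
          exact hl (E.retract.of_retract r
            (E.isMonoidal.prop_tensor _ _ X.property (E.dual _ X.property)))
        rw [h1 (tensorRightHomEquiv (V l) X.obj X.objᘁ X.obj e), h1 (tensorRightHomEquiv _ _ _ _ 0)]
      rw [h0 (b ▷ X.obj ≫ _)]
      exact h0 _
  choose f hf using fun l α => key l (b l α)
  refine ⟨∑ l, ∑ α, a l α ≫ f l α, fun X => ?_⟩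
  simp only [sum_whiskerRight, Preadditive.sum_comp, comp_whiskerRight, Category.assoc, hf]
  simp only [← comp_whiskerRight_assoc, ← Preadditive.sum_comp, ← sum_whiskerRight, hab]
  simp

variable {q : adjAlg R ⟶ (adjAlg RE).obj}
  (hq : ∀ X : E.prop.FullSubcategory, q ▷ X.obj ≫ (action adjE X).hom = action adj X.obj)

include hV hq

/-- Both sides are tested by letting the adjoint algebra of `E` act on `Z` in `E`; there they encode
the action on `Y ⊗ Z`, which `q` respects. -/
lemma restriction_adjBraid (Y : E.prop.FullSubcategory) :
    adjBraid R Y.obj ≫ Y.obj ◁ q = q ▷ Y.obj ≫ (adjBraid RE Y).hom := by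
  classical
  let _ := E.rigid
  have hE := hV.toSimpleBasis.fullSubcategory E
  refine hV.hom_ext_fullSubcategory E (T := Y ⊗ adjAlg RE) fun i hi t => ?_
  let W : E.prop.FullSubcategory := ⟨V i, hi⟩
  have h : (ObjectProperty.homMk (t ≫ adjBraid R Y.obj ≫ Y.obj ◁ q) : W ⟶ Y ⊗ adjAlg RE) =
      ObjectProperty.homMk (t ≫ q ▷ Y.obj ≫ (adjBraid RE Y).hom) := by
    refine hE.tensor_adjAlg_ext adjE E.hasSums fun Z => ?_
    ext
    exact whiskerRight_action_eq (action_tensor adj Y.obj Z.obj)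
      (congrArg (fun t => t.hom) (action_tensor adjE Y Z)) (hq Z) (hq (Y ⊗ Z)) t
  exact congrArg (fun t => t.hom) h

/-- With trivial monodromy both morphisms act on the objects of `E` by plain evaluation, and the
action on those objects determines a morphism into the adjoint algebra of `E`. -/
lemma drinfeldQ_restriction {j : ι} (hj : ∀ Y, E.prop Y → invMono (V j) Y = 𝟙 _) :
    drinfeldQ adj (V j) ≫ q = ε_ (V j) (V j)ᘁ ≫ (algUnit adjE).hom := by
  classical
  let _ := E.rigid
  have hE := hV.toSimpleBasis.fullSubcategory E
  refine hV.hom_ext_fullSubcategory E (T := adjAlg RE) fun i hi t => ?_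
  let W : E.prop.FullSubcategory := ⟨V i, hi⟩
  have h : (ObjectProperty.homMk (t ≫ drinfeldQ adj (V j) ≫ q) : W ⟶ adjAlg RE) =
      ObjectProperty.homMk (t ≫ ε_ (V j) (V j)ᘁ ≫ (algUnit adjE).hom) := by
    refine hE.adjAlg_ext adjE E.hasSums fun Z => ?_
    ext
    have h1 : (algUnit adjE).hom ▷ V Z.1 ≫ (action adjE ⟨V Z.1, Z.2⟩).hom = (λ_ (V Z.1)).hom :=
      congrArg (fun t => t.hom) (algUnit_action adjE (⟨V Z.1, Z.2⟩ : E.prop.FullSubcategory))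
    have h2 := hq ⟨V Z.1, Z.2⟩
    have h3 := drinfeldQ_action adj (V j) (V Z.1)
    rw [hj _ Z.2] at h3
    have h4 : (t ≫ drinfeldQ adj (V j) ≫ q) ▷ V Z.1 ≫ (action adjE ⟨V Z.1, Z.2⟩).hom =
        t ▷ V Z.1 ≫ drinfeldQ adj (V j) ▷ V Z.1 ≫ action adj (V Z.1) := by
      rw [← h2]; simp
    have h5 : (t ≫ ε_ (V j) (V j)ᘁ ≫ (algUnit adjE).hom) ▷ V Z.1 ≫
        (action adjE ⟨V Z.1, Z.2⟩).hom = t ▷ V Z.1 ≫ ε_ (V j) (V j)ᘁ ▷ V Z.1 ≫ (λ_ _).hom := by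
      rw [← h1]
      exact (congrArg (· ≫ _) ((comp_whiskerRight t _ _).trans
        (congrArg (_ ≫ ·) (comp_whiskerRight _ _ _)))).trans
          ((Category.assoc _ _ _).trans (congrArg (_ ≫ ·) (Category.assoc _ _ _)))
    refine h4.trans (Eq.trans ?_ h5.symm)
    rw [h3]
    simp
  exact congrArg (fun t => t.hom) h

open scoped Classical in
-- If `V j` centralizes `E`, the Drinfeld map passes through the unit of the adjoint algebra of `E`
-- and normalization gives `1`. A nonzero coefficient conversely forces centralizing, because the
-- pulled back cointegral is central for objects of `E`.
lemma drinfeldCoeff_restriction {lamE : CF RE} (hlam : IsIdempotentCointegral adjE lamE) (j : ι) :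
    hV.drinfeldCoeff adj (q ≫ lamE.hom) j =
      if (∀ Y, E.prop Y → invMono (V j) Y = 𝟙 _) then 1 else 0 := by
  rw [isIdempotentCointegral_iff] at hlam
  split_ifs with hj
  · refine hV.drinfeldCoeff_eq_one adj ?_
    rw [reassoc_of% (hV.drinfeldQ_restriction adj E adjE hq hj)]
    have h : (algUnit adjE).hom ≫ lamE.hom = 𝟙 (𝟙_ C) := congrArg (fun t => t.hom) hlam.2
    rw [h]
    exact Category.comp_id _
  · by_contra hne
    refine hj (hV.centralizes_of_drinfeldCoeff_ne_zero adj (D := E) (fun Y hY => ?_) hne)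
    have h1 := hV.restriction_adjBraid adj E adjE hq ⟨Y, hY⟩
    exact central_comp_eq h1 (congrArg (fun t => t.hom) (hlam.1 ⟨Y, hY⟩))

omit hq in
lemma exists_cointegral_fullSubcategory (hE : globalDim V d E ≠ 0) :
    ∃ lamE : CF RE, IsIdempotentCointegral adjE lamE := by
  let _ := E.rigid
  have h1 := hV.regTrace_action E hE (A := (adjAlg RE).obj) (fun Y hY => (action adjE ⟨Y, hY⟩).hom)
    (fun {Y Y'} hY hY' f => congrArg (fun t => t.hom) (action_naturality adjE
      (ObjectProperty.homMk f : (⟨Y, hY⟩ : E.prop.FullSubcategory) ⟶ ⟨Y', hY'⟩)))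
    (fun U hU => (adjBraid RE ⟨U, hU⟩).hom)
    (fun U W hU hW => congrArg (fun t => t.hom) (action_tensor adjE
      (⟨U, hU⟩ : E.prop.FullSubcategory) ⟨W, hW⟩))
    (algUnit adjE).hom
    (fun Y hY => congrArg (fun t => t.hom) (algUnit_action adjE ⟨Y, hY⟩)) rfl
  refine ⟨ObjectProperty.homMk ((globalDim V d E)⁻¹ • regTrace p V d E fun Y hY =>
    (action adjE ⟨Y, hY⟩).hom ≫ (λ_ Y).inv), (isIdempotentCointegral_iff adjE _).2
      ⟨fun X => ?_, ?_⟩⟩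
  · ext
    exact h1.1 X.obj X.property
  · ext
    exact h1.2

end SphericalBasis

end Relative

end

section

/-! ### Maschke's theorem in the center and the decomposition of `R(1)` -/

section Regular

lemma exists_linearMap_regular {k : Type*} [Field k] {M N : Type*} [AddCommGroup M] [Module k M]
    [AddCommGroup N] [Module k N] (f : M →ₗ[k] N) : ∃ g : N →ₗ[k] M, ∀ x, f (g (f x)) = f x := by
  obtain ⟨s, hs⟩ := f.rangeRestrict.exists_rightInverse_of_surjective f.range_rangeRestrict
  obtain ⟨g, hg⟩ := LinearMap.exists_extend s
  refine ⟨g, fun x => ?_⟩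
  have h1 : g (f x) = s (f.rangeRestrict x) := LinearMap.congr_fun hg (f.rangeRestrict x)
  rw [h1]
  exact congrArg Subtype.val (LinearMap.congr_fun hs (f.rangeRestrict x))

/-- Generalized inverses of the linear maps induced on the spaces `Hom(V_l, -)` are glued along a
decomposition of the target; only scalars occur between simple objects, so the glued morphism
induces them back. -/
lemma SimpleBasis.exists_regular {k : Type w} [Field k] {𝒟 : Type u} [Category.{v} 𝒟]
    [Preadditive 𝒟] [Linear k 𝒟] {ι : Type u'} [Fintype ι] {V : ι → 𝒟} (hV : SimpleBasis k V)
    {X Y : 𝒟} (g : X ⟶ Y) : ∃ q : Y ⟶ X, g ≫ q ≫ g = g := by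
  obtain ⟨n, a, b, hab⟩ := hV.decomp Y
  choose q hq using fun l => exists_linearMap_regular (Linear.rightComp k (V l) g)
  refine ⟨∑ l, ∑ α, a l α ≫ q l (b l α), ?_⟩
  have h1 : ∀ l (t : V l ⟶ Y), t ≫ ∑ l, ∑ α, a l α ≫ q l (b l α) = q l t := by
    intro l t
    conv_rhs => rw [← Category.comp_id t, ← hab]
    simp only [Preadditive.comp_sum, map_sum]
    refine Finset.sum_congr rfl fun m _ => Finset.sum_congr rfl fun α _ => ?_
    simp only [← Category.assoc]
    by_cases hm : l = m
    · subst hm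
      obtain ⟨c, hc⟩ := hV.end_scalar l (t ≫ a l α)
      rw [hc]
      simp
    · rw [hV.hom_eq_zero l m hm (t ≫ a m α)]
      simp
  refine hV.hom_ext_source fun l t => ?_
  have h2 := h1 l (t ≫ g)
  rw [Category.assoc] at h2
  rw [← Category.assoc g, ← Category.assoc t, h2]
  exact hq l t

end Regular

variable {k : Type w} [Field k] {C : Type u} [Category.{v} C] [Abelian C] [Linear k C]
  [MonoidalCategory C] [MonoidalPreadditive C] [MonoidalLinear k C] [RigidCategory C]
  {p : PivotalStructure C} {ι : Type u'} [Fintype ι] {V : ι → C} {d : ι → k}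
  (hV : SphericalBasis k p V d)

namespace SphericalBasis

include hV in
/-- A form of Maschke's theorem: the center is von Neumann regular. -/
lemma exists_central_regular (hD : globalDim V d FusionSubcategory.whole ≠ 0) {X Z : C}
    (b : HalfBraiding X) (b' : HalfBraiding Z) (m : Z ⟶ X)
    (hm : ∀ Y, m ▷ Y ≫ (b.β Y).hom = (b'.β Y).hom ≫ Y ◁ m) :
    ∃ g : X ⟶ Z, (∀ Y, g ▷ Y ≫ (b'.β Y).hom = (b.β Y).hom ≫ Y ◁ g) ∧ m ≫ g ≫ m = m := by
  obtain ⟨q, hq⟩ := hV.exists_regular m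
  have hm' : ∀ Y, (b'.β Y).inv ≫ m ▷ Y = Y ◁ m ≫ (b.β Y).inv := fun Y => by
    rw [Iso.inv_comp_eq, ← reassoc_of% (hm Y)]; simp
  -- The morphism `q` is averaged: it is conjugated by the half-braidings and traced over the
  -- regular object.
  let h : ∀ Y, FusionSubcategory.whole.prop Y → (X ⊗ Y ⟶ Z ⊗ Y) :=
    fun Y _ => (b.β Y).hom ≫ Y ◁ q ≫ (b'.β Y).inv
  refine ⟨(globalDim V d FusionSubcategory.whole)⁻¹ • regTrace p V d FusionSubcategory.whole h,
    fun U => ?_, ?_⟩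
  · have h1 := hV.regTrace_central (D := FusionSubcategory.whole) h
      (fun {Y Y'} _ _ f => by
        have h2 : f ▷ Z ≫ (b'.β Y').inv = (b'.β Y).inv ≫ Z ◁ f := by
          rw [Iso.eq_inv_comp, ← reassoc_of% (b'.naturality f)]; simp
        simp only [h, Category.assoc]
        rw [← h2, reassoc_of% (b.naturality f), whisker_exchange_assoc])
      (U := U) trivial (b.β U).hom (b'.β U).inv (fun W _ => by
        have h2 : (b'.β (U ⊗ W)).inv = (α_ U W Z).hom ≫ U ◁ (b'.β W).inv ≫ (α_ U Z W).inv ≫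
            (b'.β U).inv ▷ W ≫ (α_ Z U W).hom := by
          rw [← cancel_epi (b'.β (U ⊗ W)).hom, Iso.hom_inv_id, b'.monoidal]
          simp only [Category.assoc, Iso.inv_hom_id_assoc, ← MonoidalCategory.whiskerLeft_comp_assoc,
            Iso.hom_inv_id, MonoidalCategory.whiskerLeft_id, Category.id_comp,
            Iso.hom_inv_id_assoc, ← comp_whiskerRight_assoc, id_whiskerRight, Iso.inv_hom_id]
        simp only [h]
        rw [b.monoidal, h2]
        monoidal)
    rw [MonoidalLinear.whiskerLeft_smul, MonoidalLinear.smul_whiskerRight, Linear.smul_comp,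
      Linear.comp_smul, ← h1]
    simp
  · rw [Linear.smul_comp, Linear.comp_smul, ← regTrace_comp]
    -- Since `m` commutes with the half-braidings, every term of the average reduces to `m ≫ q ≫ m =
    -- m`.
    have h1 : (fun Y (hY : FusionSubcategory.whole.prop Y) => m ▷ Y ≫ h Y hY ≫ m ▷ Y) =
        fun Y _ => m ▷ Y := by
      funext Y hY
      simp only [h, Category.assoc]
      rw [reassoc_of% (hm Y), hm' Y, ← MonoidalCategory.whiskerLeft_comp_assoc,
        ← MonoidalCategory.whiskerLeft_comp_assoc, Category.assoc, hq, ← reassoc_of% (hm Y),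
        Iso.hom_inv_id, Category.comp_id]
    rw [h1, hV.regTrace_whiskerRight, smul_smul, inv_mul_cancel₀ hD, one_smul]

variable [BraidedCategory C] {R : C ⥤ Center C} (adj : Center.forget C ⊣ R)

lemma evaluation_ne_zero (hV : SimpleBasis k V) (j : ι) : ε_ (V j) (V j)ᘁ ≠ 0 := by
  intro h
  apply hV.id_ne_zero j
  rw [← tensorLeft_evaluation (V j), h]
  simp

include hV in
lemma drinfeldQ_ne_zero (j : ι) : drinfeldQ adj (V j) ≠ 0 := by
  intro h
  apply evaluation_ne_zero hV.toSimpleBasis j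
  rw [← adjLift_counit adj (hopfHalfBraiding (V j)) (ε_ (V j) (V j)ᘁ), ← drinfeldQ_eq, h, zero_comp]

lemma drinfeldCoeff_counit (j : ι) : hV.drinfeldCoeff adj (adjCounit adj) j = 1 := by
  refine hV.drinfeldCoeff_eq_one adj ?_
  rw [drinfeldQ_eq, adjLift_counit]

omit [BraidedCategory C] in
lemma adjEnd_counit : adjEnd adj (adjCounit adj) = 𝟙 (adjAlg R) :=
  (adjLift_unique adj _ _ _ (fun X => by rw [adjHalfBraiding_hom]; simp) (Category.id_comp _)).symm

include hV in
lemma smul_drinfeldQ_injective {j : ι} {c c' : k}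
    (h : c • drinfeldQ adj (V j) = c' • drinfeldQ adj (V j)) : c = c' := by
  by_contra hne
  apply hV.drinfeldQ_ne_zero adj j
  have h' : (c - c') • drinfeldQ adj (V j) = 0 := by rw [sub_smul, h, sub_self]
  exact (smul_eq_zero_iff_right (sub_ne_zero.mpr hne)).mp h'

variable [DecidableEq ι] (hS : IsUnit (p.sMatrix k V))

include hV hS in
/-- The Drinfeld maps decompose the adjoint algebra, as an object of the center, into the direct
sum of the objects `(V j)ᘁ ⊗ V j`. -/
lemma exists_drinfeldQ_decomposition : ∃ P : ∀ j, adjAlg R ⟶ (V j)ᘁ ⊗ V j,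
    (∀ j Y, P j ▷ Y ≫ ((hopfHalfBraiding (V j)).β Y).hom = adjBraid R Y ≫ Y ◁ P j) ∧
      (∀ j, drinfeldQ adj (V j) ≫ P j = 𝟙 _) ∧
      (∀ i j, i ≠ j → drinfeldQ adj (V i) ≫ P j = 0) ∧
      ∑ j, P j ≫ drinfeldQ adj (V j) = 𝟙 (adjAlg R) := by
  have hD := hV.globalDim_ne_zero hS FusionSubcategory.whole
  choose P hP hQP using fun j => hV.exists_central_regular hD (adjHalfBraiding R)
    (hopfHalfBraiding (V j)) (drinfeldQ adj (V j)) (fun Y => adjLift_comm adj _ _ Y)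
  -- This composite is an endomorphism in the center, so it comes from a class function and is
  -- controlled by coefficients.
  have hend : ∀ j, P j ≫ drinfeldQ adj (V j) = adjEnd adj (P j ≫ ε_ (V j) (V j)ᘁ) := by
    intro j
    refine adjLift_unique adj _ _ _ (fun X => ?_) ?_
    · have h1 := adjLift_comm adj (hopfHalfBraiding (V j)) (ε_ (V j) (V j)ᘁ) X
      rw [← drinfeldQ_eq] at h1
      rw [comp_whiskerRight, Category.assoc, h1, reassoc_of% (hP j X),
        MonoidalCategory.whiskerLeft_comp]
    · rw [Category.assoc, drinfeldQ_eq, adjLift_counit]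
  have hcoeff : ∀ i j, hV.drinfeldCoeff adj (P j ≫ ε_ (V j) (V j)ᘁ) i = if i = j then 1 else 0 := by
    intro i j
    have h1 := hV.drinfeldQ_adjEnd adj (P j ≫ ε_ (V j) (V j)ᘁ) i
    rw [← hend] at h1
    split_ifs with hij
    · subst hij
      rw [hQP] at h1
      exact hV.smul_drinfeldQ_injective adj (h1.symm.trans (one_smul _ _).symm)
    -- The class function `f` acts as the identity on the `j`-th Drinfeld map and as zero on the
    -- `i`-th, so nothing passes from one to the other.
    · obtain ⟨f, hf⟩ := hV.exists_drinfeldCoeff_eq adj hS fun l => if l = j then 1 else 0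
      have h2 := h1 =≫ adjEnd adj f
      simp only [Category.assoc, Linear.smul_comp, hV.drinfeldQ_adjEnd, hf, if_pos, if_neg hij,
        one_smul, zero_smul, smul_zero] at h2
      rw [h2] at h1
      exact hV.smul_drinfeldQ_injective adj (h1.symm.trans (zero_smul _ _).symm)
  have hsum : ∑ j, P j ≫ drinfeldQ adj (V j) = 𝟙 (adjAlg R) := by
    have h1 : ∑ j, P j ≫ ε_ (V j) (V j)ᘁ = adjCounit adj := by
      refine hV.drinfeldCoeff_injective adj hS (funext fun i => ?_)
      rw [hV.drinfeldCoeff_sum, hV.drinfeldCoeff_counit]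
      simp [hcoeff]
    rw [← adjEnd_counit adj, ← h1]
    simp only [hend]
    exact (map_sum (AddMonoidHom.mk' (adjEnd adj) (adjLift_add adj _)) _ _).symm
  suffices hone : ∀ j, drinfeldQ adj (V j) ≫ P j = 𝟙 _ by
    refine ⟨P, hP, hone, fun i j hij => ?_, hsum⟩
    have h1 := hV.drinfeldQ_adjEnd adj (P j ≫ ε_ (V j) (V j)ᘁ) i
    rw [← hend, hcoeff, if_neg hij, zero_smul] at h1
    have h2 := h1 =≫ P j
    rwa [zero_comp, Category.assoc, Category.assoc, hone, Category.comp_id] at h2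
  intro j
  refine hV.hom_ext_source fun l t => ?_
  obtain ⟨r, s, -, hsr, hsr0, -⟩ := hV.exists_adjAlg_decomposition adj
  have := hV.finite
  let T : (∀ j, V l ⟶ (V j)ᘁ ⊗ V j) →ₗ[k] (V l ⟶ adjAlg R) :=
    ∑ j, (Linear.rightComp k (V l) (drinfeldQ adj (V j))).comp (LinearMap.proj j)
  have hT : ∀ x, T x = ∑ j, x j ≫ drinfeldQ adj (V j) := fun x => by simp [T]
  -- Dimension count: the Drinfeld maps are jointly split epi onto the adjoint algebra by `hsum`,
  -- and it is also isomorphic to `⨁ V_i ⊗ V_i*`, hence by the braiding to `⨁ V_i* ⊗ V_i`. The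
  -- surjective endomorphism `Φ` of a finite-dimensional space is therefore injective, so the
  -- Drinfeld maps can be cancelled.
  let Φ : (∀ j, V l ⟶ (V j)ᘁ ⊗ V j) →ₗ[k] (∀ j, V l ⟶ (V j)ᘁ ⊗ V j) :=
    LinearMap.pi fun i => (Linear.rightComp k (V l) (r i ≫ (β_ (V i) (V i)ᘁ).hom)).comp T
  have hΦ : ∀ x i, Φ x i = T x ≫ r i ≫ (β_ (V i) (V i)ᘁ).hom := fun x i => rfl
  have hsurj : Function.Surjective Φ := by
    intro y
    refine ⟨fun j => (∑ i, y i ≫ (β_ (V i) (V i)ᘁ).inv ≫ s i) ≫ P j, ?_⟩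
    funext i
    rw [hΦ, hT]
    simp only [Category.assoc, ← Preadditive.comp_sum, hsum]
    rw [Category.id_comp, Preadditive.sum_comp, Finset.sum_eq_single i]
    · simp only [Category.assoc]
      rw [reassoc_of% (hsr i)]
      simp
    · intro i' _ hi
      simp only [Category.assoc]
      rw [reassoc_of% (hsr0 i' i hi)]
      simp
    · simp
  have hinj := LinearMap.injective_iff_surjective.2 hsurj
  have h1 : Φ (Pi.single j (t ≫ drinfeldQ adj (V j) ≫ P j)) = Φ (Pi.single j t) := by
    have h2 : ∀ t : V l ⟶ (V j)ᘁ ⊗ V j, T (Pi.single j t) = t ≫ drinfeldQ adj (V j) := by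
      intro t
      rw [hT, Finset.sum_eq_single j]
      · simp
      · intro i _ hij
        rw [Pi.single_eq_of_ne hij, zero_comp]
      · simp
    funext i
    rw [hΦ, hΦ, h2, h2]
    simp only [Category.assoc]
    rw [reassoc_of% (hQP j)]
  have h2 := congrFun (hinj h1) j
  rw [Pi.single_eq_same, Pi.single_eq_same] at h2
  rw [h2, Category.comp_id]

end SphericalBasis

end

section

/-! ### Endomorphisms of `R(1)` and the idempotents of a decomposition -/

section CenterHom

variable {C : Type u} [Category.{v} C] [MonoidalCategory C] [Preadditive C]
  [MonoidalPreadditive C] {R : C ⥤ Center C} (adj : Center.forget C ⊣ R)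

lemma center_sum_f {X Y : Center C} {J : Type*} (s : Finset J) (f : J → (X ⟶ Y)) :
    (∑ i ∈ s, f i).f = ∑ i ∈ s, (f i).f :=
  map_sum (AddMonoidHom.mk' (fun f : X ⟶ Y => f.f) fun _ _ => rfl) f s

lemma exists_adjEnd_eq (t : R.obj (𝟙_ C) ⟶ R.obj (𝟙_ C)) : ∃ f : CF R, adjEnd adj f = t.f :=
  ⟨(adj.homEquiv (R.obj (𝟙_ C)) (𝟙_ C)).symm t,
    congrArg Center.Hom.f ((adj.homEquiv (R.obj (𝟙_ C)) (𝟙_ C)).apply_symm_apply t)⟩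

lemma ConjugacyClasses.adjEnd_idem {κ : Type*} [Fintype κ] (K : ConjugacyClasses R κ) (i : κ) :
    adjEnd adj (K.idem adj i) = (K.proj i ≫ K.incl i).f :=
  congrArg Center.Hom.f ((adj.homEquiv (R.obj (𝟙_ C)) (𝟙_ C)).apply_symm_apply _)

namespace ConjugacyClasses

variable {κ : Type*} [Fintype κ] (K : ConjugacyClasses R κ)

lemma adjEnd_idem_mul_self (i : κ) : adjEnd adj (K.idem adj i) ≫ adjEnd adj (K.idem adj i) =
    adjEnd adj (K.idem adj i) := by
  rw [adjEnd_idem]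
  refine congrArg Center.Hom.f (?_ : (K.proj i ≫ K.incl i) ≫ K.proj i ≫ K.incl i = _)
  rw [Category.assoc, reassoc_of% (K.incl_proj_self i)]

lemma adjEnd_idem_mul_ne {i i' : κ} (h : i ≠ i') :
    adjEnd adj (K.idem adj i) ≫ adjEnd adj (K.idem adj i') = 0 := by
  rw [adjEnd_idem, adjEnd_idem]
  refine congrArg Center.Hom.f (?_ : (K.proj i ≫ K.incl i) ≫ K.proj i' ≫ K.incl i' = 0)
  rw [Category.assoc, reassoc_of% (K.incl_proj_ne i i' h), zero_comp, comp_zero]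

lemma sum_adjEnd_idem : ∑ i, adjEnd adj (K.idem adj i) = 𝟙 (adjAlg R) := by
  simp only [adjEnd_idem]
  exact (center_sum_f _ _).symm.trans (congrArg Center.Hom.f K.sum_proj_incl)

end ConjugacyClasses

end CenterHom

variable {k : Type w} [Field k] {C : Type u} [Category.{v} C] [Abelian C] [Linear k C]
  [MonoidalCategory C] [MonoidalPreadditive C] [MonoidalLinear k C] [RigidCategory C]
  [BraidedCategory C] {p : PivotalStructure C} {ι : Type u'} [Fintype ι] {V : ι → C} {d : ι → k}
  (hV : SphericalBasis k p V d) {R : C ⥤ Center C} (adj : Center.forget C ⊣ R)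

/-- The morphism `drinfeldQ` as a morphism of the center. -/
def drinfeldQCenter (Y : C) : hopfObj Y ⟶ R.obj (𝟙_ C) :=
  adj.homEquiv (hopfObj Y) (𝟙_ C) (ε_ Y Yᘁ)

namespace SphericalBasis

include hV in
lemma trace_hopfObj (j : ι) :
    scalar k (p.trace (𝟙 ((Center.forget C).obj (hopfObj (V j))))) = d j ^ 2 := by
  refine scalar_eq hV.unit_bijective ?_
  have h := p.trace_tensor (𝟙 ((V j)ᘁ ⊗ V j))
  rw [← id_whiskerRight, hV.ptr_whiskerRight] at h
  refine Eq.trans ?_ (h.trans ?_)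
  · rw [id_whiskerRight]; rfl
  · have h1 : p.trace (d j • 𝟙 (V j)ᘁ) = d j • p.trace (𝟙 (V j)ᘁ) := by
      simp [PivotalStructure.trace]
    rw [h1, ← hV.spherical, hV.dim_eq, smul_smul, sq]

/-! ### Simplicity of the summands `V_j* ⊗ V_j` -/

section Modular

variable [DecidableEq ι] (hS : IsUnit (p.sMatrix k V))
include hV hS

lemma exists_drinfeldQCenter_decomposition : ∃ P : ∀ j, R.obj (𝟙_ C) ⟶ hopfObj (V j),
    (∀ j, drinfeldQCenter adj (V j) ≫ P j = 𝟙 _) ∧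
      (∀ i j, i ≠ j → drinfeldQCenter adj (V i) ≫ P j = 0) ∧
      ∑ j, P j ≫ drinfeldQCenter adj (V j) = 𝟙 (R.obj (𝟙_ C)) := by
  obtain ⟨P, hP, h1, h2, h3⟩ := hV.exists_drinfeldQ_decomposition adj hS
  refine ⟨fun j => ⟨P j, hP j⟩, fun j => Center.ext _ _ (h1 j),
    fun i j hij => Center.ext _ _ (h2 i j hij), Center.ext _ _ ?_⟩
  rw [center_sum_f]
  exact h3

include adj in
-- A subobject splits by `exists_central_regular`. Its idempotent extends by `P j` to an
-- endomorphism of `R(1)`, which acts on the Drinfeld map by a scalar, so the idempotent is a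
-- scalar; if the subobject is nonzero, this scalar is `1`.
lemma simple_hopfObj (j : ι) : Simple (hopfObj (V j)) := by
  obtain ⟨P, hP, -, -⟩ := hV.exists_drinfeldQCenter_decomposition adj hS
  have hQ0 : drinfeldQCenter adj (V j) ≠ 0 := fun h =>
    hV.drinfeldQ_ne_zero adj j (congrArg Center.Hom.f h)
  refine ⟨fun {Z} m _ => ?_⟩
  obtain ⟨g', hg', hgm'⟩ := hV.exists_central_regular
    (hV.globalDim_ne_zero hS FusionSubcategory.whole) (hopfObj (V j)).2 Z.2 m.f (fun Y => m.comm Y)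
  let g : hopfObj (V j) ⟶ Z := ⟨g', hg'⟩
  have hgm : m ≫ g ≫ m = m := Center.ext _ _ hgm'
  have hmg : m ≫ g = 𝟙 Z := by
    rw [← cancel_mono m, Category.assoc, hgm, Category.id_comp]
  obtain ⟨f, hf⟩ := exists_adjEnd_eq adj (P j ≫ (g ≫ m) ≫ drinfeldQCenter adj (V j))
  have h1 := hV.drinfeldQ_adjEnd adj f j
  have h2 : (g ≫ m).f = hV.drinfeldCoeff adj f j • 𝟙 _ := by
    have h3 := congrArg (fun t => t ≫ (P j).f) h1
    rw [hf] at h3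
    have h4 := congrArg Center.Hom.f (hP j)
    calc
      (g ≫ m).f = (drinfeldQCenter adj (V j) ≫ (P j ≫ (g ≫ m) ≫ drinfeldQCenter adj (V j)) ≫
          P j).f := by
        congr 1
        rw [Category.assoc, Category.assoc, Category.assoc, hP, Category.comp_id,
          reassoc_of% (hP j)]
      _ = _ := by
        refine Eq.trans ?_ (h3.trans ?_)
        · exact (Category.assoc _ _ _).symm
        · refine (Linear.smul_comp _ _ _ _ _ _).trans ?_
          exact congrArg (fun t => hV.drinfeldCoeff adj f j • t) h4
  constructor
  · rintro hm rfl
    apply hQ0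
    rw [← Category.id_comp (drinfeldQCenter adj (V j)), ← IsIso.inv_hom_id (0 : Z ⟶ hopfObj (V j)),
      comp_zero, zero_comp]
  · intro hm
    have hc : hV.drinfeldCoeff adj f j = 1 := by
      have h5 : (m ≫ g ≫ m).f = hV.drinfeldCoeff adj f j • m.f := by
        change m.f ≫ (g ≫ m).f = _
        rw [h2, Linear.comp_smul]
        exact congrArg (fun t => hV.drinfeldCoeff adj f j • t) (Category.comp_id m.f)
      rw [hgm] at h5
      by_contra hne
      refine hm (Center.ext _ _ ((smul_eq_zero_iff_right (sub_ne_zero.mpr hne)).1 ?_))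
      rw [sub_smul, ← h5, one_smul, sub_self]
    refine ⟨g, hmg, Center.ext _ _ ?_⟩
    rw [h2, hc, one_smul]
    rfl

include adj in
theorem nonempty_conjugacyClasses : Nonempty (ConjugacyClasses R ι) := by
  obtain ⟨P, h1, h2, h3⟩ := hV.exists_drinfeldQCenter_decomposition adj hS
  exact ⟨⟨fun j => hopfObj (V j), hV.simple_hopfObj adj hS, fun j => drinfeldQCenter adj (V j), P,
    h1, h2, h3⟩⟩

end Modular

/-! ### Labelling an arbitrary decomposition -/

section Labelling

variable {κ : Type v'} [Fintype κ] (K : ConjugacyClasses R κ)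

lemma drinfeldCoeff_idem_mul_self (i : κ) (j : ι) : hV.drinfeldCoeff adj (K.idem adj i) j *
    hV.drinfeldCoeff adj (K.idem adj i) j = hV.drinfeldCoeff adj (K.idem adj i) j := by
  refine hV.smul_drinfeldQ_injective adj (j := j) ?_
  rw [← smul_smul, ← hV.drinfeldQ_adjEnd, ← Linear.smul_comp, ← hV.drinfeldQ_adjEnd, Category.assoc,
    K.adjEnd_idem_mul_self]

lemma drinfeldCoeff_idem_mul_ne {i i' : κ} (h : i ≠ i') (j : ι) :
    hV.drinfeldCoeff adj (K.idem adj i) j * hV.drinfeldCoeff adj (K.idem adj i') j = 0 := by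
  refine hV.smul_drinfeldQ_injective adj (j := j) ?_
  rw [← smul_smul, ← hV.drinfeldQ_adjEnd, ← Linear.smul_comp, ← hV.drinfeldQ_adjEnd, Category.assoc,
    K.adjEnd_idem_mul_ne adj h, comp_zero, zero_smul]

lemma sum_drinfeldCoeff_idem (j : ι) : ∑ i, hV.drinfeldCoeff adj (K.idem adj i) j = 1 := by
  refine hV.smul_drinfeldQ_injective adj (j := j) ?_
  rw [Finset.sum_smul]
  simp only [← hV.drinfeldQ_adjEnd]
  rw [← Preadditive.comp_sum, K.sum_adjEnd_idem, Category.comp_id, one_smul]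

open scoped Classical in
/-- The labelling of the conjugacy classes by the simple objects. -/
lemma exists_drinfeldCoeff_idem : ∃ σ : ι → κ, ∀ i j,
    hV.drinfeldCoeff adj (K.idem adj i) j = if i = σ j then 1 else 0 := by
  have h1 : ∀ j, ∃ i, hV.drinfeldCoeff adj (K.idem adj i) j ≠ 0 := by
    intro j
    by_contra! h
    have := hV.sum_drinfeldCoeff_idem adj K j
    simp [h] at this
  choose σ hσ using h1
  refine ⟨σ, fun i j => ?_⟩
  split_ifs with hi
  · rw [hi]
    exact mul_left_cancel₀ (hσ j) ((hV.drinfeldCoeff_idem_mul_self adj K (σ j) j).trans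
      (mul_one _).symm)
  · exact (mul_eq_zero.1 (hV.drinfeldCoeff_idem_mul_ne adj K hi j)).resolve_right (hσ j)

variable [DecidableEq ι] (hS : IsUnit (p.sMatrix k V))
include hV hS

/-- Coefficient `1` means that the Drinfeld map factors through the class. The factor is a nonzero
split mono into a simple object. -/
lemma exists_iso_cls {i : κ} {j : ι} (hij : hV.drinfeldCoeff adj (K.idem adj i) j = 1) :
    ∃ e : hopfObj (V j) ≅ K.cls i, e.hom ≫ K.incl i = drinfeldQCenter adj (V j) := by
  obtain ⟨P, hP, -, -⟩ := hV.exists_drinfeldQCenter_decomposition adj hS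
  have h1 : (drinfeldQCenter adj (V j) ≫ K.proj i) ≫ K.incl i = drinfeldQCenter adj (V j) := by
    refine Center.ext _ _ ?_
    have h2 := hV.drinfeldQ_adjEnd adj (K.idem adj i) j
    rw [hij, one_smul, K.adjEnd_idem] at h2
    exact (Category.assoc _ _ _).trans h2
  have h2 : (drinfeldQCenter adj (V j) ≫ K.proj i) ≫ K.incl i ≫ P j = 𝟙 _ := by
    rw [← Category.assoc, h1, hP]
  have := K.simple i
  have hmono : Mono (drinfeldQCenter adj (V j) ≫ K.proj i) := mono_of_mono_fac h2
  have hiso : IsIso (drinfeldQCenter adj (V j) ≫ K.proj i) := by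
    refine isIso_of_mono_of_nonzero fun h0 => hV.drinfeldQ_ne_zero adj j ?_
    rw [h0, zero_comp] at h1
    exact congrArg Center.Hom.f h1.symm
  exact ⟨asIso (drinfeldQCenter adj (V j) ≫ K.proj i), h1⟩

open scoped Classical in
lemma bijective_of_drinfeldCoeff_idem {σ : ι → κ}
    (hσ : ∀ i j, hV.drinfeldCoeff adj (K.idem adj i) j = if i = σ j then 1 else 0) :
    Function.Bijective σ := by
  constructor
  · intro j j' hjj
    by_contra hne
    obtain ⟨e, he⟩ := hV.exists_iso_cls adj K hS (i := σ j) (j := j) (by rw [hσ, if_pos rfl])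
    obtain ⟨e', he'⟩ := hV.exists_iso_cls adj K hS (i := σ j) (j := j') (by rw [hσ, if_pos hjj])
    obtain ⟨w, h1⟩ : ∃ w : (V j')ᘁ ⊗ V j' ⟶ (V j)ᘁ ⊗ V j,
        drinfeldQ adj (V j') = w ≫ drinfeldQ adj (V j) := by
      have : drinfeldQCenter adj (V j') = (e'.hom ≫ e.inv) ≫ drinfeldQCenter adj (V j) := by
        rw [← he, ← he', Category.assoc, Iso.inv_hom_id_assoc]
      exact ⟨(e'.hom ≫ e.inv).f, congrArg Center.Hom.f this⟩
    -- The Drinfeld map of `V j'` would factor through that of `V j`, although `f` fixes the former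
    -- and kills the latter.
    obtain ⟨f, hf⟩ := hV.exists_drinfeldCoeff_eq adj hS fun l => if l = j' then 1 else 0
    have h2 := hV.drinfeldQ_adjEnd adj f j'
    rw [h1, Category.assoc, hV.drinfeldQ_adjEnd, hf, hf, if_pos rfl, if_neg hne, zero_smul,
      comp_zero, ← h1, one_smul] at h2
    exact hV.drinfeldQ_ne_zero adj j' h2.symm
  · intro i
    by_contra! h
    -- An unlabelled class would have an idempotent with all coefficients zero, although it is a
    -- nonzero object.
    have h0 : K.idem adj i = 0 := by
      refine hV.drinfeldCoeff_injective adj hS (funext fun j => ?_)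
      rw [hσ, if_neg (h j).symm, ← zero_smul k (0 : CF R), hV.drinfeldCoeff_smul, zero_mul]
    have h1 : K.proj i ≫ K.incl i = 0 := by
      refine Center.ext _ _ ?_
      rw [← K.adjEnd_idem adj, h0, ← zero_smul k (0 : CF R), adjEnd, adjLift_smul, zero_smul]
      rfl
    have := K.simple i
    apply id_nonzero (K.cls i)
    calc
      𝟙 (K.cls i) = K.incl i ≫ (K.proj i ≫ K.incl i) ≫ K.proj i := by
        rw [Category.assoc, K.incl_proj_self, Category.comp_id, K.incl_proj_self]
      _ = 0 := by rw [h1, zero_comp, comp_zero]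

lemma size_eq {i : κ} {j : ι} (hij : hV.drinfeldCoeff adj (K.idem adj i) j = 1) :
    K.size k p i = d j ^ 2 := by
  obtain ⟨e, -⟩ := hV.exists_iso_cls adj K hS hij
  rw [← hV.trace_hopfObj j, p.trace_id_congr ((Center.forget C).mapIso e)]
  rfl

omit hS in
lemma isCentralIdempotent_iff (f : CF R) (j : ι) :
    IsCentralIdempotent adj V j (drinfeldMap adj f) ↔
      ∀ i, hV.drinfeldCoeff adj f i = if i = j then 1 else 0 := by
  have h : toNat adj (drinfeldMap adj f) = drinfeldNat adj f :=
    Function.invFun_eq ((hV.toNat_bijective adj hV.sums).2 _)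
  refine forall_congr' fun i => ?_
  rw [h, hV.coeff_smul i ((drinfeldNat adj f).app (V i))]
  change hV.drinfeldCoeff adj f i • _ = _ ↔ _
  have h0 := hV.id_ne_zero i
  constructor
  · intro h1
    by_contra hne
    apply h0
    refine (smul_eq_zero_iff_right (sub_ne_zero.mpr hne)).1 ?_
    rw [sub_smul, h1]
    split_ifs <;> simp
  · intro h1
    rw [h1]
    split_ifs <;> simp

end Labelling

end SphericalBasis

end

/-! ### Cointegrals of centralizers and inversion of the Fourier transform -/

section

variable {k : Type w} [Field k] {C : Type u} [Category.{v} C] [Abelian C] [Linear k C]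
  [MonoidalCategory C] [MonoidalPreadditive C] [MonoidalLinear k C] [RigidCategory C]
  [BraidedCategory C] {p : PivotalStructure C} {ι : Type u'} [Fintype ι] {V : ι → C} {d : ι → k}

/-- An object centralizes a fusion subcategory if it centralizes its simple objects. -/
lemma SimpleBasis.invMono_eq_id (hV : SimpleBasis k V) {E : FusionSubcategory C} {X : C}
    (h : ∀ i, E.prop (V i) → invMono X (V i) = 𝟙 _) {Y : C} (hY : E.prop Y) :
    invMono X Y = 𝟙 _ := by
  obtain ⟨n, a, b, hab⟩ := hV.decomp Y
  rw [← Category.id_comp (invMono X Y), ← MonoidalCategory.whiskerLeft_id, ← hab]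
  simp only [whiskerLeft_sum, Preadditive.sum_comp]
  refine Finset.sum_congr rfl fun i _ => Finset.sum_congr rfl fun α _ => ?_
  rw [MonoidalCategory.whiskerLeft_comp, Category.assoc, invMono_naturality]
  by_cases ha : a i α = 0
  · rw [ha]
    simp
  · obtain ⟨r⟩ := hV.retract_of_ne_zero ha
    rw [h i (E.retract.of_retract r hY), Category.id_comp]

namespace SphericalBasis

variable (hV : SphericalBasis k p V d) {R : C ⥤ Center C} (adj : Center.forget C ⊣ R)
  [DecidableEq ι] (hS : IsUnit (p.sMatrix k V))
include hV hS

/-- The double centralizer theorem, transferred to the generated centralizer, which has the same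
simple objects as `D.centralizing`. -/
lemma centralizes_centralizer_iff (hsimple : ∀ i, Simple (V i)) (D : FusionSubcategory C) (j : ι) :
    (∀ Y, D.centralizer.prop Y → invMono (V j) Y = 𝟙 _) ↔ D.prop (V j) := by
  refine ⟨fun h => ?_, fun h Y hY => ?_⟩
  · rw [← hV.centralizing_centralizing hS D j]
    intro Y hY
    refine invMono_eq_id_symm (hV.invMono_eq_id (E := D.centralizing) (fun i hi => ?_) hY)
    exact h _ ((D.centralizer_prop_iff (hsimple i)).2 fun Y hY => invMono_eq_id_symm (hi Y hY))
  · refine hV.invMono_eq_id (E := D.centralizer) (fun i hi => ?_) hY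
    exact invMono_eq_id_symm ((D.centralizer_prop_iff (hsimple i)).1 hi _ h)

open scoped Classical in
/-- The idempotent cointegral of the centralizer of `D` is the class function whose image under
the Drinfeld map is the sum of the idempotents of the simple objects of `D`. -/
theorem exists_cointegral_centralizer (hsimple : ∀ i, Simple (V i)) (D : FusionSubcategory C) :
    ∃ lam : CF R, (∀ mu : CF R, IsIdempotentCointegralOf adj D.centralizer mu ↔ mu = lam) ∧
      ∀ j, hV.drinfeldCoeff adj lam j = if D.prop (V j) then 1 else 0 := by
  have hcoeff : ∀ mu : CF R, IsIdempotentCointegralOf adj D.centralizer mu →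
      ∀ j, hV.drinfeldCoeff adj mu j = if D.prop (V j) then 1 else 0 := by
    rintro mu ⟨RE, adjE, lamE, q, hlam, hq, rfl⟩ j
    rw [hV.drinfeldCoeff_restriction adj D.centralizer adjE hq hlam j]
    exact if_congr (hV.centralizes_centralizer_iff hS hsimple D j) rfl rfl
  obtain ⟨lam, hlam⟩ : ∃ lam : CF R, IsIdempotentCointegralOf adj D.centralizer lam := by
    let _ := D.centralizer.rigid
    have := (hV.toSimpleBasis.fullSubcategory D.centralizer).isLeftAdjoint_forget
      D.centralizer.hasSums
    let adjE := Adjunction.ofIsLeftAdjoint (Center.forget D.centralizer.prop.FullSubcategory)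
    obtain ⟨q, hq⟩ := hV.exists_restriction adj D.centralizer adjE
    obtain ⟨lamE, hlamE⟩ := hV.exists_cointegral_fullSubcategory D.centralizer adjE
      (hV.globalDim_ne_zero hS D.centralizer)
    exact ⟨_, _, adjE, lamE, q, hlamE, hq, rfl⟩
  refine ⟨lam, fun mu => ⟨fun hmu => hV.drinfeldCoeff_injective adj hS ?_, ?_⟩, hcoeff lam hlam⟩
  · funext j
    rw [hcoeff mu hmu, hcoeff lam hlam]
  · rintro rfl
    exact hlam

omit hS in
lemma fourier_add (t : ι → k) (a b : CE R) :
    fourier adj (∑ i, t i • character adj p (V i)) (a + b) =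
      fourier adj (∑ i, t i • character adj p (V i)) a +
        fourier adj (∑ i, t i • character adj p (V i)) b := by
  obtain ⟨τ, hτ⟩ := hV.toSimpleBasis.exists_dualNat_coeff
  have h : ∀ i, hV.coeff i ((toNat adj (a + b)).app (V i)) =
      hV.coeff i ((toNat adj a).app (V i)) + hV.coeff i ((toNat adj b).app (V i)) := by
    intro i
    refine hV.coeff_eq i ?_
    rw [add_smul, ← hV.coeff_smul i ((toNat adj a).app (V i)),
      ← hV.coeff_smul i ((toNat adj b).app (V i))]
    simp [toNat]
  simp only [hV.fourier_eq, hτ, h, mul_add, add_smul, Finset.sum_add_distrib]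

/-- The inverse of an additive bijection is additive. -/
lemma fourierInv_sum {lam : CF R} (hlam : IsIdempotentCointegral adj lam) {J : Type*}
    (s : Finset J) (f : J → CF R) :
    fourierInv adj lam (∑ j ∈ s, f j) = ∑ j ∈ s, fourierInv adj lam (f j) := by
  obtain ⟨t, ht, h⟩ := hV.exists_cointegral adj hS
  rw [h] at hlam
  subst hlam
  have hb := hV.fourier_bijective adj hS ht
  have hinv : ∀ f, fourier adj (∑ i, t i • character adj p (V i))
      (fourierInv adj (∑ i, t i • character adj p (V i)) f) = f := fun f =>
    Function.invFun_eq (hb.2 f)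
  apply hb.1
  rw [hinv]
  refine Eq.symm ((map_sum (AddMonoidHom.mk' _ (hV.fourier_add adj t)) _ s).trans ?_)
  exact Finset.sum_congr rfl fun j _ => hinv (f j)

open scoped Classical in
-- Coefficients are faithful, and a sum of idempotents over `L` has as coefficients the indicator of
-- the preimage of `L` under `σ`.
lemma eq_sum_idem_iff {κ : Type v'} [Fintype κ] (K : ConjugacyClasses R κ) {σ : ι ≃ κ}
    (hσ : ∀ i j, hV.drinfeldCoeff adj (K.idem adj i) j = if i = σ j then 1 else 0) {f : CF R}
    {P : ι → Prop} (hf : ∀ j, hV.drinfeldCoeff adj f j = if P j then 1 else 0) (L : Finset κ) :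
    f = ∑ i ∈ L, K.idem adj i ↔ L = ({j | P j} : Finset ι).map σ.toEmbedding := by
  rw [← (hV.drinfeldCoeff_injective adj hS).eq_iff, funext_iff, Finset.ext_iff,
    ← σ.forall_congr_right]
  refine forall_congr' fun j => ?_
  rw [hf, hV.drinfeldCoeff_sum]
  simp only [hσ, Finset.sum_ite_eq', Finset.mem_map_equiv, Equiv.symm_apply_apply,
    Finset.mem_filter, Finset.mem_univ, true_and]
  by_cases h1 : P j <;> by_cases h2 : σ j ∈ L <;> simp [h1, h2]

end SphericalBasis

end

end FusionCat

end

/-! ### Assembly of the theorem -/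

open FusionCat in
open scoped Classical in
theorem theorem6p9 {k : Type w} [Field k] [IsAlgClosed k]
    {C : Type u} [Category.{v} C] [Abelian C] [Linear k C]
    [MonoidalCategory C] [MonoidalPreadditive C] [MonoidalLinear k C] [RigidCategory C]
    [BraidedCategory C] (hC : IsFusion k C) (p : SphericalStructure C)
    {ι : Type u'} [Fintype ι] (V : ι → C) (hV : IsSimpleFamily V)
    (hS : IsUnit (p.sMatrix k V)) :
    (Center.forget C).IsLeftAdjoint ∧
    ∀ (R : C ⥤ Center C) (adj : Center.forget C ⊣ R),
      Function.Bijective (toNat adj) ∧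
      ∃ lam : CF R, (∀ mu : CF R, IsIdempotentCointegral adj mu ↔ mu = lam) ∧
        Function.Bijective (fourier adj lam) ∧
        Nonempty (ConjugacyClasses R ι) ∧
        ∀ (κ : Type v') [Fintype κ] (K : ConjugacyClasses R κ),
          ∃ σ : ι ≃ κ,
            (∀ τ : ι ≃ κ,
              (∀ j, IsCentralIdempotent adj V j (drinfeldMap adj (K.idem adj (τ j)))) ↔ τ = σ) ∧
            (∀ j, K.size k p.toPivotalStructure (σ j) = p.dim k (V j) ^ 2) ∧
            ∀ D : FusionSubcategory C, ∃ lamD' : CF R,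
              (∀ mu : CF R, IsIdempotentCointegralOf adj D.centralizer mu ↔ mu = lamD') ∧
              fourierInv adj lam lamD' =
                ∑ j with D.prop (V j), K.classSum adj lam (σ j) ∧
              ∀ L : Finset κ, lamD' = ∑ i ∈ L, K.idem adj i ↔
                L = ({j | D.prop (V j)} : Finset ι).map σ.toEmbedding := by
  have hB := hC.sphericalBasis p hV
  refine ⟨hB.isLeftAdjoint_forget hB.sums, fun R adj =>
    ⟨hB.toNat_bijective adj hB.sums, ?_⟩⟩
  obtain ⟨t, ht, hlam⟩ := hB.exists_cointegral adj hS
  refine ⟨_, hlam, hB.fourier_bijective adj hS ht, hB.nonempty_conjugacyClasses adj hS,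
    fun κ _ K => ?_⟩
  obtain ⟨σ', hσ⟩ := hB.exists_drinfeldCoeff_idem adj K
  obtain ⟨σ, rfl⟩ : ∃ σ : ι ≃ κ, σ' = σ :=
    ⟨Equiv.ofBijective σ' (hB.bijective_of_drinfeldCoeff_idem adj K hS hσ), rfl⟩
  refine ⟨σ, fun τ => ⟨fun h => Equiv.ext fun j => ?_, ?_⟩, fun j => ?_, fun D => ?_⟩
  -- The class labelled `j` must have coefficient `1` at `j`, and only the class `σ j` does.
  · have h1 := (hB.isCentralIdempotent_iff adj _ j).1 (h j) j
    rw [hσ, if_pos rfl] at h1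
    by_contra hne
    rw [if_neg hne] at h1
    exact zero_ne_one h1
  · rintro rfl j
    rw [hB.isCentralIdempotent_iff adj]
    intro i
    rw [hσ]
    exact if_congr (τ.apply_eq_iff_eq.trans eq_comm) rfl rfl
  · exact hB.size_eq adj K hS (by rw [hσ, if_pos rfl])
  · obtain ⟨lamD, hD, hcoeff⟩ := hB.exists_cointegral_centralizer adj hS hV.simple D
    have hL := hB.eq_sum_idem_iff adj hS K hσ hcoeff
    refine ⟨lamD, hD, ?_, hL⟩
    -- The cointegral of `D'` is the sum of the idempotents labelled by `D`; additivity of the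
    -- inverse transform turns it into the sum of the class sums.
    rw [(hL _).2 rfl, hB.fourierInv_sum adj hS ((hlam _).2 rfl), Finset.sum_map]
    rfl
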